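/- Let $\kappa>0$, $\nu\ge 1$, $\alpha\in\mathbb R$, $m\in\{0,1,2,\dots\}$, and let $l,l'>\tfrac12$ with $l+l'=\nu+1$. Put $a=1/\kappa$, and on $(0,\pi a)$ let $W(x;l,l')=-\frac1{2a}\bigl[l\cot\frac{x}{2a}-l'\tan\frac{x}{2a}\bigr]$. With $a_s=\nu+1+2(s-1)$, $\mathcal R(a_s)=\kappa^2(a_s+1)$ and $E_n=\sum_{k=1}^n\mathcal R(a_k)=\kappa^2n(n+\nu+1)$, let $|\Psi_n\rangle\in L^2((0,\pi a),dx)$ be the normalized eigenstates of the Pöschl–Teller Hamiltonian: $\Psi_0(x;l,l')$ is $\sin^l\frac{x}{2a}\cos^{l'}\frac{x}{2a}$, normalized, and $$\Psi_{n+1}(x;l,l')=E_{n+1}^{-1/2}\Bigl(-\frac{d}{dx}+W(x;l,l')\Bigr)\Psi_n(x;l+1,l'+1),$$ where the factor $E_{n+1}=\kappa^2(n+1)(n+1+l+l')$ is formed with the parameters $(l,l')$ of the left-hand side. Let $\mathfrak H_m$ be the closed linear span of $\{|\Psi_{n+m}\rangle:n\ge0\}$. For $\mathcal Z_j=\sqrt{g(a_j;\kappa,\kappa)\,g(a_j;\kappa,0)}\;e^{-i\alpha\mathcal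 R(a_j)}$, where $g(b;c,d)=cb+d$, put $$K_n^m=\frac{\Bigl[\prod_{k=m+1}^{n+m}\sum_{s=k}^{n+m}\mathcal R(a_s)\Bigr]^{1/2}}{\prod_{k=m}^{n+m-1}\mathcal Z_{1+k}\;\Bigl[\prod_{k=1}^{m}\sum_{s=k}^{n+m}\mathcal R(a_s)\Bigr]^{1/2}} .$$ For $|z|<1$ and coefficients $d_n\in\mathbb C$ put $|z\rangle_m=\bigl(\sum_{n\ge0}|d_n|^2|z|^{2n}\bigr)^{-1/2}\sum_{n\ge0}d_nz^n|\Psi_{n+m}\rangle$. The photon-added coherent states are these vectors with (a) $d_n=1/K_n^m$, or, in closed form, (b) $$d_n=\sqrt{\kappa^{2m}\,\frac{\Gamma(n+m+1)\,\Gamma(n+2m+\nu+1)^2}{\Gamma(n+1)^2\,\Gamma(n+m+\nu+1)\,\Gamma(2m+\nu+1)}}\;e^{-i\alpha E_n}.$$ (For each $n$ the coefficients in (a) and (b) have the same modulus.) For $0<x<1$ let $$\omega_m(x)=\frac1\pi\,G^{1,3}_{3,3}\!\left(-x\,\middle|\,\begin{matrix}-m,\,-2m-\nu,\,-2m-\nu\\0,\,0,\,-m-\nu\end{matrix}\right)G^{3,0}_{3,3}\!\left(x\,\middle|\,\begin{matrix}m,\,2m+\nu,\,2m+\nu\\0,\,0,\,m+\nu\end{matrix}\right).$$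 Here, for $0<|y|<1$, the Meijer function $G^{M,N}_{p,p}\bigl(y\,\big|\,{}^{\alpha_1,\dots,\alpha_p}_{\beta_1,\dots,\beta_p}\bigr)$ is $$\frac1{2\pi i}\int_L\frac{\prod_{j\le M}\Gamma(\beta_j+s)\prod_{j\le N}\Gamma(1-\alpha_j-s)}{\prod_{j>M}\Gamma(1-\beta_j-s)\prod_{j>N}\Gamma(\alpha_j+s)}\,y^{-s}\,ds,$$ with $L$ a loop that starts and ends at $-\infty$ and encircles, once in the positive sense, the poles of all $\Gamma(\beta_j+s)$ with $j\le M$ and no pole of $\Gamma(1-\alpha_j-s)$ with $j\le N$. Then $\omega_m$ is real and non-negative on $(0,1)$, and for each of the families (a) and (b) the vectors $|z\rangle_m$ lie in $\mathfrak H_m$ and resolve its identity with weight $\omega_m$: $$\int_{|z|<1}d^2z\;|z\rangle_m\,\omega_m(|z|^2)\,{}_m\langle z|=\mathbf 1_{\mathfrak H_m}$$ in the weak sense, that is, for all $\varphi,\chi\in\mathfrak H_m$ the function $z\mapsto\langle\varphi|z\rangle_m\,\omega_m(|z|^2)\,{}_m\langle z|\chi\rangle$ is Lebesgue integrable on the unit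 disk with integral $\langle\varphi|\chi\rangle$. Moreover, for $m=0$, $\omega_0(|z|^2)=\frac{\nu}{\pi}(1-|z|^2)^{-2}$ for $0<|z|<1$. -/

import Mathlib

open MeasureTheory

noncomputable section

namespace PoschlTeller

/-! ### Meijer's G-function -/

/-- The quotient of Gamma functions in the Mellin-Barnes integral of `G^{m,n}_{p,q}(· | a; b)`,
`∏_{j ≤ m} Γ(b_j + s) ∏_{j ≤ n} Γ(1 - a_j - s) / (∏_{j > m} Γ(1 - b_j - s) ∏_{j > n} Γ(a_j + s))`.
The parameters are indexed from `0`.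
A zero of the denominator in Mathlib's convention is a pole of a Gamma function there, where the
reciprocal Gamma function vanishes, in agreement with `x / 0 = 0`. -/
def meijerKernel {p q : ℕ} (m n : ℕ) (a : Fin p → ℂ) (b : Fin q → ℂ) (s : ℂ) : ℂ :=
  ((∏ j with j.val < m, Complex.Gamma (b j + s)) *
      ∏ j with j.val < n, Complex.Gamma (1 - a j - s)) /
    ((∏ j with m ≤ j.val, Complex.Gamma (1 - b j - s)) *
      ∏ j with n ≤ j.val, Complex.Gamma (a j + s))

/-- `(1 / 2πi) ∫ f(s) ds` over the loop that comes from `-∞ - iT`, runs to `c - iT`, up to `c + iT`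
and back to `-∞ + iT`. -/
def loopIntegral (c T : ℝ) (f : ℂ → ℂ) : ℂ :=
  (1 / (2 * (Real.pi : ℂ) * Complex.I)) *
    ((∫ u in Set.Iic c, f ((u : ℂ) - (T : ℂ) * Complex.I)) +
      (∫ t in -T..T, f ((c : ℂ) + (t : ℂ) * Complex.I)) * Complex.I -
      ∫ u in Set.Iic c, f ((u : ℂ) + (T : ℂ) * Complex.I))

/-- The largest real part of the poles of `Γ(b_j + s)`, `j ≤ m`. -/
def leftAbscissa {q : ℕ} (m : ℕ) (b : Fin q → ℂ) : ℝ :=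
  sSup {r | ∃ j : Fin q, j.val < m ∧ r = -(b j).re}

/-- The smallest of `leftAbscissa + 1` and of the real parts of the poles of
`Γ(1 - a_j - s)`, `j ≤ n`. -/
def rightAbscissa {p q : ℕ} (m n : ℕ) (a : Fin p → ℂ) (b : Fin q → ℂ) : ℝ :=
  sInf (insert (leftAbscissa m b + 1) {r | ∃ j : Fin p, j.val < n ∧ r = 1 - (a j).re})

/-- A height that exceeds all `|Im b_j|`. -/
def loopHeight {q : ℕ} (b : Fin q → ℂ) : ℝ := 1 + ∑ j, |(b j).im|

/-- Meijer's function `G^{m,n}_{p,q}(z | a; b)`, in the convention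
`(1 / 2πi) ∫_L ∏ Γ(b_j + s) ∏ Γ(1 - a_j - s) / (∏ Γ(1 - b_j - s) ∏ Γ(a_j + s)) z^{-s} ds`,
where `L` is a loop that starts and ends at `-∞` and encircles the poles of the `Γ(b_j + s)`,
`j ≤ m`, once in the positive sense, and none of the poles of the `Γ(1 - a_j - s)`, `j ≤ n`.
This is the standard definition for `p < q`, `z ≠ 0` and for `p = q`, `0 < |z| < 1`. The loop used
here is one such loop whenever a vertical line separates the two families of poles, that is,
`leftAbscissa < rightAbscissa`; by Cauchy's theorem the value does not depend on the loop. -/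
def meijerG {p q : ℕ} (m n : ℕ) (a : Fin p → ℂ) (b : Fin q → ℂ) (z : ℂ) : ℂ :=
  loopIntegral ((leftAbscissa m b + rightAbscissa m n a b) / 2) (loopHeight b)
    fun s => meijerKernel m n a b s * z ^ (-s)

/-! ### Pöschl-Teller eigenstates

The potential parameters are `a_1 = (l, l')`, `a_2 = (l + 1, l' + 1)`, and so on. They enter the
remainder and the energies only through the sum of the two entries, so the `s`-th parameter is also
encoded by the real number `a_s = a_1 + 2 (s - 1)`, with `a_1 = l + l' = 2ρ`.  The width of the
well is `π a`, and `lam = 1 / a`. -/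

/-- The superpotential `W(x; l, l') = -(1 / 2a) (l cot (x / 2a) - l' tan (x / 2a))`. -/
def superpotential (a l l' x : ℝ) : ℝ :=
  -(1 / (2 * a)) * (l * Real.cot (x / (2 * a)) - l' * Real.tan (x / (2 * a)))

/-- The parameter `a_s = a_1 + 2 (s - 1)`, `s ≥ 1`. -/
def param (a₁ : ℝ) (s : ℕ) : ℝ := a₁ + 2 * ((s : ℝ) - 1)

/-- The remainder `R(a_s) = lam² (a_s + 1)` of the shape invariance condition. -/
def remainder (lam b : ℝ) : ℝ := lam ^ 2 * (b + 1)

/-- The eigenvalue `E_n = ∑_{k = 1}^n R(a_k)`. -/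
def energy (lam a₁ : ℝ) (n : ℕ) : ℝ := ∑ k ∈ Finset.Icc 1 n, remainder lam (param a₁ k)

/-- The zero mode `sin^l (x / 2a) cos^l' (x / 2a)` of `d/dx + W(x; l, l')`, not normalized. -/
def groundShape (a l l' x : ℝ) : ℝ :=
  Real.sin (x / (2 * a)) ^ l * Real.cos (x / (2 * a)) ^ l'

/-- The normalized eigenfunctions on `(0, π a)`: `Ψ_0(x; l, l')` is the normalized zero mode, and
`Ψ_{n+1}(x; l, l') = E_{n+1}^{-1/2} (-d/dx + W(x; l, l')) Ψ_n(x; l + 1, l' + 1)`. -/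
def eigenfunction (a : ℝ) : ℕ → ℝ → ℝ → ℝ → ℝ
  | 0, l, l', x =>
      groundShape a l l' x / Real.sqrt (∫ y in Set.Ioo 0 (Real.pi * a), groundShape a l l' y ^ 2)
  | n + 1, l, l', x =>
      (-(deriv (eigenfunction a n (l + 1) (l' + 1)) x) +
          superpotential a l l' x * eigenfunction a n (l + 1) (l' + 1) x) /
        Real.sqrt (energy (1 / a) (l + l') (n + 1))

/-- Lebesgue measure on `(0, π a)`. -/
abbrev wellMeasure (a : ℝ) : Measure ℝ := volume.restrict (Set.Ioo 0 (Real.pi * a))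

/-- The Hilbert space `L²((0, π a), dx)`. -/
abbrev WellSpace (a : ℝ) : Type := Lp ℂ 2 (wellMeasure a)

theorem eigenfunction_eq (a : ℝ) (ha : 0 < a) (n : ℕ) : ∀ l l' : ℝ,
    ∃ P : Polynomial ℝ, ∀ x ∈ Set.Ioo 0 (Real.pi * a),
      eigenfunction a n l l' x = groundShape a l l' x * P.eval (Real.sin (x / (2 * a)) ^ 2) := by
  induction n with
  | zero =>
    intro l l'
    refine ⟨Polynomial.C (1 / Real.sqrt
      (∫ y in Set.Ioo 0 (Real.pi * a), groundShape a l l' y ^ 2)), fun x _ => ?_⟩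
    simp [eigenfunction, div_eq_mul_inv]
  | succ n ih =>
    intro l l'
    obtain ⟨P, hP⟩ := ih (l + 1) (l' + 1)
    set D := Real.sqrt (energy (1 / a) (l + l') (n + 1)) with hD
    refine ⟨Polynomial.C (-(1 / (2 * a * D))) *
      ((Polynomial.C (2 * l + 1) * (1 - Polynomial.X) -
        Polynomial.C (2 * l' + 1) * Polynomial.X) * P +
        2 * Polynomial.X * (1 - Polynomial.X) * Polynomial.derivative P), fun x hx => ?_⟩
    have hu0 : 0 < x / (2 * a) := div_pos hx.1 (by positivity)
    have hu1 : x / (2 * a) < Real.pi / 2 := by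
      rw [div_lt_div_iff₀ (by positivity) (by norm_num)]
      nlinarith [hx.2]
    have hs : 0 < Real.sin (x / (2 * a)) :=
      Real.sin_pos_of_pos_of_lt_pi hu0 (by linarith [Real.pi_pos])
    have hc : 0 < Real.cos (x / (2 * a)) :=
      Real.cos_pos_of_mem_Ioo ⟨by linarith [Real.pi_pos], hu1⟩
    have hu : HasDerivAt (fun y : ℝ => y / (2 * a)) (1 / (2 * a)) x := by
      simpa using (hasDerivAt_id x).div_const (2 * a)
    have hsin := hu.sin
    have hcos := hu.cos
    have h1 := hsin.rpow_const (p := l + 1) (Or.inl hs.ne')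
    have h2 := hcos.rpow_const (p := l' + 1) (Or.inl hc.ne')
    have h3 : HasDerivAt (fun y : ℝ => P.eval (Real.sin (y / (2 * a)) ^ 2)) _ x :=
      (P.hasDerivAt _).comp x (hsin.pow 2)
    have h4 := (h1.mul h2).mul h3
    have hder : deriv (eigenfunction a n (l + 1) (l' + 1)) x = _ :=
      (h4.congr_of_eventuallyEq (by
        filter_upwards [isOpen_Ioo.mem_nhds hx] with y hy
        simpa [groundShape] using hP y hy)).deriv
    have e1 : Real.sin (x / (2 * a)) ^ (l + 1)
        = Real.sin (x / (2 * a)) ^ l * Real.sin (x / (2 * a)) := Real.rpow_add_one hs.ne' l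
    have e2 : Real.cos (x / (2 * a)) ^ (l' + 1)
        = Real.cos (x / (2 * a)) ^ l' * Real.cos (x / (2 * a)) := Real.rpow_add_one hc.ne' l'
    have hsc : Real.cos (x / (2 * a)) ^ 2 = 1 - Real.sin (x / (2 * a)) ^ 2 := by
      rw [← Real.sin_sq_add_cos_sq (x / (2 * a))]; ring
    simp only [eigenfunction]
    rw [hder, hP x hx, ← hD]
    simp only [groundShape, superpotential, Real.cot_eq_cos_div_sin, Real.tan_eq_sin_div_cos,
      e1, e2, add_sub_cancel_right, Polynomial.eval_mul, Polynomial.eval_add, Polynomial.eval_sub,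
      Polynomial.eval_C, Polynomial.eval_X, Polynomial.eval_one, Polynomial.eval_ofNat,
      Pi.mul_apply]
    rw [← hsc]
    by_cases hD0 : D = 0
    · simp [hD0]
    · field_simp
      ring

theorem memLp_eigenfunction (a l l' : ℝ) (ha : 0 < a) (hl : 1 / 2 < l) (hl' : 1 / 2 < l')
    (n : ℕ) : MemLp (fun x => (eigenfunction a n l l' x : ℂ)) 2 (wellMeasure a) := by
  obtain ⟨P, hP⟩ := eigenfunction_eq a ha n l l'
  have hcont : Continuous fun x : ℝ =>
      ((groundShape a l l' x * P.eval (Real.sin (x / (2 * a)) ^ 2) : ℝ) : ℂ) := by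
    refine Complex.continuous_ofReal.comp (Continuous.mul (Continuous.mul ?_ ?_) ?_)
    · exact (Real.continuous_rpow_const (by linarith)).comp
        (Real.continuous_sin.comp (by fun_prop))
    · exact (Real.continuous_rpow_const (by linarith)).comp
        (Real.continuous_cos.comp (by fun_prop))
    · exact P.continuous.comp (by fun_prop)
  obtain ⟨C, hC⟩ := (isCompact_Icc (a := (0 : ℝ)) (b := Real.pi * a)).exists_bound_of_continuousOn
    hcont.continuousOn
  have hmem : MemLp (fun x : ℝ =>
      ((groundShape a l l' x * P.eval (Real.sin (x / (2 * a)) ^ 2) : ℝ) : ℂ)) 2 (wellMeasure a) :=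
    MemLp.of_bound hcont.aestronglyMeasurable C
      ((ae_restrict_iff' measurableSet_Ioo).2
        (Filter.Eventually.of_forall fun x hx => hC x (Set.Ioo_subset_Icc_self hx)))
  exact hmem.ae_eq ((ae_restrict_iff' measurableSet_Ioo).2
    (Filter.Eventually.of_forall fun x hx => by simp only [hP x hx]))

/-- The eigenstate `|Ψ_n⟩` as a vector of `L²((0, π a), dx)`. -/
def eigenstate (a l l' : ℝ) (ha : 0 < a) (hl : 1 / 2 < l) (hl' : 1 / 2 < l') (n : ℕ) :
    WellSpace a :=
  (memLp_eigenfunction a l l' ha hl hl' n).toLp _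

/-! ### Photon-added coherent states -/

section States

variable {H : Type*} [NormedAddCommGroup H] [InnerProductSpace ℂ H]

/-- The Hilbert subspace `𝔥_m`, the closed span of `|Ψ_{n+m}⟩`, `n ≥ 0`. -/
def tailSpace (Ψ : ℕ → H) (m : ℕ) : Submodule ℂ H :=
  (Submodule.span ℂ (Set.range fun n => Ψ (n + m))).topologicalClosure

/-- The vector `(∑ |d_n|² |z|^{2n})^{-1/2} ∑ d_n z^n |Ψ_{n+m}⟩`. -/
def photonAdded (Ψ : ℕ → H) (d : ℕ → ℂ) (m : ℕ) (z : ℂ) : H :=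
  (((∑' n, ‖d n‖ ^ 2 * ‖z‖ ^ (2 * n)) ^ (-(1 / 2) : ℝ) : ℝ) : ℂ) •
    ∑' n, (d n * z ^ n) • Ψ (n + m)

/-- `∫_{|z| < 1} |v_z⟩ w(|z|²) ⟨v_z| d²z = 1` on the subspace `𝔥`, in the weak sense, for vectors
`v_z` of `𝔥`. Mathlib's `inner ℂ` is antilinear in its first argument. -/
def ResolvesIdentity (𝔥 : Submodule ℂ H) (v : ℂ → H) (w : ℝ → ℂ) : Prop :=
  (∀ z ∈ Metric.ball (0 : ℂ) 1, v z ∈ 𝔥) ∧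
    ∀ φ ∈ 𝔥, ∀ χ ∈ 𝔥,
      IntegrableOn (fun z => inner ℂ φ (v z) * w (‖z‖ ^ 2) * inner ℂ (v z) χ)
        (Metric.ball (0 : ℂ) 1) ∧
      ∫ z in Metric.ball (0 : ℂ) 1, inner ℂ φ (v z) * w (‖z‖ ^ 2) * inner ℂ (v z) χ
        = inner ℂ φ χ

end States

/-- The auxiliary function `g(b; c, d) = c b + d`. -/
def auxG (b c d : ℝ) : ℝ := c * b + d

/-- The functional `Z_j = √(g(a_j; κ, κ) g(a_j; κ, 0)) e^{-i α R(a_j)}` (with `lam = κ`). -/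
def functionalZ (κ α a₁ : ℝ) (j : ℕ) : ℂ :=
  (Real.sqrt (auxG (param a₁ j) κ κ * auxG (param a₁ j) κ 0) : ℂ) *
    Complex.exp (-Complex.I * α * (remainder κ (param a₁ j) : ℂ))

/-- The expansion coefficient `K_n^m` of the photon-added coherent states of a shape invariant
potential with remainders `R(a_s) = R s` and functional `Z_j`, `j = 1`:
`(∏_{k=m+1}^{n+m} ∑_{s=k}^{n+m} R(a_s))^{1/2} /
  ((∏_{k=m}^{n+m-1} Z_{1+k}) (∏_{k=1}^{m} ∑_{s=k}^{n+m} R(a_s))^{1/2})`. -/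
def expansionCoeff (R : ℕ → ℝ) (Z : ℕ → ℂ) (m n : ℕ) : ℂ :=
  (Real.sqrt (∏ k ∈ Finset.Icc (m + 1) (n + m), ∑ s ∈ Finset.Icc k (n + m), R s) : ℂ) /
    ((∏ k ∈ Finset.Ico m (n + m), Z (1 + k)) *
      (Real.sqrt (∏ k ∈ Finset.Icc 1 m, ∑ s ∈ Finset.Icc k (n + m), R s) : ℂ))

/-- The coefficients `1 / K_n^m` for the second choice of `Z_j`, with `a_1 = ν + 1`. -/
def secondCoeff (κ α ν : ℝ) (m n : ℕ) : ℂ :=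
  1 / expansionCoeff (fun s => remainder κ (param (ν + 1) s)) (functionalZ κ α (ν + 1)) m n

/-- The coefficients of the closed form of the photon-added coherent states,
`√(κ^{2m} Γ(n+m+1) Γ(n+2m+ν+1)² / (Γ(n+1)² Γ(n+m+ν+1) Γ(2m+ν+1))) e^{-i α E_n}`. -/
def explicitCoeff (κ α ν : ℝ) (m n : ℕ) : ℂ :=
  (Real.sqrt (κ ^ (2 * m) *
      (Real.Gamma (n + m + 1) * Real.Gamma (n + 2 * m + ν + 1) ^ 2 /
        (Real.Gamma (n + 1) ^ 2 * Real.Gamma (n + m + ν + 1) * Real.Gamma (2 * m + ν + 1)))) : ℂ) *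
    Complex.exp (-Complex.I * α * (energy κ (ν + 1) n : ℂ))

/-- The weight `ω_m(x) = (1/π) G^{1,3}_{3,3}(-x | -m, -2m-ν, -2m-ν; 0, 0, -m-ν)
  G^{3,0}_{3,3}(x | m, 2m+ν, 2m+ν; 0, 0, m+ν)`. -/
def weight (ν : ℝ) (m : ℕ) (x : ℝ) : ℂ :=
  (1 / (Real.pi : ℂ)) *
    meijerG 1 3 ![-(m : ℂ), -2 * m - ν, -2 * m - ν] ![0, 0, -(m : ℂ) - ν] (-(x : ℂ)) *
    meijerG 3 0 ![(m : ℂ), 2 * m + ν, 2 * m + ν] ![0, 0, (m : ℂ) + ν] (x : ℂ)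

end PoschlTeller

end

noncomputable section

namespace PoschlTeller

/-! ### Orthonormality of the eigenstates -/

/-! Write c_n = Γ(n+m+1) Γ(n+2m+ν+1)² / (Γ(n+1)² Γ(n+m+ν+1)), which is `meijerCoeff`. Both families
of coefficients satisfy |d_n|² = C c_n with the same C = κ^{2m} / Γ(2m+ν+1) (`norm_secondCoeff_sq`,
`norm_explicitCoeff_sq`), and the resolution of the identity depends on the moduli only.

Angular integration turns the resolution into a moment problem on (0, 1). If h ≥ 0 satisfies π
|d_n|² ∫ xⁿ h = 1 for all n, the functions conj(d_n zⁿ) are orthonormal for the measure h(|z|²) d²z,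
so pairing with the unnormalized vector T_z = ∑ d_n zⁿ Ψ_{n+m} is an isometry of the subspace into
that L² space. Normalizing T_z multiplies the weight by ∑ |d_n|² xⁿ
(`resolvesIdentity_photonAdded`). The states themselves need only be orthonormal
(`orthonormal_eigenstate`): divided by the zero mode they are polynomials in sin²(x/2a), the raising
operator is up to a constant the adjoint of differentiation, and shape invariance makes the
derivative of the raised polynomial a multiple of the original one.

The two Meijer functions are the two factors of the weight. The residues of Γ(s) give G^{1,3}(-x) =
∑ c_k x^k (`hasSum_meijerG_one_three`). The function G^{3,0} is the density: its kernel equals 1/c_n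
at s = n+1, and it remains to see that this kernel is the Mellin transform of a nonnegative function
which the loop integral recovers. That property, `MellinPair`, holds for Γ(s)/Γ(s+a) by the Beta
integral and the binomial series (`mellinPair_Gamma_div`) and survives division by s + b with b ≥ 0
(`MellinPair.div_add`). The kernel arises from a = 2m+ν by 2m such divisions
(`exists_mellinPair_three_zero`), so positivity of the density comes for free. For m = 0 no division
occurs and both factors are elementary. -/

open Polynomial in
/-- The action of the raising operator `-d/dx + W(x; l, l')` on polynomial factors in
`sin² (x / 2a)`, up to the factor `-1 / 2a`. -/
def raisePoly (l l' : ℝ) (P : ℝ[X]) : ℝ[X] :=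
  (C (2 * l + 1) * (1 - X) - C (2 * l' + 1) * X) * P + 2 * X * (1 - X) * derivative P

open Polynomial in
/-- The polynomial factors of the eigenfunctions. -/
def eigenPoly (a : ℝ) : ℕ → ℝ → ℝ → ℝ[X]
  | 0, l, l' => C (1 / Real.sqrt (∫ y in Set.Ioo 0 (Real.pi * a), groundShape a l l' y ^ 2))
  | n + 1, l, l' =>
      C (-(1 / (2 * a * Real.sqrt (energy (1 / a) (l + l') (n + 1))))) *
        raisePoly l l' (eigenPoly a n (l + 1) (l' + 1))

theorem half_angle_pos {a x : ℝ} (ha : 0 < a) (hx : x ∈ Set.Ioo 0 (Real.pi * a)) :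
    0 < Real.sin (x / (2 * a)) ∧ 0 < Real.cos (x / (2 * a)) := by
  have hu0 : 0 < x / (2 * a) := div_pos hx.1 (by positivity)
  have hu1 : x / (2 * a) < Real.pi / 2 := by
    rw [div_lt_div_iff₀ (by positivity) (by norm_num)]
    nlinarith [hx.2]
  exact ⟨Real.sin_pos_of_pos_of_lt_pi hu0 (by linarith [Real.pi_pos]),
    Real.cos_pos_of_mem_Ioo ⟨by linarith [Real.pi_pos], hu1⟩⟩

/-- Orthonormality needs the recursion for the polynomial factors, whereas `eigenfunction_eq` only
provides some polynomial. -/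
theorem eigenfunction_eq_eigenPoly {a : ℝ} (ha : 0 < a) (n : ℕ) : ∀ l l' : ℝ,
    ∀ x ∈ Set.Ioo 0 (Real.pi * a), eigenfunction a n l l' x =
      groundShape a l l' x * (eigenPoly a n l l').eval (Real.sin (x / (2 * a)) ^ 2) := by
  induction n with
  | zero =>
    intro l l' x _
    simp [eigenfunction, eigenPoly, div_eq_mul_inv]
  | succ n ih =>
    intro l l' x hx
    have hP := ih (l + 1) (l' + 1)
    simp only [eigenPoly]
    set P := eigenPoly a n (l + 1) (l' + 1)
    set D := Real.sqrt (energy (1 / a) (l + l') (n + 1)) with hD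
    obtain ⟨hs, hc⟩ := half_angle_pos ha hx
    have hu : HasDerivAt (fun y : ℝ => y / (2 * a)) (1 / (2 * a)) x := by
      simpa using (hasDerivAt_id x).div_const (2 * a)
    have hsin := hu.sin
    have hcos := hu.cos
    have h1 := hsin.rpow_const (p := l + 1) (Or.inl hs.ne')
    have h2 := hcos.rpow_const (p := l' + 1) (Or.inl hc.ne')
    have h3 : HasDerivAt (fun y : ℝ => P.eval (Real.sin (y / (2 * a)) ^ 2)) _ x :=
      (P.hasDerivAt _).comp x (hsin.pow 2)
    have h4 := (h1.mul h2).mul h3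
    have hder : deriv (eigenfunction a n (l + 1) (l' + 1)) x = _ :=
      (h4.congr_of_eventuallyEq (by
        filter_upwards [isOpen_Ioo.mem_nhds hx] with y hy
        simpa [groundShape] using hP y hy)).deriv
    have e1 : Real.sin (x / (2 * a)) ^ (l + 1)
        = Real.sin (x / (2 * a)) ^ l * Real.sin (x / (2 * a)) := Real.rpow_add_one hs.ne' l
    have e2 : Real.cos (x / (2 * a)) ^ (l' + 1)
        = Real.cos (x / (2 * a)) ^ l' * Real.cos (x / (2 * a)) := Real.rpow_add_one hc.ne' l'
    have hsc : Real.cos (x / (2 * a)) ^ 2 = 1 - Real.sin (x / (2 * a)) ^ 2 := by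
      rw [← Real.sin_sq_add_cos_sq (x / (2 * a))]; ring
    simp only [eigenfunction, raisePoly]
    rw [hder, hP x hx, ← hD]
    simp only [groundShape, superpotential, Real.cot_eq_cos_div_sin, Real.tan_eq_sin_div_cos,
      e1, e2, add_sub_cancel_right, Polynomial.eval_mul, Polynomial.eval_add, Polynomial.eval_sub,
      Polynomial.eval_C, Polynomial.eval_X, Polynomial.eval_one, Polynomial.eval_ofNat,
      Pi.mul_apply]
    rw [← hsc]
    -- For arbitrary l, l' the energy may be nonpositive and its square root zero; division by zero
    -- then annihilates both sides.
    by_cases hD0 : D = 0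
    · simp [hD0]
    · field_simp
      ring

/-- Integration of polynomials in `sin² (x / 2a)` against the squared zero mode. -/
def wellIntegral (a l l' : ℝ) (P : Polynomial ℝ) : ℝ :=
  ∫ x in Set.Ioo 0 (Real.pi * a), groundShape a l l' x ^ 2 * P.eval (Real.sin (x / (2 * a)) ^ 2)

theorem continuous_groundShape (a : ℝ) {l l' : ℝ} (hl : 0 ≤ l) (hl' : 0 ≤ l') :
    Continuous (groundShape a l l') := by
  refine Continuous.mul ?_ ?_
  · exact (Real.continuous_rpow_const hl).comp (Real.continuous_sin.comp (by fun_prop))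
  · exact (Real.continuous_rpow_const hl').comp (Real.continuous_cos.comp (by fun_prop))

theorem integrableOn_well {a l l' : ℝ} (hl : 0 ≤ l) (hl' : 0 ≤ l')
    (P : Polynomial ℝ) : IntegrableOn
      (fun x => groundShape a l l' x ^ 2 * P.eval (Real.sin (x / (2 * a)) ^ 2))
      (Set.Ioo 0 (Real.pi * a)) := by
  refine Continuous.integrableOn_Icc (a := 0) (b := Real.pi * a) ?_ |>.mono_set
    Set.Ioo_subset_Icc_self
  exact ((continuous_groundShape a hl hl').pow 2).mul (P.continuous.comp (by fun_prop))

theorem wellIntegral_add {a l l' : ℝ} (hl : 0 ≤ l) (hl' : 0 ≤ l') (P Q : Polynomial ℝ) :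
    wellIntegral a l l' (P + Q) = wellIntegral a l l' P + wellIntegral a l l' Q := by
  simp only [wellIntegral, Polynomial.eval_add, mul_add]
  exact integral_add (integrableOn_well hl hl' P) (integrableOn_well hl hl' Q)

theorem wellIntegral_C_mul (a l l' c : ℝ) (P : Polynomial ℝ) :
    wellIntegral a l l' (Polynomial.C c * P) = c * wellIntegral a l l' P := by
  simp only [wellIntegral, Polynomial.eval_mul, Polynomial.eval_C]
  rw [← integral_const_mul]
  congr 1 with x
  ring

/-- Raising both exponents by one multiplies the squared zero mode by sin² cos², which is X (1 - X)
in the variable X = sin². -/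
theorem wellIntegral_succ {a l l' : ℝ} (ha : 0 < a) (P : Polynomial ℝ) :
    wellIntegral a (l + 1) (l' + 1) P =
      wellIntegral a l l' (Polynomial.X * (1 - Polynomial.X) * P) := by
  refine setIntegral_congr_fun measurableSet_Ioo fun x hx => ?_
  obtain ⟨hs, hc⟩ := half_angle_pos ha hx
  have hsc : Real.cos (x / (2 * a)) ^ 2 = 1 - Real.sin (x / (2 * a)) ^ 2 := by
    rw [← Real.sin_sq_add_cos_sq (x / (2 * a))]; ring
  simp only [groundShape, Real.rpow_add_one hs.ne', Real.rpow_add_one hc.ne', Polynomial.eval_mul,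
    Polynomial.eval_sub, Polynomial.eval_X, Polynomial.eval_one, ← hsc]
  ring

/-- The integrand is 2a times the derivative of sin^{2l+1} cos^{2l'+1} P(sin²), a function that
vanishes at both ends of the well. -/
theorem wellIntegral_raisePoly {a l l' : ℝ} (ha : 0 < a) (hl : 0 < l) (hl' : 0 < l')
    (P : Polynomial ℝ) : wellIntegral a l l' (raisePoly l l' P) = 0 := by
  let F : ℝ → ℝ := fun x => Real.sin (x / (2 * a)) ^ (2 * l + 1) *
    Real.cos (x / (2 * a)) ^ (2 * l' + 1) * P.eval (Real.sin (x / (2 * a)) ^ 2)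
  have hab : (0 : ℝ) ≤ Real.pi * a := by positivity
  have hcont : ContinuousOn F (Set.Icc 0 (Real.pi * a)) := by
    refine Continuous.continuousOn ?_
    refine Continuous.mul (Continuous.mul ?_ ?_) (P.continuous.comp (by fun_prop))
    · exact (Real.continuous_rpow_const (by linarith)).comp
        (Real.continuous_sin.comp (by fun_prop))
    · exact (Real.continuous_rpow_const (by linarith)).comp
        (Real.continuous_cos.comp (by fun_prop))
  have hderiv : ∀ x ∈ Set.Ioo 0 (Real.pi * a), HasDerivAt F (1 / (2 * a) *
      (groundShape a l l' x ^ 2 *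
        (raisePoly l l' P).eval (Real.sin (x / (2 * a)) ^ 2))) x := by
    intro x hx
    obtain ⟨hs, hc⟩ := half_angle_pos ha hx
    have hu : HasDerivAt (fun y : ℝ => y / (2 * a)) (1 / (2 * a)) x := by
      simpa using (hasDerivAt_id x).div_const (2 * a)
    have h1 := hu.sin.rpow_const (p := 2 * l + 1) (Or.inl hs.ne')
    have h2 := hu.cos.rpow_const (p := 2 * l' + 1) (Or.inl hc.ne')
    have h3 : HasDerivAt (fun y : ℝ => P.eval (Real.sin (y / (2 * a)) ^ 2)) _ x :=
      (P.hasDerivAt _).comp x (hu.sin.pow 2)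
    have hsc : Real.cos (x / (2 * a)) ^ 2 = 1 - Real.sin (x / (2 * a)) ^ 2 := by
      rw [← Real.sin_sq_add_cos_sq (x / (2 * a))]; ring
    have e1 : Real.sin (x / (2 * a)) ^ (2 * l) = (Real.sin (x / (2 * a)) ^ l) ^ 2 := by
      rw [← Real.rpow_natCast, ← Real.rpow_mul hs.le]; congr 1; push_cast; ring
    have e2 : Real.cos (x / (2 * a)) ^ (2 * l') = (Real.cos (x / (2 * a)) ^ l') ^ 2 := by
      rw [← Real.rpow_natCast, ← Real.rpow_mul hc.le]; congr 1; push_cast; ring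
    refine ((h1.mul h2).mul h3).congr_deriv ?_
    simp only [groundShape, raisePoly, add_sub_cancel_right, Polynomial.eval_mul,
      Polynomial.eval_add, Polynomial.eval_sub, Polynomial.eval_C, Polynomial.eval_X,
      Polynomial.eval_one, Polynomial.eval_ofNat, Real.rpow_add_one hs.ne',
      Real.rpow_add_one hc.ne', e1, e2, Pi.mul_apply]
    rw [← hsc]
    field_simp
    ring
  have hint := intervalIntegral.integral_eq_sub_of_hasDerivAt_of_le hab hcont hderiv (by
    rw [intervalIntegrable_iff_integrableOn_Ioo_of_le hab]
    exact (integrableOn_well hl.le hl'.le _).const_mul _)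
  have hF0 : F 0 = 0 := by simp [F, Real.zero_rpow (show 2 * l + 1 ≠ 0 by positivity)]
  have hFa : F (Real.pi * a) = 0 := by
    have : Real.pi * a / (2 * a) = Real.pi / 2 := by field_simp
    simp [F, this, Real.zero_rpow (show 2 * l' + 1 ≠ 0 by positivity)]
  rw [hF0, hFa, sub_self, intervalIntegral.integral_of_le hab, integral_Ioc_eq_integral_Ioo,
    integral_const_mul] at hint
  exact (mul_eq_zero.1 hint).resolve_left (by positivity)

/-- Integration by parts: the raising operator obeys a Leibniz rule with extra term 2X(1-X) P Q',
and a raised polynomial integrates to zero. So raising is, up to the factor -2, adjoint to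
differentiation between the weights (l, l') and (l+1, l'+1). -/
theorem wellIntegral_raisePoly_mul {a l l' : ℝ} (ha : 0 < a) (hl : 0 < l) (hl' : 0 < l')
    (P Q : Polynomial ℝ) : wellIntegral a l l' (raisePoly l l' P * Q) =
      -2 * wellIntegral a (l + 1) (l' + 1) (P * Polynomial.derivative Q) := by
  have h := wellIntegral_raisePoly ha hl hl' (P * Q)
  have e : raisePoly l l' (P * Q) = raisePoly l l' P * Q +
      Polynomial.C 2 * (Polynomial.X * (1 - Polynomial.X) *
        (P * Polynomial.derivative Q)) := by
    simp only [raisePoly, Polynomial.derivative_mul, map_ofNat]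
    ring
  rw [e, wellIntegral_add hl.le hl'.le, wellIntegral_C_mul, ← wellIntegral_succ ha] at h
  linarith

/-- Shape invariance for polynomials: moving the derivative past the raising operator shifts the
parameters by one and costs only a constant. -/
theorem derivative_raisePoly (l l' : ℝ) (P : Polynomial ℝ) :
    Polynomial.derivative (raisePoly l l' P) =
      Polynomial.C (-2 * (l + l' + 1)) * P +
        raisePoly (l + 1) (l' + 1) (Polynomial.derivative P) := by
  simp only [raisePoly, Polynomial.derivative_mul,
    Polynomial.derivative_sub, Polynomial.derivative_C, Polynomial.derivative_X,
    Polynomial.derivative_one, Polynomial.derivative_ofNat, map_add, map_mul, map_neg, map_one,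
    map_ofNat]
  ring

theorem raisePoly_C_mul (l l' c : ℝ) (P : Polynomial ℝ) :
    raisePoly l l' (Polynomial.C c * P) = Polynomial.C c * raisePoly l l' P := by
  simp only [raisePoly, Polynomial.derivative_C_mul]
  ring

/-- The constants of `derivative_raisePoly` accumulate along the recursion. The resulting factor is
-2a² times the energy E_{n+1}, which is what the normalization in the definition cancels. -/
theorem derivative_raisePoly_eigenPoly (a : ℝ) (n : ℕ) : ∀ l l' : ℝ,
    Polynomial.derivative (raisePoly l l' (eigenPoly a n (l + 1) (l' + 1))) =
      Polynomial.C (-2 * ((n + 1) * (n + 1 + l + l'))) * eigenPoly a n (l + 1) (l' + 1) := by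
  induction n with
  | zero =>
    intro l l'
    rw [derivative_raisePoly]
    simp [eigenPoly, raisePoly]
    exact Or.inl (by ring)
  | succ n ih =>
    intro l l'
    rw [derivative_raisePoly]
    simp only [eigenPoly]
    rw [Polynomial.derivative_C_mul, ih (l + 1) (l' + 1), raisePoly_C_mul, raisePoly_C_mul]
    push_cast
    simp only [map_add, map_mul, map_neg, map_one, map_ofNat, map_natCast]
    ring

theorem energy_eq (lam a₁ : ℝ) (n : ℕ) : energy lam a₁ n = lam ^ 2 * (n * (n + a₁)) := by
  induction n with
  | zero => simp [energy]
  | succ n ih =>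
    have : energy lam a₁ (n + 1) = energy lam a₁ n + remainder lam (param a₁ (n + 1)) := by
      simp [energy, Finset.sum_Icc_succ_top]
    rw [this, ih, remainder, param]
    push_cast
    ring

/-- Adjointness followed by the eigenvalue relation reduces the pairing of n+1 and k+1 at (l, l') to
that of n and k at (l+1, l'+1). When one index is 0 its polynomial is constant, so differentiation
kills the pairing with any positive index. -/
theorem wellIntegral_eigenPoly_mul {a : ℝ} (ha : 0 < a) (n : ℕ) : ∀ (k : ℕ) {l l' : ℝ},
    0 < l → 0 < l' → wellIntegral a l l' (eigenPoly a n l l' * eigenPoly a k l l') =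
      if n = k then 1 else 0 := by
  have hzero : ∀ (n : ℕ) {l l' : ℝ}, 0 < l → 0 < l' →
      wellIntegral a l l' (eigenPoly a (n + 1) l l' * eigenPoly a 0 l l') = 0 := by
    intro n l l' hl hl'
    simp only [eigenPoly]
    rw [mul_assoc, wellIntegral_C_mul, wellIntegral_raisePoly_mul ha hl hl']
    simp [wellIntegral]
  induction n with
  | zero =>
    intro k l l' hl hl'
    cases k with
    | zero =>
      have hpos : 0 < ∫ y in Set.Ioo 0 (Real.pi * a), groundShape a l l' y ^ 2 := by
        have hi := integrableOn_well (a := a) hl.le hl'.le 1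
        simp only [Polynomial.eval_one, mul_one] at hi
        rw [setIntegral_pos_iff_support_of_nonneg_ae
          (Filter.Eventually.of_forall fun x => sq_nonneg _) hi]
        have : Set.Ioo 0 (Real.pi * a) ⊆
            (Function.support fun y => groundShape a l l' y ^ 2) ∩ Set.Ioo 0 (Real.pi * a) := by
          refine fun x hx => ⟨?_, hx⟩
          obtain ⟨hs, hc⟩ := half_angle_pos ha hx
          exact (pow_pos (mul_pos (Real.rpow_pos_of_pos hs _) (Real.rpow_pos_of_pos hc _))
            2).ne'
        refine lt_of_lt_of_le ?_ (measure_mono this)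
        simp only [Real.volume_Ioo, sub_zero, ENNReal.ofReal_pos]
        positivity
      have e : eigenPoly a 0 l l' * eigenPoly a 0 l l' =
          Polynomial.C (1 / ∫ y in Set.Ioo 0 (Real.pi * a), groundShape a l l' y ^ 2) * 1 := by
        rw [eigenPoly, ← map_mul, mul_one]
        congr 1
        rw [div_mul_div_comm, Real.mul_self_sqrt hpos.le, one_mul]
      rw [e, wellIntegral_C_mul]
      simp only [wellIntegral, Polynomial.eval_one, mul_one]
      simp [hpos.ne']
    | succ k =>
      rw [mul_comm, hzero k hl hl', if_neg (by simp)]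
  | succ n ih =>
    intro k l l' hl hl'
    cases k with
    | zero => rw [hzero n hl hl', if_neg (by simp)]
    | succ k =>
      have hE : ∀ j : ℕ, 0 < ((j : ℝ) + 1) * (j + 1 + (l + l')) := fun j => by positivity
      have h1 := wellIntegral_raisePoly_mul ha hl hl' (eigenPoly a n (l + 1) (l' + 1))
        (raisePoly l l' (eigenPoly a k (l + 1) (l' + 1)))
      rw [derivative_raisePoly_eigenPoly, mul_left_comm, wellIntegral_C_mul,
        ih k (by linarith) (by linarith)] at h1
      simp only [eigenPoly]
      rw [mul_mul_mul_comm, ← map_mul, wellIntegral_C_mul, h1]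
      by_cases hnk : n = k
      · subst hnk
        rw [if_pos rfl, if_pos rfl, neg_mul_neg, div_mul_div_comm, mul_mul_mul_comm,
          Real.mul_self_sqrt, energy_eq]
        · have := hE n
          push_cast
          field_simp
          ring
        · rw [energy_eq]
          have := hE n
          push_cast
          positivity
      · rw [if_neg hnk, if_neg (by simpa using hnk)]
        simp

theorem orthonormal_eigenstate (a l l' : ℝ) (ha : 0 < a) (hl : 1 / 2 < l) (hl' : 1 / 2 < l') :
    Orthonormal ℂ (eigenstate a l l' ha hl hl') := by
  rw [orthonormal_iff_ite]
  intro n k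
  have hint : wellIntegral a l l' (eigenPoly a n l l' * eigenPoly a k l l') =
      if n = k then 1 else 0 := wellIntegral_eigenPoly_mul ha n k (by linarith) (by linarith)
  rw [L2.inner_def]
  have e : (∫ x, inner ℂ (eigenstate a l l' ha hl hl' n x) (eigenstate a l l' ha hl hl' k x)
      ∂(wellMeasure a)) = ∫ x in Set.Ioo 0 (Real.pi * a),
        ((groundShape a l l' x ^ 2 * (eigenPoly a n l l' * eigenPoly a k l l').eval
          (Real.sin (x / (2 * a)) ^ 2) : ℝ) : ℂ) := by
    refine integral_congr_ae ?_
    filter_upwards [(memLp_eigenfunction a l l' ha hl hl' n).coeFn_toLp,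
      (memLp_eigenfunction a l l' ha hl hl' k).coeFn_toLp,
      ae_restrict_mem measurableSet_Ioo] with x h1 h2 hx
    simp only [eigenstate]
    rw [h1, h2, eigenfunction_eq_eigenPoly ha n l l' x hx,
      eigenfunction_eq_eigenPoly ha k l l' x hx, Polynomial.eval_mul]
    simp only [RCLike.inner_apply, Complex.conj_ofReal]
    push_cast
    ring
  rw [e, integral_complex_ofReal]
  change ((wellIntegral a l l' (eigenPoly a n l l' * eigenPoly a k l l') : ℝ) : ℂ) = _
  rw [hint]
  split_ifs <;> simp

/-! ### Resolution of the identity from a radial moment problem -/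

section Expansion

variable {H : Type*} [NormedAddCommGroup H] [InnerProductSpace ℂ H] [CompleteSpace H]

/-- Supplies ℓ² coordinates for vectors of the tail space. -/
theorem exists_linearIsometry_eq_of_mem_closure_span {v : ℕ → H} (hv : Orthonormal ℂ v) {φ : H}
    (hφ : φ ∈ (Submodule.span ℂ (Set.range v)).topologicalClosure) :
    ∃ a : lp (fun _ : ℕ => ℂ) 2, hv.orthogonalFamily.linearIsometry a = φ := by
  have h : (Submodule.span ℂ (Set.range v)).topologicalClosure =
      LinearMap.range hv.orthogonalFamily.linearIsometry.toLinearMap := by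
    rw [OrthogonalFamily.range_linearIsometry]
    congr 1
    simp [← LinearMap.span_singleton_eq_range, ← Submodule.span_iUnion]
  rw [h] at hφ
  exact hφ

theorem hasSum_linearIsometry {v : ℕ → H} (hv : Orthonormal ℂ v) (a : lp (fun _ : ℕ => ℂ) 2) :
    HasSum (fun n => a n • v n) (hv.orthogonalFamily.linearIsometry a) :=
  hv.orthogonalFamily.hasSum_linearIsometry a

theorem inner_linearIsometry {v : ℕ → H} (hv : Orthonormal ℂ v) (a : lp (fun _ : ℕ => ℂ) 2)
    (n : ℕ) : inner ℂ (v n) (hv.orthogonalFamily.linearIsometry a) = a n := by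
  have h := (hasSum_linearIsometry hv a).mapL (innerSL ℂ (v n))
  refine h.unique ?_
  convert hasSum_single n fun k hk => ?_ using 1
  · simp [hv.1 n]
  · simp [hv.2 hk.symm]

theorem summable_smul_of_summable_sq {v : ℕ → H} (hv : Orthonormal ℂ v) {c : ℕ → ℂ}
    (hc : Summable fun n => ‖c n‖ ^ 2) : Summable fun n => c n • v n :=
  (hv.orthogonalFamily.summable_iff_norm_sq_summable c).2 hc

theorem hasSum_inner_linearIsometry {v : ℕ → H} (hv : Orthonormal ℂ v)
    (a : lp (fun _ : ℕ => ℂ) 2) {c : ℕ → ℂ} {t : H} (ht : HasSum (fun n => c n • v n) t) :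
    HasSum (fun n => a n * (starRingEnd ℂ) (c n))
      (inner ℂ t (hv.orthogonalFamily.linearIsometry a)) := by
  have h1 := Complex.hasSum_conj'.2 (ht.mapL (innerSL ℂ (hv.orthogonalFamily.linearIsometry a)))
  simp only [innerSL_apply_apply, inner_conj_symm, inner_smul_left] at h1
  exact h1.congr_fun fun n => by rw [inner_linearIsometry hv, mul_comm]

/-- The partial sums converge in L², hence almost everywhere along a subsequence, and there the
limit must be the pointwise sum. -/
theorem linearIsometry_ae_eq {α : Type*} [MeasurableSpace α] {μ : Measure α} {f : ℕ → α → ℂ}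
    (hf : ∀ n, MemLp (f n) 2 μ) (he : Orthonormal ℂ fun n => (hf n).toLp (f n))
    (a : lp (fun _ : ℕ => ℂ) 2) {Φ : α → ℂ}
    (hΦ : ∀ᵐ z ∂μ, HasSum (fun n => a n * f n z) (Φ z)) :
    he.orthogonalFamily.linearIsometry a =ᵐ[μ] Φ := by
  have h := (hasSum_linearIsometry he a).tendsto_sum_nat
  obtain ⟨ns, hns, hlim⟩ := (tendstoInMeasure_of_tendsto_Lp h).exists_seq_tendsto_ae
  have hsum : ∀ᵐ z ∂μ, ∀ N : ℕ, (∑ n ∈ Finset.range N, a n • (hf n).toLp (f n) : Lp ℂ 2 μ) z =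
      ∑ n ∈ Finset.range N, a n * f n z := by
    rw [ae_all_iff]
    intro N
    have h1 : ∀ᵐ z ∂μ, ∀ n, (a n • (hf n).toLp (f n) : Lp ℂ 2 μ) z = a n * f n z := by
      rw [ae_all_iff]
      intro n
      filter_upwards [Lp.coeFn_smul (a n) ((hf n).toLp (f n)), (hf n).coeFn_toLp] with z h2 h3
      rw [h2, Pi.smul_apply, h3, smul_eq_mul]
    filter_upwards [h1, Lp.coeFn_fun_finsetSum (Finset.range N)
      fun n => a n • (hf n).toLp (f n)] with z h2 h3
    rw [h3]
    exact Finset.sum_congr rfl fun n _ => h2 n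
  filter_upwards [hΦ, hlim, hsum] with z h1 h2 h3
  refine tendsto_nhds_unique h2 ?_
  simp only [h3]
  exact h1.tendsto_sum_nat.comp hns.tendsto_atTop

end Expansion

/-! ### Radial integrals of monomials over the plane. -/

theorem integral_angle (n k : ℕ) :
    (∫ θ in Set.Ioo (-Real.pi) Real.pi,
      Complex.exp ((((n : ℂ) - k) * Complex.I) * (θ : ℂ))) =
      if n = k then ((2 * Real.pi : ℝ) : ℂ) else 0 := by
  have hpi : -Real.pi ≤ Real.pi := by linarith [Real.pi_pos]
  rw [← integral_Ioc_eq_integral_Ioo, ← intervalIntegral.integral_of_le hpi]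
  split_ifs with h
  · subst h
    simp
    ring
  · have hc : ((n : ℂ) - k) * Complex.I ≠ 0 :=
      mul_ne_zero (sub_ne_zero.2 (by exact_mod_cast h)) Complex.I_ne_zero
    rw [integral_exp_mul_complex hc, div_eq_zero_iff]
    left
    rw [sub_eq_zero, Complex.exp_eq_exp_iff_exists_int]
    refine ⟨(n : ℤ) - k, ?_⟩
    push_cast
    ring

/-- In polar coordinates the angular integral kills n ≠ k, and for n = k the substitution x = r²
turns 2π r dr into π dx. The factorization of the double integral needs no integrability of g. -/
theorem integral_radial_mul_pow (g : ℝ → ℝ) (n k : ℕ) :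
    (∫ z : ℂ, (g (‖z‖ ^ 2) : ℂ) * (z ^ n * (starRingEnd ℂ) z ^ k)) =
      if n = k then ((Real.pi * ∫ x in Set.Ioi 0, x ^ n * g x : ℝ) : ℂ) else 0 := by
  rw [← Complex.integral_comp_polarCoord_symm, polarCoord_target]
  have e : (∫ p in Set.Ioi (0 : ℝ) ×ˢ Set.Ioo (-Real.pi) Real.pi,
      p.1 • ((g (‖Complex.polarCoord.symm p‖ ^ 2) : ℂ) * (Complex.polarCoord.symm p ^ n *
        (starRingEnd ℂ) (Complex.polarCoord.symm p) ^ k))) =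
      ∫ p in Set.Ioi (0 : ℝ) ×ˢ Set.Ioo (-Real.pi) Real.pi,
        ((p.1 * g (p.1 ^ 2) * p.1 ^ (n + k) : ℝ) : ℂ) *
          Complex.exp ((((n : ℂ) - k) * Complex.I) * (p.2 : ℂ)) := by
    refine setIntegral_congr_fun (measurableSet_Ioi.prod measurableSet_Ioo) fun p hp => ?_
    have hr : 0 < p.1 := hp.1
    have h1 : Complex.polarCoord.symm p = p.1 * Complex.exp (p.2 * Complex.I) := by
      rw [Complex.polarCoord_symm_apply, Complex.exp_mul_I]
      push_cast
      ring
    have h2 : (starRingEnd ℂ) (Complex.polarCoord.symm p) =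
        p.1 * Complex.exp (-(p.2 * Complex.I)) := by
      rw [h1, map_mul, ← Complex.exp_conj]
      simp
    simp only [h2, Complex.norm_polarCoord_symm, sq_abs]
    rw [h1, mul_pow, mul_pow, ← Complex.exp_nat_mul, ← Complex.exp_nat_mul]
    rw [show ((n : ℂ) - k) * Complex.I * p.2 =
      n * (p.2 * Complex.I) + k * (-(p.2 * Complex.I)) by ring, Complex.exp_add]
    rw [Complex.real_smul]
    push_cast
    ring
  rw [e, Measure.volume_eq_prod, setIntegral_prod_mul
    (fun r : ℝ => ((r * g (r ^ 2) * r ^ (n + k) : ℝ) : ℂ))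
    (fun θ : ℝ => Complex.exp ((((n : ℂ) - k) * Complex.I) * (θ : ℂ))), integral_angle]
  split_ifs with h
  · subst h
    rw [integral_complex_ofReal, ← Complex.ofReal_mul]
    congr 1
    have := integral_comp_rpow_Ioi_of_pos (g := fun x => x ^ n * g x) (show (0 : ℝ) < 2 by norm_num)
    rw [← this, ← integral_const_mul, ← integral_mul_const]
    refine setIntegral_congr_fun measurableSet_Ioi fun x hx => ?_
    simp only [Real.rpow_two, smul_eq_mul]
    rw [show (2 : ℝ) - 1 = 1 by norm_num, Real.rpow_one]
    ring
  · simp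

theorem integrable_radial {g : ℝ → ℝ} (hg : IntegrableOn g (Set.Ioi 0)) :
    Integrable fun z : ℂ => g (‖z‖ ^ 2) := by
  rw [integrable_fun_norm_addHaar volume (f := fun r => g (r ^ 2))]
  have := (integrableOn_Ioi_comp_rpow_iff' g (p := 2) (by norm_num)).2 hg
  refine this.congr_fun (fun x hx => ?_) measurableSet_Ioi
  simp only [Real.rpow_two, smul_eq_mul, Complex.finrank_real_complex]
  norm_num

section Resolution

variable {H : Type*} [NormedAddCommGroup H] [InnerProductSpace ℂ H] [CompleteSpace H]

set_option maxHeartbeats 1000000 in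
/-- If `h` solves the moment problem `π |d_n|² ∫ x^n h(x) dx = 1` on `(0, 1)`, then the normalized
vectors `∑ d_n z^n |Ψ_{n+m}⟩` resolve the identity with the weight `∑ |d_n|² x^n h(x)`. -/
theorem resolvesIdentity_photonAdded {Ψ : ℕ → H} (hΨ : Orthonormal ℂ Ψ) {d : ℕ → ℂ} (m : ℕ)
    {h : ℝ → ℝ} {w : ℝ → ℂ}
    (hd : ∀ x : ℝ, 0 ≤ x → x < 1 → Summable fun n => ‖d n‖ ^ 2 * x ^ n)
    (hcont : ContinuousOn h (Set.Ioo 0 1)) (hnn : ∀ x ∈ Set.Ioo (0 : ℝ) 1, 0 ≤ h x)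
    (hint : IntegrableOn h (Set.Ioo 0 1))
    (hmom : ∀ n, Real.pi * ‖d n‖ ^ 2 * ∫ x in Set.Ioo (0 : ℝ) 1, x ^ n * h x = 1)
    (hw : ∀ x ∈ Set.Ioo (0 : ℝ) 1, w x = ((∑' n, ‖d n‖ ^ 2 * x ^ n) * h x : ℝ)) :
    ResolvesIdentity (tailSpace Ψ m) (photonAdded Ψ d m) w := by
  have hv : Orthonormal ℂ fun n => Ψ (n + m) := hΨ.comp _ (add_left_injective m)
  have hd0 : ∀ n, d n ≠ 0 := fun n h0 => by simpa [h0] using hmom n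
  have hsq : ∀ z ∈ Metric.ball (0 : ℂ) 1, Summable fun n => ‖d n * z ^ n‖ ^ 2 := by
    intro z hz
    have hz1 : ‖z‖ < 1 := by simpa using hz
    refine (hd (‖z‖ ^ 2) (by positivity) (by nlinarith [norm_nonneg z])).congr fun n => ?_
    rw [norm_mul, norm_pow, mul_pow, ← pow_mul, ← pow_mul, mul_comm n 2]
  have hT : ∀ z ∈ Metric.ball (0 : ℂ) 1, Summable fun n => (d n * z ^ n) • Ψ (n + m) :=
    fun z hz => summable_smul_of_summable_sq hv (hsq z hz)
  have hN : ∀ z ∈ Metric.ball (0 : ℂ) 1, 0 < ∑' n, ‖d n‖ ^ 2 * ‖z‖ ^ (2 * n) := by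
    intro z hz
    have hs : Summable fun n => ‖d n‖ ^ 2 * ‖z‖ ^ (2 * n) := by
      refine (hsq z hz).congr fun n => ?_
      rw [norm_mul, norm_pow, mul_pow, ← pow_mul, mul_comm n 2]
    refine hs.tsum_pos (fun n => by positivity) 0 ?_
    have := norm_pos_iff.2 (hd0 0)
    simp only [mul_zero, pow_zero, mul_one]
    positivity
  have hmem : ∀ z ∈ Metric.ball (0 : ℂ) 1, photonAdded Ψ d m z ∈ tailSpace Ψ m := by
    intro z hz
    refine Submodule.smul_mem _ _ ?_
    refine (Submodule.isClosed_topologicalClosure _).mem_of_tendsto (hT z hz).hasSum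
      (Filter.Eventually.of_forall fun s => ?_)
    refine Submodule.sum_mem _ fun n _ => Submodule.smul_mem _ _ ?_
    exact Submodule.le_topologicalClosure _ (Submodule.subset_span ⟨n, rfl⟩)
  refine ⟨hmem, ?_⟩
  -- the radial measure
  let g : ℝ → ℝ := (Set.Ioo (0 : ℝ) 1).indicator h
  have hgm : Measurable g := by
    have := hcont.measurable_piecewise (continuousOn_const (c := (0 : ℝ))) measurableSet_Ioo
    convert this using 1
    ext x
    simp [g, Set.indicator, Set.piecewise]
  have hg0 : ∀ x, 0 ≤ g x := Set.indicator_nonneg hnn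
  have hgi : IntegrableOn g (Set.Ioi 0) :=
    ((integrable_indicator_iff measurableSet_Ioo).2 hint).integrableOn
  have hgmom : ∀ n : ℕ, ∫ x in Set.Ioi 0, x ^ n * g x = ∫ x in Set.Ioo (0 : ℝ) 1, x ^ n * h x := by
    intro n
    have : ∀ x, x ^ n * g x = (Set.Ioo (0 : ℝ) 1).indicator (fun x => x ^ n * h x) x := by
      intro x
      simp only [g, Set.indicator]
      split_ifs <;> simp
    simp only [this]
    rw [setIntegral_indicator measurableSet_Ioo]
    congr 2
    ext x
    simp +contextual
  let ρ : ℂ → ENNReal := fun z => ENNReal.ofReal (g (‖z‖ ^ 2))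
  have hρm : Measurable ρ := (hgm.comp (by fun_prop)).ennreal_ofReal
  have hρt : ∀ᵐ z, ρ z < ⊤ := Filter.Eventually.of_forall fun z => ENNReal.ofReal_lt_top
  have hρr : ∀ z, (ρ z).toReal = g (‖z‖ ^ 2) := fun z => ENNReal.toReal_ofReal (hg0 _)
  let μ : Measure ℂ := volume.withDensity ρ
  have : IsFiniteMeasure μ := by
    refine isFiniteMeasure_withDensity ?_
    exact ((hasFiniteIntegral_iff_ofReal (Filter.Eventually.of_forall fun z => hg0 _)).1
      (integrable_radial hgi).2).ne
  have hμball : ∀ᵐ z ∂μ, z ∈ Metric.ball (0 : ℂ) 1 ∧ ‖z‖ ^ 2 ∈ Set.Ioo (0 : ℝ) 1 := by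
    rw [ae_withDensity_iff hρm]
    refine Filter.Eventually.of_forall fun z hz => ?_
    have h1 : ‖z‖ ^ 2 ∈ Set.Ioo (0 : ℝ) 1 := by
      by_contra hcon
      exact hz (by simp only [ρ, g, Set.indicator_of_notMem hcon, ENNReal.ofReal_zero])
    refine ⟨?_, h1⟩
    rw [mem_ball_zero_iff]
    nlinarith [h1.2, norm_nonneg z]
  -- the orthonormal monomials
  let f : ℕ → ℂ → ℂ := fun n z => (starRingEnd ℂ) (d n * z ^ n)
  have hf : ∀ n, MemLp (f n) 2 μ := by
    intro n
    refine MemLp.of_bound (by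
      refine Continuous.aestronglyMeasurable ?_
      exact Complex.continuous_conj.comp (by fun_prop)) ‖d n‖ ?_
    filter_upwards [hμball] with z hz
    have hz1 : ‖z‖ ≤ 1 := (mem_ball_zero_iff.1 hz.1).le
    simp only [f, RCLike.norm_conj, norm_mul, norm_pow]
    exact mul_le_of_le_one_right (norm_nonneg _) (pow_le_one₀ (norm_nonneg _) hz1)
  -- Off the diagonal the angular integral vanishes; on the diagonal the norm is exactly the moment
  -- condition.
  have he : Orthonormal ℂ fun n => (hf n).toLp (f n) := by
    rw [orthonormal_iff_ite]
    intro n k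
    rw [L2.inner_def]
    have e1 : (∫ z, inner ℂ ((hf n).toLp (f n) z) ((hf k).toLp (f k) z) ∂μ) =
        ∫ z, d n * (starRingEnd ℂ) (d k) * (z ^ n * (starRingEnd ℂ) z ^ k) ∂μ := by
      refine integral_congr_ae ?_
      filter_upwards [(hf n).coeFn_toLp, (hf k).coeFn_toLp] with z h1 h2
      rw [h1, h2]
      simp only [f, RCLike.inner_apply, map_mul, map_pow, Complex.conj_conj]
      ring
    rw [e1, integral_const_mul, integral_withDensity_eq_integral_toReal_smul hρm hρt]
    have e2 := integral_radial_mul_pow g n k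
    simp only [hρr, Complex.real_smul]
    rw [e2]
    split_ifs with hnk
    · subst hnk
      rw [hgmom, Complex.mul_conj, ← Complex.ofReal_mul, Complex.normSq_eq_norm_sq,
        show ‖d n‖ ^ 2 * (Real.pi * ∫ x in Set.Ioo (0 : ℝ) 1, x ^ n * h x) = 1 from
          (by ring : _ = _).trans (hmom n), Complex.ofReal_one]
    · simp
  intro φ hφ χ hχ
  obtain ⟨a, rfl⟩ := exists_linearIsometry_eq_of_mem_closure_span hv hφ
  obtain ⟨b, rfl⟩ := exists_linearIsometry_eq_of_mem_closure_span hv hχ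
  let T : ℂ → H := fun z => ∑' n, (d n * z ^ n) • Ψ (n + m)
  -- The pairing of T z with a vector of coordinates a is the series of the a n * f n z, so it
  -- represents the image of a in L²(μ).
  have hΦ : ∀ a : lp (fun _ : ℕ => ℂ) 2, he.orthogonalFamily.linearIsometry a =ᵐ[μ]
      fun z => inner ℂ (T z) (hv.orthogonalFamily.linearIsometry a) := by
    intro a
    refine linearIsometry_ae_eq hf he a ?_
    filter_upwards [hμball] with z hz
    exact hasSum_inner_linearIsometry hv a (hT z hz.1).hasSum
  have hwT : ∀ᵐ z, z ∈ Metric.ball (0 : ℂ) 1 →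
      inner ℂ (hv.orthogonalFamily.linearIsometry a) (photonAdded Ψ d m z) * w (‖z‖ ^ 2) *
        inner ℂ (photonAdded Ψ d m z) (hv.orthogonalFamily.linearIsometry b) =
      (ρ z).toReal • (inner ℂ (hv.orthogonalFamily.linearIsometry a) (T z) *
        inner ℂ (T z) (hv.orthogonalFamily.linearIsometry b)) := by
    -- The formula for w is available only where 0 < |z|² < 1, so the null set {0} is removed. The
    -- two normalization factors then cancel the series contained in w.
    filter_upwards [compl_mem_ae_iff.2 (measure_singleton (0 : ℂ))] with z hz0 hz
    have hz1 : ‖z‖ < 1 := by simpa using hz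
    have hzp : 0 < ‖z‖ := norm_pos_iff.2 hz0
    have hx : ‖z‖ ^ 2 ∈ Set.Ioo (0 : ℝ) 1 := ⟨by positivity, by nlinarith⟩
    have hNz := hN z hz
    have hsq : ((∑' n, ‖d n‖ ^ 2 * ‖z‖ ^ (2 * n)) ^ (-(1 / 2) : ℝ)) *
        ((∑' n, ‖d n‖ ^ 2 * ‖z‖ ^ (2 * n)) ^ (-(1 / 2) : ℝ)) *
        (∑' n, ‖d n‖ ^ 2 * ‖z‖ ^ (2 * n)) = 1 := by
      rw [← Real.rpow_add hNz, show (-(1 / 2) + -(1 / 2) : ℝ) = -1 by norm_num,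
        Real.rpow_neg_one, inv_mul_cancel₀ hNz.ne']
    rw [hρr, hw _ hx]
    simp only [photonAdded, inner_smul_left, inner_smul_right, Complex.conj_ofReal, ← pow_mul, g,
      Set.indicator_of_mem hx, Complex.real_smul]
    generalize (∑' n, ‖d n‖ ^ 2 * ‖z‖ ^ (2 * n)) = N at hsq
    generalize N ^ (-(1 / 2) : ℝ) = r at hsq
    have hsq' : (r : ℂ) * r * N = 1 := by exact_mod_cast hsq
    push_cast
    linear_combination (h (‖z‖ ^ 2) * inner ℂ (hv.orthogonalFamily.linearIsometry a) (T z) *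
        inner ℂ (T z) (hv.orthogonalFamily.linearIsometry b)) * hsq'
  have hL2 : (fun z => inner ℂ ((he.orthogonalFamily.linearIsometry a) z)
      ((he.orthogonalFamily.linearIsometry b) z)) =ᵐ[μ]
      fun z => inner ℂ (hv.orthogonalFamily.linearIsometry a) (T z) *
        inner ℂ (T z) (hv.orthogonalFamily.linearIsometry b) := by
    filter_upwards [hΦ a, hΦ b] with z h1 h2
    rw [h1, h2, RCLike.inner_apply, inner_conj_symm, mul_comm]
  have hi : Integrable (fun z => (ρ z).toReal • (inner ℂ (hv.orthogonalFamily.linearIsometry a)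
      (T z) * inner ℂ (T z) (hv.orthogonalFamily.linearIsometry b))) := by
    rw [← integrable_withDensity_iff_integrable_smul' hρm hρt]
    exact (L2.integrable_inner _ _).congr hL2
  have hout : ∀ z ∉ Metric.ball (0 : ℂ) 1, (ρ z).toReal •
      (inner ℂ (hv.orthogonalFamily.linearIsometry a) (T z) *
        inner ℂ (T z) (hv.orthogonalFamily.linearIsometry b)) = 0 := by
    intro z hz
    have hz1 : 1 ≤ ‖z‖ := by simpa using hz
    rw [hρr]
    simp only [g]
    rw [Set.indicator_of_notMem (fun h => by nlinarith [h.2]), zero_smul]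
  constructor
  · exact hi.integrableOn.congr (((ae_restrict_iff' Metric.isOpen_ball.measurableSet).2 hwT).mono
      fun z hz => hz.symm)
  -- The integral is an inner product in L²(μ) of the images of b and a; both isometries preserve
  -- the ℓ² inner product, so it equals the one in the original space.
  · rw [setIntegral_congr_ae Metric.isOpen_ball.measurableSet hwT,
      setIntegral_eq_integral_of_forall_compl_eq_zero hout,
      ← integral_withDensity_eq_integral_toReal_smul hρm hρt, ← integral_congr_ae hL2,
      ← L2.inner_def, LinearIsometry.inner_map_map, LinearIsometry.inner_map_map]

end Resolution

/-! ### Loop integrals -/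

/-- The boundary integral of the rectangle `[c', c] × [-1, 1]`. -/
def rectIntegral (c' c : ℝ) (f : ℂ → ℂ) : ℂ :=
  (∫ x in c'..c, f ((x : ℂ) - Complex.I)) - (∫ x in c'..c, f ((x : ℂ) + Complex.I)) +
    (∫ y in (-1 : ℝ)..1, f ((c : ℂ) + (y : ℂ) * Complex.I)) * Complex.I -
    (∫ y in (-1 : ℝ)..1, f ((c' : ℂ) + (y : ℂ) * Complex.I)) * Complex.I

theorem rectIntegral_eq_zero {c' c : ℝ} (hcc : c' ≤ c) {f : ℂ → ℂ} {S : Set ℂ} (hS : S.Countable)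
    (hc : ∀ s : ℂ, c' ≤ s.re → s.re ≤ c → |s.im| ≤ 1 → ContinuousAt f s)
    (hd : ∀ s : ℂ, c' ≤ s.re → s.re ≤ c → |s.im| ≤ 1 → s ∉ S → DifferentiableAt ℂ f s) :
    rectIntegral c' c f = 0 := by
  have h := Complex.integral_boundary_rect_eq_zero_of_differentiable_on_off_countable f
    (c' - Complex.I) (c + Complex.I) S hS ?_ ?_
  · simp only [Complex.sub_re, Complex.ofReal_re, Complex.I_re, sub_zero, Complex.add_re, add_zero,
      Complex.sub_im, Complex.ofReal_im, Complex.I_im, zero_sub, Complex.add_im, zero_add,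
      Complex.ofReal_neg, Complex.ofReal_one, neg_mul, one_mul, smul_eq_mul] at h
    rw [rectIntegral, ← h]
    simp only [← sub_eq_add_neg]
    ring
  · intro s hs
    simp only [Complex.mem_reProdIm, Complex.sub_re, Complex.ofReal_re, Complex.I_re, sub_zero,
      Complex.add_re, add_zero, Complex.sub_im, Complex.ofReal_im, Complex.I_im, zero_sub,
      Complex.add_im, zero_add, Set.uIcc_of_le hcc,
      Set.uIcc_of_le (show (-1 : ℝ) ≤ 1 by norm_num)] at hs
    exact (hc s hs.1.1 hs.1.2 (abs_le.2 hs.2)).continuousWithinAt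
  · rintro s ⟨hs, hsS⟩
    simp only [Complex.mem_reProdIm, Complex.sub_re, Complex.ofReal_re, Complex.I_re, sub_zero,
      Complex.add_re, add_zero, Complex.sub_im, Complex.ofReal_im, Complex.I_im, zero_sub,
      Complex.add_im, zero_add, min_eq_left hcc, max_eq_right hcc,
      min_eq_left (show (-1 : ℝ) ≤ 1 by norm_num),
      max_eq_right (show (-1 : ℝ) ≤ 1 by norm_num)] at hs
    exact hd s hs.1.1.le hs.1.2.le (abs_le.2 ⟨hs.2.1.le, hs.2.2.le⟩) hsS

theorem integral_inv_horizontal {c' c p b : ℝ} (hb : b ≠ 0) :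
    ∫ x in c'..c, ((x : ℂ) + b * Complex.I - p)⁻¹ =
      Complex.log (c + b * Complex.I - p) - Complex.log (c' + b * Complex.I - p) := by
  have hmem : ∀ x : ℝ, (x : ℂ) + b * Complex.I - p ∈ Complex.slitPlane := fun x =>
    Or.inr (by simpa using hb)
  refine intervalIntegral.integral_eq_sub_of_hasDerivAt
    (f := fun x : ℝ => Complex.log ((x : ℂ) + b * Complex.I - p)) (fun x _ => ?_) ?_
  · have h1 : HasDerivAt (fun x : ℝ => (x : ℂ) + b * Complex.I - p) 1 x :=
      ((Complex.ofRealCLM.hasDerivAt (x := x)).add_const _).sub_const _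
    simpa using h1.clog_real (hmem x)
  · refine Continuous.intervalIntegrable ?_ _ _
    exact Continuous.inv₀ (by fun_prop) fun x => Complex.slitPlane_ne_zero (hmem x)

/-- The sign of σ puts the rotated side into the right half-plane, where the principal logarithm is
a primitive even when the side lies to the left of p. -/
theorem integral_inv_vertical {a p : ℝ} (σ : ℝ) (hσ : 0 < σ * (a - p)) :
    (∫ y in (-1 : ℝ)..1, ((a : ℂ) + y * Complex.I - p)⁻¹) * Complex.I =
      Complex.log (σ * (a + Complex.I - p)) - Complex.log (σ * (a - Complex.I - p)) := by
  have hσ0 : (σ : ℂ) ≠ 0 := by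
    rintro h
    rw [Complex.ofReal_eq_zero] at h
    simp [h] at hσ
  have hmem : ∀ y : ℝ, (σ : ℂ) * ((a : ℂ) + y * Complex.I - p) ∈ Complex.slitPlane := fun y =>
    Or.inl (by simpa using hσ)
  have hne : ∀ y : ℝ, (a : ℂ) + y * Complex.I - p ≠ 0 := fun y h => by
    simpa [h] using Complex.slitPlane_ne_zero (hmem y)
  rw [← intervalIntegral.integral_mul_const]
  have := intervalIntegral.integral_eq_sub_of_hasDerivAt (a := -1) (b := 1)
    (f := fun y : ℝ => Complex.log ((σ : ℂ) * ((a : ℂ) + y * Complex.I - p)))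
    (f' := fun y : ℝ => ((a : ℂ) + y * Complex.I - p)⁻¹ * Complex.I) (fun y _ => ?_) ?_
  · rw [this]
    simp [sub_eq_add_neg]
  · have h1 : HasDerivAt (fun y : ℝ => (σ : ℂ) * ((a : ℂ) + y * Complex.I - p))
        ((σ : ℂ) * (1 * Complex.I)) y :=
      ((((Complex.ofRealCLM.hasDerivAt (x := y)).mul_const _).const_add _).sub_const _).const_mul _
    refine (h1.clog_real (hmem y)).congr_deriv ?_
    have := hne y
    field_simp
  · refine Continuous.intervalIntegrable ?_ _ _
    exact (Continuous.inv₀ (by fun_prop) hne).mul continuous_const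

theorem log_neg_of_im_pos {w : ℂ} (hw : 0 < w.im) :
    Complex.log (-w) = Complex.log w - Real.pi * Complex.I := by
  simp only [Complex.log, norm_neg, Complex.arg_neg_eq_arg_sub_pi_of_im_pos hw]
  push_cast
  ring

theorem log_neg_of_im_neg {w : ℂ} (hw : w.im < 0) :
    Complex.log (-w) = Complex.log w + Real.pi * Complex.I := by
  simp only [Complex.log, norm_neg, Complex.arg_neg_eq_arg_add_pi_of_im_neg hw]
  push_cast
  ring

/-- The logarithms at the corners cancel except on the left side, where log(-w) differs from log w
by -πi above the axis and by πi below it. These two jumps make up 2πi. -/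
theorem rectIntegral_inv {c' c p : ℝ} (hp' : c' < p) (hp : p < c) :
    rectIntegral c' c (fun s => (s - p)⁻¹) = 2 * Real.pi * Complex.I := by
  have h1 := integral_inv_horizontal (c' := c') (c := c) (p := p) (b := 1) one_ne_zero
  have h2 := integral_inv_horizontal (c' := c') (c := c) (p := p) (b := -1) (by norm_num)
  have h3 := integral_inv_vertical (a := c) (p := p) 1 (by linarith)
  have h4 := integral_inv_vertical (a := c') (p := p) (-1) (by linarith)
  simp only [Complex.ofReal_neg, Complex.ofReal_one, one_mul, neg_mul, ← sub_eq_add_neg]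
    at h1 h2 h3 h4
  rw [log_neg_of_im_pos (by simp), log_neg_of_im_neg (by simp)] at h4
  rw [rectIntegral, h1, h2, h3, h4]
  ring

/-- Cauchy's integral formula for the rectangle `[c', c] × [-1, 1]`. -/
theorem rectIntegral_div_sub {c' c p : ℝ} (hp' : c' < p) (hp : p < c) {f : ℂ → ℂ}
    (hf : ∀ s : ℂ, c' ≤ s.re → s.re ≤ c → |s.im| ≤ 1 → DifferentiableAt ℂ f s) :
    rectIntegral c' c (fun s => f s / (s - p)) = 2 * Real.pi * Complex.I * f p := by
  have hcc : c' ≤ c := (hp'.trans hp).le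
  -- The slope of f at p is continuous at p and holomorphic elsewhere, so its boundary integral
  -- vanishes. On the boundary it splits into f(s)/(s - p) and f(p)/(s - p).
  have h0 : rectIntegral c' c (dslope f p) = 0 := by
    refine rectIntegral_eq_zero hcc (S := {(p : ℂ)}) (Set.countable_singleton _)
      (fun s h1 h2 h3 => ?_) fun s h1 h2 h3 h4 => ?_
    · by_cases hs : s = p
      · rw [hs]
        exact continuousAt_dslope_same.2 (hf p (by simpa using hp'.le) (by simpa using hp.le)
          (by simp))
      · exact (continuousAt_dslope_of_ne hs).2 (hf s h1 h2 h3).continuousAt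
    · exact (differentiableAt_dslope_of_ne h4).2 (hf s h1 h2 h3)
  have hcalc : ∀ (s : ℂ), s ≠ p → dslope f p s = f s / (s - p) - f p * (s - p)⁻¹ := by
    intro s hs
    rw [dslope_of_ne _ hs, slope_def_field]
    ring
  have hH : ∀ (σ : ℂ), σ.re = 0 → |σ.im| = 1 → (∫ x in c'..c, dslope f p ((x : ℂ) + σ)) =
      (∫ x in c'..c, f ((x : ℂ) + σ) / ((x : ℂ) + σ - p)) -
        f p * ∫ x in c'..c, ((x : ℂ) + σ - p)⁻¹ := by
    intro σ h0 h1
    have hne : ∀ x : ℝ, (x : ℂ) + σ - p ≠ 0 := fun x h => by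
      have := congrArg Complex.im h
      simp only [Complex.sub_im, Complex.add_im, Complex.ofReal_im, zero_add, sub_zero,
        Complex.zero_im] at this
      rw [this] at h1
      simp at h1
    rw [← intervalIntegral.integral_const_mul, ← intervalIntegral.integral_sub]
    · exact intervalIntegral.integral_congr fun x _ => hcalc _ (sub_ne_zero.1 (hne x))
    · refine ContinuousOn.intervalIntegrable ?_
      rw [Set.uIcc_of_le hcc]
      refine ContinuousOn.div ?_ (by fun_prop) fun x _ => hne x
      intro x hx
      have := (hf ((x : ℂ) + σ) (by simpa [h0] using hx.1) (by simpa [h0] using hx.2)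
        (by simp [h1])).continuousAt
      exact (this.comp (f := fun x : ℝ => (x : ℂ) + σ) (by fun_prop)).continuousWithinAt
    · exact (Continuous.const_mul (Continuous.inv₀ (by fun_prop) hne) _).intervalIntegrable _ _ 
  have hV : ∀ (a : ℝ), c' ≤ a → a ≤ c → a ≠ p →
      (∫ y in (-1 : ℝ)..1, dslope f p ((a : ℂ) + y * Complex.I)) =
      (∫ y in (-1 : ℝ)..1, f ((a : ℂ) + y * Complex.I) / ((a : ℂ) + y * Complex.I - p)) -
        f p * ∫ y in (-1 : ℝ)..1, ((a : ℂ) + y * Complex.I - p)⁻¹ := by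
    intro a h0 h1 hap
    have hne : ∀ y : ℝ, (a : ℂ) + y * Complex.I - p ≠ 0 := fun y h => by
      have := congrArg Complex.re h
      simp only [Complex.sub_re, Complex.add_re, Complex.ofReal_re, Complex.mul_re, Complex.I_re,
        Complex.ofReal_im, Complex.I_im, mul_zero, zero_mul, sub_zero, add_zero,
        Complex.zero_re] at this
      exact hap (by linarith)
    rw [← intervalIntegral.integral_const_mul, ← intervalIntegral.integral_sub]
    · exact intervalIntegral.integral_congr fun x _ => hcalc _ (sub_ne_zero.1 (hne x))
    · refine ContinuousOn.intervalIntegrable ?_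
      rw [Set.uIcc_of_le (by norm_num)]
      refine ContinuousOn.div ?_ (by fun_prop) fun x _ => hne x
      intro y hy
      have := (hf ((a : ℂ) + y * Complex.I) (by simpa using h0) (by simpa using h1)
        (by simpa using abs_le.2 hy)).continuousAt
      exact (this.comp (f := fun y : ℝ => (a : ℂ) + y * Complex.I) (by fun_prop)).continuousWithinAt
    · exact (Continuous.const_mul (Continuous.inv₀ (by fun_prop) hne) _).intervalIntegrable _ _ 
  have hi := rectIntegral_inv hp' hp
  have e1 := hH Complex.I (by simp) (by simp)
  have e2 := hH (-Complex.I) (by simp) (by simp)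
  have e3 := hV c hcc le_rfl hp.ne'
  have e4 := hV c' le_rfl hcc hp'.ne
  simp only [← sub_eq_add_neg] at e2
  rw [rectIntegral] at h0 hi ⊢
  rw [e1, e2, e3, e4] at h0
  linear_combination h0 + f p * hi

/-- Continuity and exponential decay on the two rays of a loop. -/
def RayDecay (f : ℂ → ℂ) : Prop :=
  (∀ s : ℂ, s.re < 1 → |s.im| = 1 → ContinuousAt f s) ∧
    ∃ C δ : ℝ, 0 < δ ∧ ∀ s : ℂ, s.re < 1 → |s.im| = 1 → ‖f s‖ ≤ C * Real.exp (δ * s.re)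

theorem RayDecay.integrableOn {f : ℂ → ℂ} (hf : RayDecay f) {c : ℝ} (hc : c < 1) {σ : ℂ}
    (h0 : σ.re = 0) (h1 : |σ.im| = 1) : IntegrableOn (fun u : ℝ => f (u + σ)) (Set.Iic c) := by
  obtain ⟨hcont, C, δ, hδ, hb⟩ := hf
  refine Integrable.mono' ((integrableOn_exp_mul_Iic hδ c).const_mul C) ?_ ?_
  · refine ContinuousOn.aestronglyMeasurable (fun u hu => ?_) measurableSet_Iic
    have := hcont ((u : ℂ) + σ) (by simpa [h0] using lt_of_le_of_lt hu hc) (by simp [h1])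
    exact (this.comp (f := fun u : ℝ => (u : ℂ) + σ) (by fun_prop)).continuousWithinAt
  · refine (ae_restrict_iff' measurableSet_Iic).2 (Filter.Eventually.of_forall fun u hu => ?_)
    simpa [h0] using hb ((u : ℂ) + σ) (by simpa [h0] using lt_of_le_of_lt hu hc) (by simp [h1])

theorem loopIntegral_one (c : ℝ) (f : ℂ → ℂ) : loopIntegral c 1 f =
    (1 / (2 * (Real.pi : ℂ) * Complex.I)) * ((∫ u in Set.Iic c, f ((u : ℂ) + -Complex.I)) +
      (∫ t in (-1 : ℝ)..1, f ((c : ℂ) + (t : ℂ) * Complex.I)) * Complex.I -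
      ∫ u in Set.Iic c, f ((u : ℂ) + Complex.I)) := by
  simp [loopIntegral, sub_eq_add_neg]

/-- The parts of the rays to the left of both abscissas cancel; ray decay makes each ray integral
finite. -/
theorem loopIntegral_sub_loopIntegral {f : ℂ → ℂ} (hf : RayDecay f) {c c' : ℝ}
    (hc : c < 1) (hc' : c' < 1) :
    loopIntegral c 1 f - loopIntegral c' 1 f =
      1 / (2 * Real.pi * Complex.I) * rectIntegral c' c f := by
  rw [loopIntegral_one, loopIntegral_one, rectIntegral,
    ← intervalIntegral.integral_Iic_sub_Iic (hf.integrableOn hc' (by simp) (by simp))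
      (hf.integrableOn hc (by simp) (by simp))]
  simp only [sub_eq_add_neg (_ : ℂ) Complex.I]
  rw [← intervalIntegral.integral_Iic_sub_Iic (hf.integrableOn hc' (by simp) (by simp))
      (hf.integrableOn hc (by simp) (by simp))]
  ring

theorem loopIntegral_congr {f g : ℂ → ℂ} {c : ℝ}
    (h : ∀ s : ℂ, s.re ≤ c → |s.im| ≤ 1 → (s.re = c ∨ |s.im| = 1) → f s = g s) :
    loopIntegral c 1 f = loopIntegral c 1 g := by
  rw [loopIntegral_one, loopIntegral_one]
  congr 1
  congr 1
  · congr 1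
    · refine setIntegral_congr_fun measurableSet_Iic fun u hu => h _ ?_ ?_ ?_
      · simpa using hu
      · simp
      · simp
    · congr 1
      refine intervalIntegral.integral_congr fun t ht => h _ ?_ ?_ ?_
      · simp
      · rw [Set.uIcc_of_le (by norm_num)] at ht
        simpa using abs_le.2 ht
      · simp
  · refine setIntegral_congr_fun measurableSet_Iic fun u hu => h _ ?_ ?_ ?_
    · simpa using hu
    · simp
    · simp

/-! ### Residue sums -/

theorem rectIntegral_congr {f g : ℂ → ℂ} {c' c : ℝ} (hcc : c' ≤ c)
    (h : ∀ s : ℂ, c' ≤ s.re → s.re ≤ c → |s.im| ≤ 1 → f s = g s) :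
    rectIntegral c' c f = rectIntegral c' c g := by
  have hH : ∀ σ : ℂ, σ.re = 0 → |σ.im| = 1 →
      (∫ x in c'..c, f ((x : ℂ) + σ)) = ∫ x in c'..c, g ((x : ℂ) + σ) := by
    intro σ h0 h1
    refine intervalIntegral.integral_congr fun x hx => ?_
    rw [Set.uIcc_of_le hcc] at hx
    exact h _ (by simpa [h0] using hx.1) (by simpa [h0] using hx.2) (by simp [h1])
  have hV : ∀ a : ℝ, c' ≤ a → a ≤ c → (∫ y in (-1 : ℝ)..1, f ((a : ℂ) + y * Complex.I)) =
      ∫ y in (-1 : ℝ)..1, g ((a : ℂ) + y * Complex.I) := by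
    intro a h0 h1
    refine intervalIntegral.integral_congr fun y hy => ?_
    rw [Set.uIcc_of_le (by norm_num)] at hy
    exact h _ (by simpa using h0) (by simpa using h1) (by simpa using abs_le.2 hy)
  simp only [rectIntegral, sub_eq_add_neg (_ : ℂ) Complex.I]
  rw [hH Complex.I (by simp) (by simp), hH (-Complex.I) (by simp) (by simp), hV c hcc le_rfl,
    hV c' le_rfl hcc]

theorem complex_Gamma_add_nat (s : ℂ) (n : ℕ) (h : ∀ j < n, s + j ≠ 0) :
    Complex.Gamma (s + n) = (∏ j ∈ Finset.range n, (s + j)) * Complex.Gamma s := by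
  induction n with
  | zero => simp
  | succ n ih =>
    rw [Finset.prod_range_succ, Nat.cast_succ, ← add_assoc,
      Complex.Gamma_add_one _ (h n n.lt_succ_self), ih fun j hj => h j (hj.trans n.lt_succ_self)]
    ring

theorem prod_range_neg_add (k : ℕ) :
    ∏ j ∈ Finset.range k, (-(k : ℂ) + j) = (-1) ^ k * (k.factorial : ℂ) := by
  rw [← Finset.prod_range_reflect]
  have h : ∀ j ∈ Finset.range k, -(k : ℂ) + ((k - 1 - j : ℕ) : ℂ) = -1 * ((j + 1 : ℕ) : ℂ) := by
    intro j hj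
    have hj' : j + 1 ≤ k := Finset.mem_range.1 hj
    rw [show k - 1 - j = k - (j + 1) by omega, Nat.cast_sub hj']
    ring
  rw [Finset.prod_congr rfl h, Finset.prod_mul_distrib, Finset.prod_const, Finset.card_range,
    ← Nat.cast_prod, Finset.prod_range_add_one_eq_factorial]

/-- In this strip -k is the only pole of Γ. Writing Γ(s) = Γ(s+k+1) / ∏_{j≤k} (s+j) isolates the
factor s + k, and Cauchy's formula gives the residue. -/
theorem rectIntegral_Gamma_mul {φ : ℂ → ℂ} {c : ℝ} (hc0 : 0 < c) (hc1 : c < 1) (k : ℕ)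
    (hφ : ∀ s : ℂ, s.re < 1 → DifferentiableAt ℂ φ s) :
    rectIntegral (c - k - 1) (c - k) (fun s => Complex.Gamma s * φ s) =
      2 * Real.pi * Complex.I * ((-1) ^ k / (k.factorial : ℂ) * φ (-k)) := by
  let G : ℂ → ℂ := fun s =>
    Complex.Gamma (s + (k + 1 : ℕ)) / (∏ j ∈ Finset.range k, (s + j)) * φ s
  have hne : ∀ s : ℂ, c - k - 1 ≤ s.re → s.re ≤ c - k → ∀ j < k, s + (j : ℂ) ≠ 0 := by
    intro s h1 h2 j hj h
    have := congrArg Complex.re h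
    simp only [Complex.add_re, Complex.natCast_re, Complex.zero_re] at this
    have : (j : ℝ) + 1 ≤ k := by exact_mod_cast hj
    linarith
  have hG : ∀ s : ℂ, c - k - 1 ≤ s.re → s.re ≤ c - k → |s.im| ≤ 1 → DifferentiableAt ℂ G s := by
    intro s h1 h2 _
    refine DifferentiableAt.mul (DifferentiableAt.div ?_ ?_ ?_) (hφ s ?_)
    · refine (Complex.differentiableAt_Gamma _ fun m h => ?_).comp s (by fun_prop)
      have := congrArg Complex.re h
      simp only [Complex.add_re, Complex.natCast_re, Complex.neg_re] at this
      push_cast at this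
      have : (0 : ℝ) ≤ m := by positivity
      linarith
    · fun_prop
    · exact Finset.prod_ne_zero_iff.2 fun j hj => hne s h1 h2 j (Finset.mem_range.1 hj)
    · have : (0 : ℝ) ≤ k := by positivity
      linarith
  have hfG : ∀ s : ℂ, c - k - 1 ≤ s.re → s.re ≤ c - k → |s.im| ≤ 1 →
      Complex.Gamma s * φ s = G s / (s - ((-k : ℝ) : ℂ)) := by
    intro s h1 h2 _
    -- At the pole itself both sides are zero by convention: `Complex.Gamma` takes the value 0 there
    -- and the quotient has denominator 0.
    by_cases hs : s + (k : ℂ) = 0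
    · have hs' : s = -(k : ℂ) := eq_neg_of_add_eq_zero_left hs
      have : s - ((-k : ℝ) : ℂ) = 0 := by rw [hs']; simp
      rw [this, div_zero, hs', Complex.Gamma_neg_nat_eq_zero, zero_mul]
    · have hprod : ∏ j ∈ Finset.range k, (s + (j : ℂ)) ≠ 0 :=
        Finset.prod_ne_zero_iff.2 fun j hj => hne s h1 h2 j (Finset.mem_range.1 hj)
      have hg := complex_Gamma_add_nat s (k + 1) fun j hj => by
        rcases Nat.lt_succ_iff_lt_or_eq.1 hj with h | h
        · exact hne s h1 h2 j h
        · rw [h]; exact hs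
      rw [Finset.prod_range_succ] at hg
      have e : s - ((-k : ℝ) : ℂ) = s + k := by push_cast; ring
      simp only [G]
      rw [e, hg]
      field_simp
  rw [rectIntegral_congr (by linarith) hfG,
    rectIntegral_div_sub (by linarith) (by linarith) hG]
  simp only [G]
  push_cast
  rw [prod_range_neg_add, neg_add_cancel_left, Complex.Gamma_one]
  congr 2
  rw [one_div, mul_inv, div_eq_mul_inv, ← inv_pow]
  norm_num

/-- The loop integral of `Γ(s) φ(s)` is the sum of the residues. -/
theorem tendsto_residue_sum {φ : ℂ → ℂ} {c : ℝ} (hc0 : 0 < c) (hc1 : c < 1)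
    (hφ : ∀ s : ℂ, s.re < 1 → DifferentiableAt ℂ φ s)
    (hray : RayDecay fun s => Complex.Gamma s * φ s)
    (hvert : ∃ C δ : ℝ, 0 < δ ∧ ∀ N : ℕ, ∀ t : ℝ, |t| ≤ 1 →
      ‖Complex.Gamma (c + t * Complex.I - N) * φ (c + t * Complex.I - N)‖ ≤
        C * Real.exp (-δ * N)) :
    Filter.Tendsto (fun N : ℕ => ∑ k ∈ Finset.range N, (-1) ^ k / (k.factorial : ℂ) * φ (-k))
      Filter.atTop (nhds (loopIntegral c 1 fun s => Complex.Gamma s * φ s)) := by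
  set f : ℂ → ℂ := fun s => Complex.Gamma s * φ s with hf
  have hpi : 2 * (Real.pi : ℂ) * Complex.I ≠ 0 := Complex.two_pi_I_ne_zero
  -- Each shift of the abscissa by one crosses exactly one pole, so the residues telescope.
  have hsum : ∀ N : ℕ, ∑ k ∈ Finset.range N, (-1) ^ k / (k.factorial : ℂ) * φ (-k) =
      loopIntegral c 1 f - loopIntegral (c - N) 1 f := by
    intro N
    induction N with
    | zero => simp
    | succ N ih =>
      have h := loopIntegral_sub_loopIntegral hray (c := c - N) (c' := c - N - 1)
        (by have : (0 : ℝ) ≤ N := by positivity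
            linarith) (by have : (0 : ℝ) ≤ N := by positivity
                          linarith)
      rw [rectIntegral_Gamma_mul hc0 hc1 N hφ, ← mul_assoc, one_div_mul_cancel hpi, one_mul] at h
      rw [Finset.sum_range_succ, ih, ← h]
      push_cast
      rw [show c - (N + 1 : ℝ) = c - N - 1 by ring]
      ring
  -- The shifted loops vanish in the limit: the rays by the decay of f, the vertical sides by
  -- `hvert`.
  have hlim : Filter.Tendsto (fun N : ℕ => loopIntegral (c - N) 1 f) Filter.atTop (nhds 0) := by
    obtain ⟨hcont, C₁, δ₁, hδ₁, hb₁⟩ := hray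
    obtain ⟨C₂, δ₂, hδ₂, hb₂⟩ := hvert
    have hH : ∀ (N : ℕ) (σ : ℂ), σ.re = 0 → |σ.im| = 1 →
        ‖∫ u in Set.Iic (c - N), f ((u : ℂ) + σ)‖ ≤
          C₁ * (Real.exp (δ₁ * (c - N)) / δ₁) := by
      intro N σ h0 h1
      rw [← integral_exp_mul_Iic hδ₁, ← integral_const_mul]
      refine norm_integral_le_of_norm_le
        ((integrableOn_exp_mul_Iic hδ₁ _).const_mul C₁) ?_
      refine (ae_restrict_iff' measurableSet_Iic).2 (Filter.Eventually.of_forall fun u hu => ?_)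
      have hu' : u ≤ c - N := hu
      have : (0 : ℝ) ≤ N := by positivity
      simpa [h0] using hb₁ ((u : ℂ) + σ) (by simp [h0]; linarith) (by simp [h1])
    have hV : ∀ N : ℕ, ‖(∫ t in (-1 : ℝ)..1, f (((c - N : ℝ) : ℂ) + t * Complex.I)) *
        Complex.I‖ ≤ C₂ * Real.exp (-δ₂ * N) * 2 := by
      intro N
      rw [norm_mul, Complex.norm_I, mul_one]
      have := intervalIntegral.norm_integral_le_of_norm_le_const (a := -1) (b := 1)
        (f := fun t : ℝ => f (((c - N : ℝ) : ℂ) + t * Complex.I))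
        (C := C₂ * Real.exp (-δ₂ * N)) fun t ht => ?_
      · simpa [show |(1 : ℝ) + 1| = 2 by norm_num] using this
      · rw [Set.uIoc_of_le (by norm_num)] at ht
        have := hb₂ N t (abs_le.2 ⟨ht.1.le, ht.2⟩)
        rwa [show (c : ℂ) + t * Complex.I - N = ((c - N : ℝ) : ℂ) + t * Complex.I by
          push_cast; ring] at this
    have hexp : ∀ δ : ℝ, 0 < δ →
        Filter.Tendsto (fun N : ℕ => Real.exp (-δ * N)) Filter.atTop (nhds 0) := by
      intro δ hδ
      refine Real.tendsto_exp_atBot.comp ?_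
      exact tendsto_natCast_atTop_atTop.const_mul_atTop_of_neg (by linarith)
    have hB : Filter.Tendsto (fun N : ℕ => ‖1 / (2 * (Real.pi : ℂ) * Complex.I)‖ *
        (C₁ * (Real.exp (δ₁ * c) * Real.exp (-δ₁ * N) / δ₁) + C₂ * Real.exp (-δ₂ * N) * 2 +
          C₁ * (Real.exp (δ₁ * c) * Real.exp (-δ₁ * N) / δ₁))) Filter.atTop (nhds 0) := by
      have h1 : Filter.Tendsto (fun N : ℕ => C₁ * (Real.exp (δ₁ * c) * Real.exp (-δ₁ * N) / δ₁))
          Filter.atTop (nhds 0) := by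
        simpa using (((hexp δ₁ hδ₁).const_mul (Real.exp (δ₁ * c))).div_const δ₁).const_mul C₁
      have h2 : Filter.Tendsto (fun N : ℕ => C₂ * Real.exp (-δ₂ * N) * 2)
          Filter.atTop (nhds 0) := by
        simpa using ((hexp δ₂ hδ₂).const_mul C₂).mul_const 2
      simpa using ((h1.add h2).add h1).const_mul ‖1 / (2 * (Real.pi : ℂ) * Complex.I)‖
    refine squeeze_zero_norm (fun N => ?_) hB
    rw [loopIntegral_one, norm_mul]
    refine mul_le_mul_of_nonneg_left ?_ (norm_nonneg _)
    have e : Real.exp (δ₁ * c) * Real.exp (-δ₁ * N) = Real.exp (δ₁ * (c - N)) := by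
      rw [← Real.exp_add]; congr 1; ring
    rw [e]
    refine (norm_sub_le _ _).trans (add_le_add ((norm_add_le _ _).trans (add_le_add ?_ (hV N))) ?_)
    · exact hH N (-Complex.I) (by simp) (by simp)
    · exact hH N Complex.I (by simp) (by simp)
  simp only [hsum]
  simpa using hlim.const_sub (loopIntegral c 1 f)

/-! ### Subexponential growth -/

/-- Subexponential growth along the two rays of a loop. -/
def SubexpOnRays (f : ℂ → ℂ) : Prop :=
  ∀ ε : ℝ, 0 < ε → ∃ C : ℝ, 0 ≤ C ∧ ∀ s : ℂ, s.re < 1 → |s.im| = 1 →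
    ‖f s‖ ≤ C * Real.exp (-ε * s.re)

/-- Once A/N ≤ ε, a unit translation costs at most a factor exp ε. The finitely many earlier
translates are bounded by compactness, which fixes C. -/
theorem exists_bound_translates {f : ℂ → ℂ} {K : Set ℂ} (hK : IsCompact K)
    (hcont : ∀ N : ℕ, ∀ s ∈ K, ContinuousAt f (s - N)) {A : ℝ}
    (hstep : ∀ N : ℕ, 1 ≤ N → ∀ s ∈ K, ‖f (s - N - 1)‖ ≤ Real.exp (A / N) * ‖f (s - N)‖)
    {ε : ℝ} (hε : 0 < ε) :
    ∃ C : ℝ, 0 ≤ C ∧ ∀ N : ℕ, ∀ s ∈ K, ‖f (s - N)‖ ≤ C * Real.exp (ε * N) := by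
  have hb : ∀ N : ℕ, ∃ B : ℝ, ∀ s ∈ K, ‖f (s - N)‖ ≤ B := fun N =>
    hK.exists_bound_of_continuousOn fun s hs =>
      ((hcont N s hs).comp (f := fun s : ℂ => s - N) (by fun_prop)).continuousWithinAt
  choose B hB using hb
  obtain ⟨N₀, hN₀⟩ := exists_nat_ge (max (A / ε) 1)
  have hN₁ : 1 ≤ N₀ := by exact_mod_cast (le_max_right _ _).trans hN₀
  have hstep' : ∀ N : ℕ, N₀ ≤ N → A / N ≤ ε := by
    intro N hN
    have h1 : (0 : ℝ) < N := by exact_mod_cast hN₁.trans hN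
    rw [div_le_iff₀ h1]
    have h2 : A / ε ≤ N := (le_max_left _ _).trans (hN₀.trans (by exact_mod_cast hN))
    rwa [div_le_iff₀ hε, mul_comm] at h2
  let C : ℝ := ∑ N ∈ Finset.range (N₀ + 1), |B N|
  have hC : ∀ N ≤ N₀, B N ≤ C := fun N hN => (le_abs_self _).trans
    (Finset.single_le_sum (f := fun N => |B N|) (fun i _ => abs_nonneg _)
      (Finset.mem_range.2 (Nat.lt_succ_of_le hN)))
  have hC0 : 0 ≤ C := Finset.sum_nonneg fun i _ => abs_nonneg _
  refine ⟨C, hC0, fun N => ?_⟩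
  induction N with
  | zero =>
    intro s hs
    simpa using (hB 0 s hs).trans (hC 0 (Nat.zero_le _))
  | succ N ih =>
    intro s hs
    rcases lt_or_ge N N₀ with h | h
    · refine ((hB (N + 1) s hs).trans (hC (N + 1) h)).trans ?_
      refine le_mul_of_one_le_right hC0 (Real.one_le_exp ?_)
      positivity
    · have h1 := hstep N (hN₁.trans h) s hs
      rw [show s - ((N + 1 : ℕ) : ℂ) = s - N - 1 by push_cast; ring]
      calc ‖f (s - N - 1)‖ ≤ Real.exp (A / N) * ‖f (s - N)‖ := h1
        _ ≤ Real.exp ε * (C * Real.exp (ε * N)) := by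
          gcongr
          · exact hstep' N h
          · exact ih s hs
        _ = C * Real.exp (ε * (N + 1 : ℕ)) := by
          rw [mul_left_comm, ← Real.exp_add]; congr 2; push_cast; ring

/-- Every point of the two rays is an integer translate of a point with real part in [0, 1] and
imaginary part ±1. Growth bounds thus follow from the functional equation alone, without Stirling's
formula. -/
theorem subexpOnRays_of_step {f : ℂ → ℂ}
    (hcont : ∀ s : ℂ, s.re ≤ 1 → |s.im| = 1 → ContinuousAt f s) {A : ℝ}
    (hstep : ∀ N : ℕ, 1 ≤ N → ∀ s : ℂ, s.re ≤ 1 → |s.im| ≤ 1 →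
      ‖f (s - N - 1)‖ ≤ Real.exp (A / N) * ‖f (s - N)‖) : SubexpOnRays f := by
  intro ε hε
  let K : Set ℂ := Set.Icc 0 1 ×ℂ {-1, 1}
  have hK : IsCompact K := isCompact_Icc.reProdIm (Set.toFinite _).isCompact
  have him : ∀ s : ℂ, s.im ∈ ({-1, 1} : Set ℝ) ↔ |s.im| = 1 := by
    intro s
    rw [abs_eq (by norm_num), or_comm]
    rfl
  obtain ⟨C, hC0, hC⟩ := exists_bound_translates hK (f := f) (A := A) (fun N s hs => by
      refine hcont _ ?_ ?_
      · have : (0 : ℝ) ≤ N := by positivity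
        simp
        linarith [hs.1.2]
      · simpa using (him s).1 hs.2) (fun N hN s hs =>
      hstep N hN s hs.1.2 ((him s).1 hs.2).le) hε
  refine ⟨C * Real.exp ε, by positivity, fun s h1 h2 => ?_⟩
  set N := ⌊1 - s.re⌋₊ with hN
  have hN1 : (N : ℝ) ≤ 1 - s.re := Nat.floor_le (by linarith)
  have hN2 : 1 - s.re < N + 1 := Nat.lt_floor_add_one _
  have := hC N (s + N) ⟨⟨by simp; linarith, by simp; linarith⟩, by
    show (s + N).im ∈ ({-1, 1} : Set ℝ)
    rw [him]
    simpa using h2⟩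
  rw [add_sub_cancel_right] at this
  refine this.trans ?_
  rw [mul_assoc, ← Real.exp_add]
  gcongr
  nlinarith

theorem exists_bound_vertical_of_step {f : ℂ → ℂ} {c : ℝ} (hc1 : c < 1)
    (hcont : ∀ N : ℕ, ∀ s : ℂ, s.re = c → ContinuousAt f (s - N)) {A : ℝ}
    (hstep : ∀ N : ℕ, 1 ≤ N → ∀ s : ℂ, s.re ≤ 1 → |s.im| ≤ 1 →
      ‖f (s - N - 1)‖ ≤ Real.exp (A / N) * ‖f (s - N)‖) {ε : ℝ} (hε : 0 < ε) :
    ∃ C : ℝ, 0 ≤ C ∧ ∀ N : ℕ, ∀ t : ℝ, |t| ≤ 1 →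
      ‖f (c + t * Complex.I - N)‖ ≤ C * Real.exp (ε * N) := by
  let K : Set ℂ := {c} ×ℂ Set.Icc (-1) 1
  have hK : IsCompact K := (Set.toFinite _).isCompact.reProdIm isCompact_Icc
  obtain ⟨C, hC0, hC⟩ := exists_bound_translates hK (f := f) (A := A)
    (fun N s hs => hcont N s hs.1) (fun N hN s hs => hstep N hN s
      (by rw [show s.re = c from hs.1]; exact hc1.le) (abs_le.2 hs.2)) hε
  exact ⟨C, hC0, fun N t ht => hC N _ ⟨by simp, by simpa using abs_le.1 ht⟩⟩

theorem norm_one_add_div_le {A : ℝ} (hA : 0 ≤ A) {w : ℂ} {N : ℕ} (hN : 1 ≤ N)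
    (hw : (N : ℝ) ≤ ‖w‖) : ‖1 + (A : ℂ) / w‖ ≤ Real.exp (A / N) := by
  have hN0 : (0 : ℝ) < N := by exact_mod_cast hN
  calc ‖1 + (A : ℂ) / w‖ ≤ 1 + A / ‖w‖ := by
        refine (norm_add_le _ _).trans ?_
        rw [norm_one, norm_div, Complex.norm_real, Real.norm_of_nonneg hA]
    _ ≤ A / N + 1 := by
        rw [add_comm]
        gcongr
    _ ≤ Real.exp (A / N) := Real.add_one_le_exp _

theorem norm_cpow_neg_le {y : ℂ} (hy0 : y ≠ 0) {s : ℂ} (hs : |s.im| ≤ 1) :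
    ‖y ^ (-s)‖ ≤ Real.exp (-Real.log ‖y‖ * s.re) * Real.exp Real.pi := by
  rw [Complex.norm_cpow_of_ne_zero hy0]
  have e1 : ‖y‖ ^ (-s).re = Real.exp (-Real.log ‖y‖ * s.re) := by
    rw [Real.rpow_def_of_pos (norm_pos_iff.2 hy0)]; congr 1; simp
  have e2 : 1 / Real.exp (y.arg * (-s).im) ≤ Real.exp Real.pi := by
    rw [one_div, ← Real.exp_neg]
    refine Real.exp_le_exp.2 ((le_abs_self _).trans ?_)
    rw [abs_neg, abs_mul, Complex.neg_im, abs_neg]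
    exact (mul_le_of_le_one_right (abs_nonneg _) hs).trans (Complex.abs_arg_le_pi y)
  rw [div_eq_mul_one_div, e1]
  gcongr

theorem SubexpOnRays.rayDecay_mul_cpow {f : ℂ → ℂ} (hf : SubexpOnRays f)
    (hcont : ∀ s : ℂ, s.re < 1 → |s.im| = 1 → ContinuousAt f s) {y : ℂ} (hy0 : y ≠ 0)
    (hy1 : ‖y‖ < 1) : RayDecay fun s => f s * y ^ (-s) := by
  refine ⟨fun s h1 h2 => (hcont s h1 h2).mul ?_, ?_⟩
  · exact ContinuousAt.const_cpow continuous_neg.continuousAt (Or.inl hy0)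
  · have hL : Real.log ‖y‖ < 0 := Real.log_neg (norm_pos_iff.2 hy0) hy1
    -- Half of the decay rate of y^{-s} absorbs the growth of f, and the other half remains.
    obtain ⟨C, hC0, hC⟩ := hf (-Real.log ‖y‖ / 2) (by linarith)
    refine ⟨C * Real.exp Real.pi, -Real.log ‖y‖ / 2, by linarith, fun s h1 h2 => ?_⟩
    rw [norm_mul]
    calc ‖f s‖ * ‖y ^ (-s)‖ ≤ (C * Real.exp (-(-Real.log ‖y‖ / 2) * s.re)) *
          (Real.exp (-Real.log ‖y‖ * s.re) * Real.exp Real.pi) := by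
          gcongr
          · exact hC s h1 h2
          · exact norm_cpow_neg_le hy0 h2.le
      _ = C * Real.exp Real.pi * (Real.exp (-(-Real.log ‖y‖ / 2) * s.re) *
          Real.exp (-Real.log ‖y‖ * s.re)) := by ring
      _ = _ := by rw [← Real.exp_add]; congr 2; ring

/-- The step bound makes Γφ subexponential to the left, while y^{-s} decays exponentially since |y|
< 1. Only integer powers of y appear in the residues, so y may lie on the branch cut. -/
theorem tendsto_residue_sum_cpow {φ : ℂ → ℂ} {c : ℝ} (hc0 : 0 < c) (hc1 : c < 1)
    (hφ : ∀ s : ℂ, s.re < 1 → DifferentiableAt ℂ φ s)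
    (hcont : ∀ s : ℂ, s.re ≤ 1 → |s.im| = 1 → ContinuousAt φ s) {A : ℝ}
    (hstep : ∀ N : ℕ, 1 ≤ N → ∀ s : ℂ, s.re ≤ 1 → |s.im| ≤ 1 →
      ‖Complex.Gamma (s - N - 1) * φ (s - N - 1)‖ ≤
        Real.exp (A / N) * ‖Complex.Gamma (s - N) * φ (s - N)‖)
    {y : ℂ} (hy0 : y ≠ 0) (hy1 : ‖y‖ < 1) :
    Filter.Tendsto
      (fun N : ℕ => ∑ k ∈ Finset.range N, (-1) ^ k / (k.factorial : ℂ) * φ (-k) * y ^ k)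
      Filter.atTop (nhds (loopIntegral c 1 fun s => Complex.Gamma s * φ s * y ^ (-s))) := by
  have hcontG : ∀ s : ℂ, (∀ m : ℕ, s ≠ -m) → ContinuousAt Complex.Gamma s := fun s hs =>
    (Complex.differentiableAt_Gamma s hs).continuousAt
  have him : ∀ s : ℂ, |s.im| = 1 → ∀ m : ℕ, s ≠ -m := by
    rintro s hs m rfl
    simp at hs
  have hcf : ∀ s : ℂ, s.re ≤ 1 → |s.im| = 1 →
      ContinuousAt (fun s => Complex.Gamma s * φ s) s := fun s h1 h2 =>
    (hcontG s (him s h2)).mul (hcont s h1 h2)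
  have hray := (subexpOnRays_of_step hcf hstep).rayDecay_mul_cpow
    (fun s h1 h2 => hcf s h1.le h2) hy0 hy1
  simp only [mul_assoc] at hray
  have hL : Real.log ‖y‖ < 0 := Real.log_neg (norm_pos_iff.2 hy0) hy1
  have hvert := exists_bound_vertical_of_step hc1 (f := fun s => Complex.Gamma s * φ s)
    (fun N s hs => by
      have hN : (0 : ℝ) ≤ N := by positivity
      refine (hcontG _ fun m h => ?_).mul (hφ _ ?_).continuousAt
      · have h1 := congrArg Complex.re h
        simp only [Complex.sub_re, Complex.natCast_re, Complex.neg_re, hs] at h1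
        -- A pole on the vertical line would make c an integer strictly between 0 and 1.
        have h2 : c = ((N : ℤ) - (m : ℤ) : ℤ) := by push_cast; linarith
        rw [h2] at hc0 hc1
        norm_cast at hc0 hc1
        omega
      · simp only [Complex.sub_re, Complex.natCast_re, hs]
        linarith) hstep (ε := -Real.log ‖y‖ / 2) (by linarith)
  obtain ⟨C, hC0, hC⟩ := hvert
  have key := tendsto_residue_sum (φ := fun s => φ s * y ^ (-s)) hc0 hc1 (fun s hs =>
    (hφ s hs).mul (differentiableAt_id.neg.const_cpow (Or.inl hy0))) hray ?_
  · simp only [neg_neg, Complex.cpow_natCast] at key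
    simpa only [mul_assoc] using key
  · refine ⟨C * (Real.exp (-Real.log ‖y‖ * c) * Real.exp Real.pi), -Real.log ‖y‖ / 2, by linarith,
      fun N t ht => ?_⟩
    rw [← mul_assoc, norm_mul]
    calc ‖Complex.Gamma (c + t * Complex.I - N) * φ (c + t * Complex.I - N)‖ *
          ‖y ^ (-(c + t * Complex.I - N : ℂ))‖
        ≤ (C * Real.exp (-Real.log ‖y‖ / 2 * N)) *
          (Real.exp (-Real.log ‖y‖ * (c - N)) * Real.exp Real.pi) := by
          gcongr
          · exact hC N t ht
          · have := norm_cpow_neg_le hy0 (s := c + t * Complex.I - N) (by simpa using ht)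
            simpa using this
      _ = C * Real.exp Real.pi * (Real.exp (-Real.log ‖y‖ / 2 * N) *
          Real.exp (-Real.log ‖y‖ * (c - N))) := by ring
      _ = C * Real.exp Real.pi * (Real.exp (-Real.log ‖y‖ * c) *
          Real.exp (-(-Real.log ‖y‖ / 2) * N)) := by
          rw [← Real.exp_add, ← Real.exp_add]; congr 2; ring
      _ = _ := by ring

/-! ### The loop as one parametrized path -/

/-- The loop from `-∞ - i` through `c ∓ i` to `-∞ + i`. -/
def loopPath (c τ : ℝ) : ℂ :=
  ((c + min 0 (1 - |τ|) : ℝ) : ℂ) + ((max (-1) (min 1 τ) : ℝ) : ℂ) * Complex.I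

/-- The velocity of `loopPath`. -/
def loopSpeed (τ : ℝ) : ℂ := if τ ≤ -1 then 1 else if τ < 1 then Complex.I else -1

theorem continuous_loopPath (c : ℝ) : Continuous (loopPath c) := by
  unfold loopPath
  fun_prop

theorem loopPath_re (c τ : ℝ) : (loopPath c τ).re = c + min 0 (1 - |τ|) := by
  simp [loopPath]

theorem loopPath_im (c τ : ℝ) : (loopPath c τ).im = max (-1) (min 1 τ) := by
  simp [loopPath]

theorem loopPath_re_le (c τ : ℝ) : (loopPath c τ).re ≤ c := by
  rw [loopPath_re]
  linarith [min_le_left 0 (1 - |τ|)]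

theorem loopPath_cases (c τ : ℝ) :
    |(loopPath c τ).im| ≤ 1 ∧ ((loopPath c τ).re = c ∨ |(loopPath c τ).im| = 1) := by
  rw [loopPath_re, loopPath_im]
  rcases le_total |τ| 1 with h | h
  · refine ⟨abs_le.2 ⟨le_max_left _ _, max_le (by norm_num) (min_le_left _ _)⟩, Or.inl ?_⟩
    rw [min_eq_left (by linarith), add_zero]
  · have : |max (-1) (min 1 τ)| = 1 := by
      rcases le_abs'.1 h with h | h
      · rw [min_eq_right (by linarith), max_eq_left h]; norm_num
      · rw [min_eq_left h, max_eq_right (by norm_num)]; norm_num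
    exact ⟨this.le, Or.inr this⟩

theorem loopPath_mem_slitPlane {c : ℝ} (hc : 0 < c) (τ : ℝ) :
    loopPath c τ ∈ Complex.slitPlane := by
  rcases (loopPath_cases c τ).2 with h | h
  · exact Or.inl (by rw [h]; exact hc)
  · refine Or.inr fun h0 => ?_
    rw [h0] at h
    simp at h

theorem norm_loopSpeed (τ : ℝ) : ‖loopSpeed τ‖ = 1 := by
  unfold loopSpeed
  split_ifs <;> simp

theorem measurable_loopSpeed : Measurable loopSpeed :=
  Measurable.ite measurableSet_Iic measurable_const
    (Measurable.ite measurableSet_Iio measurable_const measurable_const)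

/-- A single Lebesgue integral over the real line makes Fubini and differentiation under the
integral applicable to the loop. -/
theorem loopIntegral_eq_integral {f : ℂ → ℂ} (hf : RayDecay f) {c : ℝ} (hc : c < 1)
    (hcont : ContinuousOn (fun t : ℝ => f (c + t * Complex.I)) (Set.Icc (-1) 1)) :
    Integrable (fun τ => f (loopPath c τ)) ∧ loopIntegral c 1 f =
      (1 / (2 * (Real.pi : ℂ) * Complex.I)) * ∫ τ, loopSpeed τ * f (loopPath c τ) := by
  have hray : ∀ {σ : ℂ}, σ.re = 0 → |σ.im| = 1 →
      IntegrableOn (fun u : ℝ => f (u + σ)) (Set.Iic c) := hf.integrableOn hc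
  have p1 : ∀ τ ∈ Set.Iic (-1 : ℝ),
      f (loopPath c τ) = f (((τ + (c + 1) : ℝ) : ℂ) + -Complex.I) := by
    intro τ hτ
    have hτ' : τ ≤ -1 := hτ
    rw [loopPath, abs_of_nonpos (by linarith), min_eq_right (a := 0) (by linarith),
      min_eq_right (a := 1) (by linarith), max_eq_left hτ']
    congr 1
    push_cast
    ring
  have p2 : ∀ τ ∈ Set.Ioo (-1 : ℝ) 1, f (loopPath c τ) = f (c + τ * Complex.I) := by
    intro τ hτ
    have : |τ| ≤ 1 := abs_le.2 ⟨hτ.1.le, hτ.2.le⟩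
    rw [loopPath, min_eq_left (a := 0) (by linarith),
      min_eq_right (a := 1) hτ.2.le, max_eq_right hτ.1.le, add_zero]
  have p3 : ∀ τ ∈ Set.Ici (1 : ℝ),
      f (loopPath c τ) = f (((c + 1 - τ : ℝ) : ℂ) + Complex.I) := by
    intro τ hτ
    have hτ' : 1 ≤ τ := hτ
    rw [loopPath, abs_of_nonneg (by linarith), min_eq_right (a := 0) (by linarith),
      min_eq_left (a := 1) (by linarith), max_eq_right (by norm_num)]
    congr 1
    push_cast
    ring
  have m1 := measurePreserving_add_right (volume : Measure ℝ) (c + 1)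
  have m3 := Measure.measurePreserving_sub_left (volume : Measure ℝ) (c + 1)
  have b1 : MeasurableEmbedding fun τ : ℝ => τ + (c + 1) := measurableEmbedding_addRight _
  have b3 : MeasurableEmbedding fun τ : ℝ => c + 1 - τ := measurableEmbedding_subLeft _
  have s1 : (fun τ : ℝ => τ + (c + 1)) ⁻¹' Set.Iic c = Set.Iic (-1) := by
    ext τ
    simp only [Set.mem_preimage, Set.mem_Iic]
    constructor <;> intro h <;> linarith
  have s3 : (fun τ : ℝ => c + 1 - τ) ⁻¹' Set.Iic c = Set.Ici 1 := by
    ext τ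
    simp only [Set.mem_preimage, Set.mem_Iic, Set.mem_Ici]
    constructor <;> intro h <;> linarith
  have i1 : IntegrableOn (fun τ => f (loopPath c τ)) (Set.Iic (-1)) := by
    have := (m1.integrableOn_comp_preimage b1 (f := fun u : ℝ => f (u + -Complex.I))).2
      (hray (by simp) (by simp))
    rw [s1] at this
    exact this.congr_fun (fun τ hτ => (p1 τ hτ).symm) measurableSet_Iic
  have i2 : IntegrableOn (fun τ => f (loopPath c τ)) (Set.Ioo (-1) 1) := by
    have : IntegrableOn (fun t : ℝ => f (c + t * Complex.I)) (Set.Ioo (-1) 1) :=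
      hcont.integrableOn_Icc.mono_set Set.Ioo_subset_Icc_self
    exact this.congr_fun (fun τ hτ => (p2 τ hτ).symm) measurableSet_Ioo
  have i3 : IntegrableOn (fun τ => f (loopPath c τ)) (Set.Ici 1) := by
    have := (m3.integrableOn_comp_preimage b3 (f := fun u : ℝ => f (u + Complex.I))).2
      (hray (by simp) (by simp))
    rw [s3] at this
    exact this.congr_fun (fun τ hτ => (p3 τ hτ).symm) measurableSet_Ici
  have hun : Set.Iic (-1 : ℝ) ∪ (Set.Ioo (-1) 1 ∪ Set.Ici 1) = Set.univ := by
    rw [Set.Ioo_union_Ici_eq_Ioi (by norm_num), Set.Iic_union_Ioi]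
  have hint : Integrable (fun τ => f (loopPath c τ)) := by
    rw [← integrableOn_univ, ← hun]
    exact i1.union (i2.union i3)
  refine ⟨hint, ?_⟩
  have hint' : Integrable (fun τ => loopSpeed τ * f (loopPath c τ)) :=
    hint.bdd_mul measurable_loopSpeed.aestronglyMeasurable
      (Filter.Eventually.of_forall fun τ => (norm_loopSpeed τ).le)
  have hsplit : ∫ τ, loopSpeed τ * f (loopPath c τ) =
      (∫ τ in Set.Iic (-1 : ℝ), loopSpeed τ * f (loopPath c τ)) +
        ((∫ τ in Set.Ioo (-1 : ℝ) 1, loopSpeed τ * f (loopPath c τ)) +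
          ∫ τ in Set.Ici (1 : ℝ), loopSpeed τ * f (loopPath c τ)) := by
    rw [← setIntegral_univ, ← hun, setIntegral_union _ (measurableSet_Ioo.union measurableSet_Ici)
      hint'.integrableOn hint'.integrableOn,
      setIntegral_union _ measurableSet_Ici hint'.integrableOn hint'.integrableOn]
    · exact Set.disjoint_left.2 fun x h1 h2 => absurd h1.2 (not_lt.2 h2)
    · rw [Set.Ioo_union_Ici_eq_Ioi (by norm_num)]
      exact Set.Iic_disjoint_Ioi le_rfl
  rw [loopIntegral_one, hsplit]
  congr 1
  have e1 : ∫ τ in Set.Iic (-1 : ℝ), loopSpeed τ * f (loopPath c τ) =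
      ∫ u in Set.Iic c, f ((u : ℂ) + -Complex.I) := by
    rw [← m1.setIntegral_preimage_emb b1 (fun u : ℝ => f ((u : ℂ) + -Complex.I)), s1]
    refine setIntegral_congr_fun measurableSet_Iic fun τ hτ => ?_
    have hτ' : τ ≤ -1 := hτ
    simp only [loopSpeed, if_pos hτ', one_mul, p1 τ hτ]
  have e2 : ∫ τ in Set.Ioo (-1 : ℝ) 1, loopSpeed τ * f (loopPath c τ) =
      (∫ t in (-1 : ℝ)..1, f ((c : ℂ) + (t : ℂ) * Complex.I)) * Complex.I := by
    rw [intervalIntegral.integral_of_le (by norm_num), integral_Ioc_eq_integral_Ioo,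
      ← integral_mul_const]
    refine setIntegral_congr_fun measurableSet_Ioo fun τ hτ => ?_
    simp only [loopSpeed, if_neg (not_le.2 hτ.1), if_pos hτ.2, p2 τ hτ]
    ring
  have e3 : ∫ τ in Set.Ici (1 : ℝ), loopSpeed τ * f (loopPath c τ) =
      -∫ u in Set.Iic c, f ((u : ℂ) + Complex.I) := by
    rw [← m3.setIntegral_preimage_emb b3 (fun u : ℝ => f ((u : ℂ) + Complex.I)), s3,
      ← integral_neg]
    refine setIntegral_congr_fun measurableSet_Ici fun τ hτ => ?_
    have hτ' : 1 ≤ τ := hτ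
    simp only [loopSpeed, if_neg (show ¬ τ ≤ -1 by linarith), if_neg (not_lt.2 hτ'), p3 τ hτ]
    ring
  rw [e1, e2, e3]
  ring

/-! ### Inverse Mellin transforms over the loop -/

theorem norm_sub_ge_of_im {s p : ℂ} (hs : |s.im| = 1) : 1 - |p.im| ≤ ‖s - p‖ := by
  refine le_trans ?_ (Complex.abs_im_le_norm _)
  rw [Complex.sub_im]
  have := abs_sub_abs_le_abs_sub s.im p.im
  linarith

theorem RayDecay.div_sub {f : ℂ → ℂ} (hf : RayDecay f) {p : ℂ} (hp : |p.im| < 1) :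
    RayDecay fun s => f s / (s - p) := by
  obtain ⟨hcont, C, δ, hδ, hb⟩ := hf
  have hne : ∀ s : ℂ, |s.im| = 1 → 0 < ‖s - p‖ := fun s hs =>
    lt_of_lt_of_le (by linarith) (norm_sub_ge_of_im (p := p) hs)
  refine ⟨fun s h1 h2 => (hcont s h1 h2).div (by fun_prop) (norm_pos_iff.1 (hne s h2)),
    C / (1 - |p.im|), δ, hδ, fun s h1 h2 => ?_⟩
  rw [norm_div, div_mul_eq_mul_div]
  have h3 := hb s h1 h2
  exact div_le_div₀ ((norm_nonneg _).trans h3) h3 (by linarith) (norm_sub_ge_of_im h2)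

theorem loopPath_sub_ge {c : ℝ} (p : ℂ) (τ : ℝ) :
    min (c - p.re) (1 - |p.im|) ≤ ‖loopPath c τ - p‖ := by
  rcases (loopPath_cases c τ).2 with h | h
  · refine (min_le_left _ _).trans ((le_abs_self _).trans ?_)
    have := Complex.abs_re_le_norm (loopPath c τ - p)
    rwa [Complex.sub_re, h] at this
  · exact (min_le_right _ _).trans (norm_sub_ge_of_im h)

/-- Inside the loop the distance to the path is bounded below near p, so the derivative of the
Cauchy kernel is dominated by a multiple of |g|. -/
theorem differentiableAt_loop_cauchy {g : ℝ → ℂ} (hg : Integrable g) {c : ℝ} {p : ℂ}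
    (h1 : p.re < c) (h2 : |p.im| < 1) :
    DifferentiableAt ℂ (fun p => ∫ τ, g τ / (loopPath c τ - p)) p := by
  set δ := min (c - p.re) (1 - |p.im|) / 2 with hδ
  have hδ0 : 0 < δ := by
    have : 0 < min (c - p.re) (1 - |p.im|) := lt_min (by linarith) (by linarith)
    positivity
  have hge : ∀ q ∈ Metric.ball p δ, ∀ τ, δ ≤ ‖loopPath c τ - q‖ := by
    intro q hq τ
    have h3 := loopPath_sub_ge (c := c) p τ
    have h4 : ‖q - p‖ < δ := by simpa [dist_eq_norm] using hq
    have h5 : ‖loopPath c τ - p‖ ≤ ‖loopPath c τ - q‖ + ‖q - p‖ :=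
      norm_sub_le_norm_sub_add_norm_sub _ _ _
    linarith
  have hne : ∀ q ∈ Metric.ball p δ, ∀ τ, loopPath c τ - q ≠ 0 := fun q hq τ =>
    norm_pos_iff.1 (hδ0.trans_le (hge q hq τ))
  have hcontq : ∀ q ∈ Metric.ball p δ, Continuous fun τ => (loopPath c τ - q)⁻¹ := fun q hq =>
    Continuous.inv₀ ((continuous_loopPath c).sub continuous_const) (hne q hq)
  have hp0 : p ∈ Metric.ball p δ := Metric.mem_ball_self hδ0
  refine (hasDerivAt_integral_of_dominated_loc_of_deriv_le (Metric.ball_mem_nhds p hδ0)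
    (F' := fun q τ => g τ / (loopPath c τ - q) ^ 2) (bound := fun τ => ‖g τ‖ * (1 / δ ^ 2))
    ?_ ?_ ?_ ?_ (hg.norm.mul_const _) ?_).2.differentiableAt
  · filter_upwards [Metric.ball_mem_nhds p hδ0] with q hq
    simp only [div_eq_mul_inv]
    exact hg.aestronglyMeasurable.mul (hcontq q hq).aestronglyMeasurable
  · simp only [div_eq_mul_inv]
    refine hg.mul_bdd (hcontq p hp0).aestronglyMeasurable (c := δ⁻¹)
      (Filter.Eventually.of_forall fun τ => ?_)
    rw [norm_inv]
    exact inv_anti₀ hδ0 (hge p hp0 τ)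
  · simp only [div_eq_mul_inv, ← inv_pow]
    exact hg.aestronglyMeasurable.mul ((hcontq p hp0).pow 2).aestronglyMeasurable
  · refine Filter.Eventually.of_forall fun τ q hq => ?_
    rw [norm_div, norm_pow, div_eq_mul_one_div]
    have := hge q hq τ
    gcongr
  · refine Filter.Eventually.of_forall fun τ q hq => ?_
    have h3 : HasDerivAt (fun q => loopPath c τ - q) (-1) q := by
      simpa using (hasDerivAt_id q).const_sub (loopPath c τ)
    have := (h3.inv (hne q hq τ)).const_mul (g τ)
    simp only [div_eq_mul_inv]
    refine this.congr_deriv ?_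
    rw [neg_neg, one_div]

/-- `F` is the Mellin transform of the nonnegative function `h` on `(0, 1)`, and `h` is recovered
from `F` by the loop integral. -/
structure MellinPair (F : ℂ → ℂ) (h : ℝ → ℝ) : Prop where
  differentiableAt : ∀ s ∈ Complex.slitPlane, DifferentiableAt ℂ F s
  subexp : SubexpOnRays F
  continuousOn : ContinuousOn h (Set.Ioo 0 1)
  nonneg : ∀ x ∈ Set.Ioo (0 : ℝ) 1, 0 ≤ h x
  integrableOn : ∀ q : ℝ, 0 < q → IntegrableOn (fun t : ℝ => t ^ (q - 1) * h t) (Set.Ioo 0 1)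
  mellin : ∀ q : ℝ, 0 < q → ((∫ t in Set.Ioo (0 : ℝ) 1, t ^ (q - 1) * h t : ℝ) : ℂ) = F q
  loop : ∀ c x : ℝ, 0 < c → c < 1 → 0 < x → x < 1 →
    loopIntegral c 1 (fun s => F s * (x : ℂ) ^ (-s)) = h x

theorem mem_slitPlane_of_abs_im {s : ℂ} (hs : |s.im| = 1) : s ∈ Complex.slitPlane :=
  Or.inr fun h => by simp [h] at hs

namespace MellinPair

variable {F : ℂ → ℂ} {h : ℝ → ℝ}

theorem integrableOn_self (P : MellinPair F h) : IntegrableOn h (Set.Ioo 0 1) := by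
  simpa using P.integrableOn 1 one_pos

theorem rayDecay (P : MellinPair F h) {x : ℝ} (hx0 : 0 < x) (hx1 : x < 1) :
    RayDecay fun s => F s * (x : ℂ) ^ (-s) :=
  P.subexp.rayDecay_mul_cpow
    (fun s _ h2 => (P.differentiableAt s (mem_slitPlane_of_abs_im h2)).continuousAt)
    (by exact_mod_cast hx0.ne') (by rwa [Complex.norm_real, Real.norm_of_nonneg hx0.le])

theorem differentiableAt_mul_cpow (P : MellinPair F h) {x : ℝ} (hx0 : 0 < x) {s : ℂ}
    (hs : s ∈ Complex.slitPlane) : DifferentiableAt ℂ (fun s => F s * (x : ℂ) ^ (-s)) s :=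
  (P.differentiableAt s hs).mul
    (differentiableAt_id.neg.const_cpow (Or.inl (by exact_mod_cast hx0.ne')))

theorem continuous_comp_loopPath (P : MellinPair F h) {c : ℝ} (hc0 : 0 < c) :
    Continuous fun τ => F (loopPath c τ) :=
  continuous_iff_continuousAt.2 fun τ =>
    ((P.differentiableAt _ (loopPath_mem_slitPlane hc0 τ)).continuousAt).comp
      (continuous_loopPath c).continuousAt

theorem loop_eq_integral (P : MellinPair F h) {c x : ℝ} (hc0 : 0 < c) (hc1 : c < 1)
    (hx0 : 0 < x) (hx1 : x < 1) :
    Integrable (fun τ => F (loopPath c τ) * (x : ℂ) ^ (-loopPath c τ)) ∧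
      (h x : ℂ) = (1 / (2 * (Real.pi : ℂ) * Complex.I)) *
        ∫ τ, loopSpeed τ * (F (loopPath c τ) * (x : ℂ) ^ (-loopPath c τ)) := by
  have key := loopIntegral_eq_integral (P.rayDecay hx0 hx1) hc1 fun t _ =>
    ((P.differentiableAt_mul_cpow hx0 (s := c + t * Complex.I)
      (Or.inl (by simpa using hc0))).continuousAt.comp
        (f := fun t : ℝ => (c : ℂ) + t * Complex.I) (by fun_prop)).continuousWithinAt
  rwa [P.loop c x hc0 hc1 hx0 hx1] at key

theorem loop_div_eq_integral (P : MellinPair F h) {c x : ℝ} (hc0 : 0 < c) (hc1 : c < 1)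
    (hx0 : 0 < x) (hx1 : x < 1) {p : ℂ} (hp1 : p.re ≠ c) (hp2 : |p.im| < 1) :
    loopIntegral c 1 (fun s => F s * (x : ℂ) ^ (-s) / (s - p)) =
      (1 / (2 * (Real.pi : ℂ) * Complex.I)) *
        ∫ τ, loopSpeed τ * (F (loopPath c τ) * (x : ℂ) ^ (-loopPath c τ) /
          (loopPath c τ - p)) := by
  refine (loopIntegral_eq_integral ((P.rayDecay hx0 hx1).div_sub hp2) hc1 fun t _ => ?_).2
  have h1 := (P.differentiableAt_mul_cpow hx0 (s := c + t * Complex.I)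
      (Or.inl (by simpa using hc0))).continuousAt
  have h2 : (c : ℂ) + t * Complex.I - p ≠ 0 := fun h => hp1 (by
    have := congrArg Complex.re h
    simp at this
    linarith)
  have h3 : ContinuousAt (fun s => F s * (x : ℂ) ^ (-s) / (s - p)) (c + t * Complex.I) :=
    h1.div (by fun_prop) h2
  exact (h3.comp (f := fun t : ℝ => (c : ℂ) + t * Complex.I) (by fun_prop)).continuousWithinAt

theorem integral_cpow_Ioo {x : ℝ} (hx0 : 0 < x) {r : ℂ} (hr : -1 < r.re) :
    ∫ t in Set.Ioo 0 x, (t : ℂ) ^ r = (x : ℂ) ^ (r + 1) / (r + 1) := by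
  have hne : r + 1 ≠ 0 := fun h => by
    have := congrArg Complex.re h
    simp at this
    linarith
  rw [← integral_Ioc_eq_integral_Ioo, ← intervalIntegral.integral_of_le hx0.le,
    integral_cpow (Or.inl hr), Complex.ofReal_zero, Complex.zero_cpow hne, sub_zero]

/-- Insert the loop formula for h(t) and exchange the integrals. Since p lies to the right of the
loop, ∫₀ˣ t^{p-1-s} dt = x^{p-s}/(p-s) converges for every s on it. -/
theorem integral_Ioo_zero_eq_loop (P : MellinPair F h) {c p x : ℝ} (hc0 : 0 < c) (hc1 : c < 1)
    (hcp : c < p) (hx0 : 0 < x) (hx1 : x < 1) :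
    ∫ t in Set.Ioo 0 x, (t : ℂ) ^ ((p : ℂ) - 1) * (h t : ℂ) =
      -(x : ℂ) ^ (p : ℂ) * loopIntegral c 1 (fun s => F s * (x : ℂ) ^ (-s) / (s - p)) := by
  let k : ℂ := 1 / (2 * (Real.pi : ℂ) * Complex.I)
  let K : ℝ → ℝ → ℂ := fun t τ =>
    k * (loopSpeed τ * F (loopPath c τ)) * (t : ℂ) ^ ((p : ℂ) - 1 - loopPath c τ)
  have hre : ∀ τ, -1 < ((p : ℂ) - 1 - loopPath c τ).re := fun τ => by
    have := loopPath_re_le c τ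
    simp
    linarith
  have hL : ∀ t ∈ Set.Ioo 0 x, (t : ℂ) ^ ((p : ℂ) - 1) * (h t : ℂ) = ∫ τ, K t τ := by
    intro t ht
    have ht0 : (t : ℂ) ≠ 0 := by exact_mod_cast ht.1.ne'
    rw [(P.loop_eq_integral hc0 hc1 ht.1 (ht.2.trans hx1)).2, mul_left_comm,
      ← integral_const_mul, ← integral_const_mul]
    congr 1 with τ
    simp only [K, k]
    rw [sub_eq_add_neg _ (loopPath c τ), Complex.cpow_add _ _ ht0]
    ring
  have hmeas : Measurable (Function.uncurry K) := by
    refine Measurable.mul (measurable_const.mul ?_) ?_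
    · exact (measurable_loopSpeed.comp measurable_snd).mul
        ((P.continuous_comp_loopPath hc0).measurable.comp measurable_snd)
    · exact (Complex.measurable_ofReal.comp measurable_fst).pow
        (measurable_const.sub ((continuous_loopPath c).measurable.comp measurable_snd))
  have hnorm : ∀ τ, ∀ t ∈ Set.Ioo 0 x, ‖K t τ‖ =
      ‖k‖ * ‖F (loopPath c τ)‖ * t ^ ((p : ℂ) - 1 - loopPath c τ).re := by
    intro τ t ht
    simp only [K, norm_mul, norm_loopSpeed, one_mul]
    rw [Complex.norm_cpow_eq_rpow_re_of_pos ht.1]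
  have hnint : ∀ τ, ∫ t in Set.Ioo 0 x, ‖K t τ‖ = ‖k‖ * x ^ p / (p - (loopPath c τ).re) *
      ‖F (loopPath c τ) * (x : ℂ) ^ (-loopPath c τ)‖ := by
    intro τ
    rw [setIntegral_congr_fun measurableSet_Ioo (hnorm τ), integral_const_mul,
      ← integral_Ioc_eq_integral_Ioo, ← intervalIntegral.integral_of_le hx0.le,
      integral_rpow (Or.inl (hre τ)), norm_mul, Complex.norm_cpow_eq_rpow_re_of_pos hx0]
    have e : ((p : ℂ) - 1 - loopPath c τ).re + 1 = p - (loopPath c τ).re := by simp; ring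
    have hpos : 0 < p - (loopPath c τ).re := by linarith [loopPath_re_le c τ]
    rw [e, Real.zero_rpow hpos.ne', sub_zero, sub_eq_add_neg p, Real.rpow_add hx0, Complex.neg_re]
    ring
  have hint : Integrable (Function.uncurry K)
      ((volume.restrict (Set.Ioo 0 x)).prod (volume : Measure ℝ)) := by
    rw [integrable_prod_iff' hmeas.aestronglyMeasurable]
    refine ⟨Filter.Eventually.of_forall fun τ => ?_, ?_⟩
    · have := intervalIntegral.intervalIntegrable_cpow' (a := 0) (b := x) (hre τ)
      rw [intervalIntegrable_iff_integrableOn_Ioo_of_le hx0.le] at this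
      exact Integrable.const_mul this (k * (loopSpeed τ * F (loopPath c τ)))
    · simp only [Function.uncurry, hnint]
      refine (P.loop_eq_integral hc0 hc1 hx0 hx1).1.norm.bdd_mul
        (c := ‖k‖ * x ^ p / (p - c)) ?_ (Filter.Eventually.of_forall fun τ => ?_)
      · refine Continuous.aestronglyMeasurable (Continuous.div continuous_const
          (continuous_const.sub (Complex.continuous_re.comp (continuous_loopPath c))) fun τ => ?_)
        have := loopPath_re_le c τ
        linarith
      · have := loopPath_re_le c τ
        have h1 : 0 < p - c := by linarith
        have h2 : p - c ≤ p - (loopPath c τ).re := by linarith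
        have h3 : 0 < p - (loopPath c τ).re := by linarith
        rw [Real.norm_of_nonneg (by positivity)]
        gcongr
  rw [setIntegral_congr_fun measurableSet_Ioo hL, integral_integral_swap hint,
    P.loop_div_eq_integral hc0 hc1 hx0 hx1 (by simpa using hcp.ne') (by simp), ← mul_assoc,
    ← integral_const_mul]
  congr 1 with τ
  simp only [K]
  rw [integral_const_mul, integral_cpow_Ioo hx0 (hre τ)]
  have hx0' : (x : ℂ) ≠ 0 := by exact_mod_cast hx0.ne'
  have e : (p : ℂ) - 1 - loopPath c τ + 1 = p + -loopPath c τ := by ring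
  have hne : loopPath c τ - p ≠ 0 := fun h => by
    have h1 := congrArg Complex.re h
    have := loopPath_re_le c τ
    simp at h1
    linarith
  have hne' : (p : ℂ) + -loopPath c τ ≠ 0 := fun h => hne (by linear_combination -h)
  rw [e, Complex.cpow_add _ _ hx0']
  simp only [k]
  field_simp
  ring

/-- Moving the loop from the abscissa p/2 to c picks up the residue x^{-p} F(p), which is x^{-p}
times the integral of t^{p-1} h over all of (0, 1). The loop at p/2 subtracts the part over (0, x).
-/
theorem loop_div_of_pos (P : MellinPair F h) {c p x : ℝ} (hp0 : 0 < p) (hpc : p < c) (hc1 : c < 1)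
    (hx0 : 0 < x) (hx1 : x < 1) :
    loopIntegral c 1 (fun s => F s * (x : ℂ) ^ (-s) / (s - p)) =
      (x : ℂ) ^ (-(p : ℂ)) * ∫ t in Set.Ioo x 1, (t : ℂ) ^ ((p : ℂ) - 1) * (h t : ℂ) := by
  have hx0' : (x : ℂ) ≠ 0 := by exact_mod_cast hx0.ne'
  have h1 := loopIntegral_sub_loopIntegral
    ((P.rayDecay hx0 hx1).div_sub (p := (p : ℂ)) (by simp)) hc1 (c' := p / 2) (by linarith)
  rw [rectIntegral_div_sub (by linarith) hpc fun s h1 _ _ =>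
    P.differentiableAt_mul_cpow hx0 (Or.inl (by linarith)), ← mul_assoc,
    one_div_mul_cancel Complex.two_pi_I_ne_zero, one_mul] at h1
  have h2 := P.integral_Ioo_zero_eq_loop (c := p / 2) (p := p) (by linarith) (by linarith)
    (by linarith) hx0 hx1
  have h3 : ∫ t in Set.Ioo (0 : ℝ) 1, (t : ℂ) ^ ((p : ℂ) - 1) * (h t : ℂ) = F p := by
    rw [← P.mellin p hp0, ← integral_complex_ofReal]
    refine setIntegral_congr_fun measurableSet_Ioo fun t ht => ?_
    push_cast
    rw [Complex.ofReal_cpow ht.1.le]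
    push_cast
    rfl
  have hint : IntegrableOn (fun t : ℝ => (t : ℂ) ^ ((p : ℂ) - 1) * (h t : ℂ)) (Set.Ioo 0 1) := by
    have hi : IntegrableOn (fun t : ℝ => ((t ^ (p - 1) * h t : ℝ) : ℂ)) (Set.Ioo 0 1) :=
      (P.integrableOn p hp0).ofReal
    refine hi.congr_fun (fun t ht => ?_) measurableSet_Ioo
    push_cast
    rw [Complex.ofReal_cpow ht.1.le]
    push_cast
    rfl
  have h4 : (∫ t in Set.Ioo (0 : ℝ) 1, (t : ℂ) ^ ((p : ℂ) - 1) * (h t : ℂ)) =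
      (∫ t in Set.Ioo 0 x, (t : ℂ) ^ ((p : ℂ) - 1) * (h t : ℂ)) +
        ∫ t in Set.Ioo x 1, (t : ℂ) ^ ((p : ℂ) - 1) * (h t : ℂ) := by
    rw [← integral_Ico_eq_integral_Ioo (x := x), ← setIntegral_union _ measurableSet_Ico
      (hint.mono_set (Set.Ioo_subset_Ioo_right hx1.le))
      (hint.mono_set fun t ht => ⟨hx0.trans_le ht.1, ht.2⟩), Set.Ioo_union_Ico_eq_Ioo hx0 hx1.le]
    exact Set.disjoint_left.2 fun t ht ht' => absurd ht.2 (not_lt.2 ht'.1)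
  rw [h3, h2] at h4
  have h5 : (x : ℂ) ^ (-(p : ℂ)) * (x : ℂ) ^ (p : ℂ) = 1 := by
    rw [← Complex.cpow_add _ _ hx0']; simp
  linear_combination h1 + (x : ℂ) ^ (-(p : ℂ)) * h4 - loopIntegral (p / 2) 1
    (fun s => F s * (x : ℂ) ^ (-s) / (s - p)) * h5

end MellinPair

/-! ### Stability of Mellin pairs under division by s + b. -/

namespace MellinPair

variable {F : ℂ → ℂ} {h : ℝ → ℝ}

/-- Cutting h off below x > 0 leaves a Mellin transform of a function supported in [x, 1], which is
entire. -/
theorem differentiable_integral_cpow (P : MellinPair F h) {x : ℝ} (hx0 : 0 < x) :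
    Differentiable ℂ fun p : ℂ =>
      ∫ t in Set.Ioo x 1, (t : ℂ) ^ (p - 1) * (h t : ℂ) := by
  let g : ℝ → ℂ := (Set.Ioo x 1).indicator fun t => (h t : ℂ)
  have hg : Integrable g := by
    refine (integrable_indicator_iff measurableSet_Ioo).2 ?_
    have hi : IntegrableOn (fun t : ℝ => (h t : ℂ)) (Set.Ioo 0 1) := P.integrableOn_self.ofReal
    exact hi.mono_set (Set.Ioo_subset_Ioo_left hx0.le)
  have e : (fun p : ℂ => ∫ t in Set.Ioo x 1, (t : ℂ) ^ (p - 1) * (h t : ℂ)) = _root_.mellin g := by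
    ext p
    have : ∀ t : ℝ, (t : ℂ) ^ (p - 1) • g t =
        (Set.Ioo x 1).indicator (fun t => (t : ℂ) ^ (p - 1) * (h t : ℂ)) t := by
      intro t
      simp only [g, Set.indicator]
      split_ifs <;> simp
    simp only [_root_.mellin, this]
    rw [setIntegral_indicator measurableSet_Ioo]
    congr 2
    ext t
    simp only [Set.mem_Ioo, Set.mem_inter_iff, Set.mem_Ioi]
    constructor
    · exact fun ht => ⟨hx0.trans ht.1, ht⟩
    · exact fun ht => ht.2
  rw [e]
  intro p
  refine mellin_differentiableAt_of_isBigO_rpow (a := p.re + 1) (b := p.re - 1)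
    (hg.locallyIntegrable.locallyIntegrableOn _) ?_ (by linarith) ?_ (by linarith)
  · refine Filter.EventuallyEq.trans_isBigO ?_ (Asymptotics.isBigO_zero _ _)
    filter_upwards [Filter.eventually_gt_atTop 1] with t ht
    exact Set.indicator_of_notMem (fun h => absurd h.2 (not_lt.2 ht.le)) _
  · refine Filter.EventuallyEq.trans_isBigO ?_ (Asymptotics.isBigO_zero _ _)
    filter_upwards [Ioo_mem_nhdsGT hx0] with t ht
    exact Set.indicator_of_notMem (fun h => absurd h.1 (not_lt.2 ht.2.le)) _

/-- Both sides are holomorphic in p on the strip Re p < c, |Im p| < 1 and agree for p in (0, c) by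
`loop_div_of_pos`. The identity theorem carries the formula to the points p = -b ≤ 0, which the
argument with F(p) cannot reach. -/
theorem loop_div (P : MellinPair F h) {c x : ℝ} (hc0 : 0 < c) (hc1 : c < 1)
    (hx0 : 0 < x) (hx1 : x < 1) {p : ℂ} (hp1 : p.re < c) (hp2 : |p.im| < 1) :
    loopIntegral c 1 (fun s => F s * (x : ℂ) ^ (-s) / (s - p)) =
      (x : ℂ) ^ (-p) * ∫ t in Set.Ioo x 1, (t : ℂ) ^ (p - 1) * (h t : ℂ) := by
  have hx0' : (x : ℂ) ≠ 0 := by exact_mod_cast hx0.ne'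
  let U : Set ℂ := Set.Iio c ×ℂ Set.Ioo (-1) 1
  have hU : IsOpen U := isOpen_Iio.reProdIm isOpen_Ioo
  have hUmem : ∀ q : ℂ, q ∈ U ↔ q.re < c ∧ |q.im| < 1 := fun q => by
    simp only [U, Complex.mem_reProdIm, Set.mem_Iio, Set.mem_Ioo, abs_lt]
  have hUc : IsPreconnected U := (((convex_Iio c).linear_preimage Complex.reLm).inter
    ((convex_Ioo (-1) 1).linear_preimage Complex.imLm)).isPreconnected
  have hA : AnalyticOnNhd ℂ
      (fun q : ℂ => loopIntegral c 1 (fun s => F s * (x : ℂ) ^ (-s) / (s - q))) U := by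
    refine DifferentiableOn.analyticOnNhd (fun q hq => ?_) hU
    have hint : Integrable fun τ =>
        loopSpeed τ * (F (loopPath c τ) * (x : ℂ) ^ (-loopPath c τ)) :=
      (P.loop_eq_integral hc0 hc1 hx0 hx1).1.bdd_mul measurable_loopSpeed.aestronglyMeasurable
        (Filter.Eventually.of_forall fun τ => (norm_loopSpeed τ).le)
    have hd := (differentiableAt_loop_cauchy hint ((hUmem q).1 hq).1 ((hUmem q).1 hq).2).const_mul
      (1 / (2 * (Real.pi : ℂ) * Complex.I))
    refine (hd.congr_of_eventuallyEq ?_).differentiableWithinAt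
    filter_upwards [hU.mem_nhds hq] with r hr
    rw [P.loop_div_eq_integral hc0 hc1 hx0 hx1 ((hUmem r).1 hr).1.ne ((hUmem r).1 hr).2]
    simp only [mul_div_assoc]
  have hB : AnalyticOnNhd ℂ (fun q : ℂ => (x : ℂ) ^ (-q) *
      ∫ t in Set.Ioo x 1, (t : ℂ) ^ (q - 1) * (h t : ℂ)) U := by
    refine DifferentiableOn.analyticOnNhd (fun q _ => ?_) hU
    exact ((differentiableAt_id.neg.const_cpow (Or.inl hx0')).mul
      (P.differentiable_integral_cpow hx0 q)).differentiableWithinAt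
  refine hA.eqOn_of_preconnected_of_frequently_eq hB hUc (z₀ := ((c / 2 : ℝ) : ℂ))
    ((hUmem _).2 ⟨by simp; linarith, by simp⟩) ?_ ((hUmem p).2 ⟨hp1, hp2⟩)
  -- Agreement at real points different from c/2 and tending to it suffices for the identity
  -- theorem.
  have htend : Filter.Tendsto (fun r : ℝ => (r : ℂ)) (nhdsWithin (c / 2) {c / 2}ᶜ)
      (nhdsWithin ((c / 2 : ℝ) : ℂ) {((c / 2 : ℝ) : ℂ)}ᶜ) := by
    refine Filter.Tendsto.inf Complex.continuous_ofReal.continuousAt ?_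
    rw [Filter.tendsto_principal_principal]
    intro r hr h
    exact hr (Complex.ofReal_injective h)
  refine htend.frequently (Filter.Eventually.frequently ?_)
  filter_upwards [nhdsWithin_le_nhds (Ioo_mem_nhds (show 0 < c / 2 by linarith)
    (show c / 2 < c by linarith))] with r hr
  exact P.loop_div_of_pos hr.1 hr.2 hc1 hx0 hx1

theorem integrableOn_rpow_mul (P : MellinPair F h) {x : ℝ} (hx0 : 0 < x) (r : ℝ) :
    IntegrableOn (fun t : ℝ => t ^ r * h t) (Set.Ioo x 1) := by
  refine (P.integrableOn_self.mono_set (Set.Ioo_subset_Ioo_left hx0.le)).continuousOn_mul_of_subset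
    (K := Set.Icc x 1) (fun t ht => ?_) isCompact_Icc measurableSet_Ioo Set.Ioo_subset_Icc_self
  exact (Real.continuousAt_rpow_const t r (Or.inl (hx0.trans_le ht.1).ne')).continuousWithinAt

/-- The kernel of the double integral behind the Mellin transform of `F(s) / (s + b)`. -/
theorem integrable_prod_indicator (P : MellinPair F h) {b q : ℝ} (hb : 0 ≤ b) (hq : 0 < q) :
    Integrable (Function.uncurry fun x t : ℝ =>
      (Set.Ioi x).indicator (fun t => x ^ (q - 1 + b) * (t ^ (-b - 1) * h t)) t)
      ((volume.restrict (Set.Ioo (0 : ℝ) 1)).prod (volume.restrict (Set.Ioo (0 : ℝ) 1))) ∧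
    ∀ t ∈ Set.Ioo (0 : ℝ) 1, ∫ x in Set.Ioo (0 : ℝ) 1,
      (Set.Ioi x).indicator (fun t => x ^ (q - 1 + b) * (t ^ (-b - 1) * h t)) t =
        (t ^ (q - 1) * h t) / (q + b) := by
  have hr : -1 < q - 1 + b := by linarith
  have hswap : ∀ t x : ℝ, (Set.Ioi x).indicator (fun t => x ^ (q - 1 + b) *
      (t ^ (-b - 1) * h t)) t =
      (Set.Iio t).indicator (fun x => x ^ (q - 1 + b)) x * (t ^ (-b - 1) * h t) := by
    intro t x
    by_cases hxt : x < t
    · rw [Set.indicator_of_mem (show t ∈ Set.Ioi x from hxt),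
        Set.indicator_of_mem (show x ∈ Set.Iio t from hxt)]
    · rw [Set.indicator_of_notMem (show t ∉ Set.Ioi x from hxt),
        Set.indicator_of_notMem (show x ∉ Set.Iio t from hxt), zero_mul]
  have hsub : ∀ t ∈ Set.Ioo (0 : ℝ) 1, Set.Ioo (0 : ℝ) 1 ∩ Set.Iio t = Set.Ioo 0 t := by
    intro t ht
    ext x
    simp only [Set.mem_inter_iff, Set.mem_Ioo, Set.mem_Iio]
    exact ⟨fun h => ⟨h.1.1, h.2⟩, fun h => ⟨⟨h.1, h.2.trans ht.2⟩, h.2⟩⟩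
  have hval : ∀ t ∈ Set.Ioo (0 : ℝ) 1, ∫ x in Set.Ioo (0 : ℝ) 1,
      (Set.Ioi x).indicator (fun t => x ^ (q - 1 + b) * (t ^ (-b - 1) * h t)) t =
        (t ^ (q - 1) * h t) / (q + b) := by
    intro t ht
    simp only [hswap]
    rw [integral_mul_const, setIntegral_indicator measurableSet_Iio, hsub t ht,
      ← integral_Ioc_eq_integral_Ioo, ← intervalIntegral.integral_of_le ht.1.le,
      integral_rpow (Or.inl hr), Real.zero_rpow (by linarith), sub_zero,
      show q - 1 + b + 1 = q + b by ring, show -b - 1 = (q - 1) - (q + b) by ring,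
      Real.rpow_sub ht.1]
    have := (Real.rpow_pos_of_pos ht.1 (q + b)).ne'
    field_simp
  refine ⟨?_, hval⟩
  have hmeas : AEStronglyMeasurable (Function.uncurry fun x t : ℝ =>
      (Set.Ioi x).indicator (fun t => x ^ (q - 1 + b) * (t ^ (-b - 1) * h t)) t)
      ((volume.restrict (Set.Ioo (0 : ℝ) 1)).prod (volume.restrict (Set.Ioo (0 : ℝ) 1))) := by
    have h1 : AEStronglyMeasurable (fun z : ℝ × ℝ => z.1 ^ (q - 1 + b) * (z.2 ^ (-b - 1) * h z.2))
        ((volume.restrict (Set.Ioo (0 : ℝ) 1)).prod (volume.restrict (Set.Ioo (0 : ℝ) 1))) := by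
      refine (Measurable.aestronglyMeasurable (by fun_prop)).mul
        ((Measurable.aestronglyMeasurable (by fun_prop)).mul ?_)
      exact P.integrableOn_self.aestronglyMeasurable.comp_snd
    have h2 := h1.indicator (measurableSet_lt measurable_fst measurable_snd)
    refine h2.congr (Filter.Eventually.of_forall fun z => ?_)
    by_cases hz : z.1 < z.2
    · simp only [Function.uncurry]
      rw [Set.indicator_of_mem (show z ∈ {z : ℝ × ℝ | z.1 < z.2} from hz),
        Set.indicator_of_mem (show z.2 ∈ Set.Ioi z.1 from hz)]
    · simp only [Function.uncurry]
      rw [Set.indicator_of_notMem (show z ∉ {z : ℝ × ℝ | z.1 < z.2} from hz),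
        Set.indicator_of_notMem (show z.2 ∉ Set.Ioi z.1 from hz)]
  rw [integrable_prod_iff' hmeas]
  constructor
  · refine (ae_restrict_iff' measurableSet_Ioo).2 (Filter.Eventually.of_forall fun t ht => ?_)
    simp only [Function.uncurry, hswap]
    refine Integrable.mul_const ?_ _
    rw [integrable_indicator_iff measurableSet_Iio, IntegrableOn,
      Measure.restrict_restrict measurableSet_Iio, Set.inter_comm, hsub t ht]
    have := intervalIntegral.intervalIntegrable_rpow' (a := 0) (b := t) hr
    rwa [intervalIntegrable_iff_integrableOn_Ioo_of_le ht.1.le] at this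
  · refine ((P.integrableOn q hq).div_const (q + b)).congr ?_
    refine (ae_restrict_iff' measurableSet_Ioo).2 (Filter.Eventually.of_forall fun t ht => ?_)
    simp only [Function.uncurry]
    rw [← hval t ht]
    refine setIntegral_congr_fun measurableSet_Ioo fun x hx => ?_
    refine (Real.norm_of_nonneg ?_).symm
    rw [hswap]
    refine mul_nonneg ?_ (mul_nonneg (Real.rpow_nonneg ht.1.le _) (P.nonneg t ht))
    rw [Set.indicator_apply]
    split_ifs
    exacts [Real.rpow_nonneg hx.1.le _, le_rfl]

/-- On (0, 1) the Mellin transform of x^b is 1/(s + b), so the new density is the multiplicative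
convolution of h with x^b, which preserves nonnegativity. The loop formula is `loop_div` at p = -b;
Fubini gives the transform. -/
theorem div_add (P : MellinPair F h) {b : ℝ} (hb : 0 ≤ b) :
    MellinPair (fun s => F s / (s + b))
      (fun x => x ^ b * ∫ t in Set.Ioo x 1, t ^ (-b - 1) * h t) := by
  have hslice : ∀ q : ℝ, ∀ x ∈ Set.Ioo (0 : ℝ) 1, ∫ t in Set.Ioo (0 : ℝ) 1,
      (Set.Ioi x).indicator (fun t => x ^ (q - 1 + b) * (t ^ (-b - 1) * h t)) t =
        x ^ (q - 1) * (x ^ b * ∫ t in Set.Ioo x 1, t ^ (-b - 1) * h t) := by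
    intro q x hx
    have hsub : Set.Ioo (0 : ℝ) 1 ∩ Set.Ioi x = Set.Ioo x 1 := by
      ext t
      simp only [Set.mem_inter_iff, Set.mem_Ioo, Set.mem_Ioi]
      exact ⟨fun h => ⟨h.2, h.1.2⟩, fun h => ⟨⟨hx.1.trans h.1, h.2⟩, h.1⟩⟩
    rw [setIntegral_indicator measurableSet_Ioi, hsub, integral_const_mul, Real.rpow_add hx.1,
      mul_assoc]
  have hne : ∀ s ∈ Complex.slitPlane, s + (b : ℂ) ≠ 0 := by
    intro s hs h0
    have h1 : s = ((-b : ℝ) : ℂ) := by push_cast; linear_combination h0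
    rw [h1, Complex.ofReal_mem_slitPlane] at hs
    linarith
  constructor
  · exact fun s hs => (P.differentiableAt s hs).div (by fun_prop) (hne s hs)
  · intro ε hε
    obtain ⟨C, hC0, hC⟩ := P.subexp ε hε
    refine ⟨C, hC0, fun s h1 h2 => ?_⟩
    have h3 : 1 ≤ ‖s + (b : ℂ)‖ := by
      have := Complex.abs_im_le_norm (s + (b : ℂ))
      simpa [h2] using this
    rw [norm_div]
    exact (div_le_self (norm_nonneg _) h3).trans (hC s h1 h2)
  · intro x hx
    have hx2 : 0 < x / 2 := by linarith [hx.1]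
    have hI : IntegrableOn (fun t : ℝ => t ^ (-b - 1) * h t) (Set.uIcc (x / 2) 1) := by
      rw [Set.uIcc_of_le (by linarith [hx.2]), integrableOn_Icc_iff_integrableOn_Ioo]
      exact P.integrableOn_rpow_mul hx2 _
    have h1 := intervalIntegral.continuousOn_primitive_interval_left hI
    rw [Set.uIcc_of_le (by linarith [hx.2])] at h1
    have h2 : ContinuousAt (fun y => ∫ t in y..1, t ^ (-b - 1) * h t) x :=
      h1.continuousAt (Icc_mem_nhds (by linarith [hx.1]) hx.2)
    have h3 : ContinuousAt (fun y => ∫ t in Set.Ioo y 1, t ^ (-b - 1) * h t) x := by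
      refine h2.congr ?_
      filter_upwards [Iio_mem_nhds hx.2] with y hy
      rw [intervalIntegral.integral_of_le (le_of_lt hy), integral_Ioc_eq_integral_Ioo]
    exact ((Real.continuousAt_rpow_const x b (Or.inl hx.1.ne')).mul h3).continuousWithinAt
  · intro x hx
    refine mul_nonneg (Real.rpow_nonneg hx.1.le _) (setIntegral_nonneg measurableSet_Ioo
      fun t ht => ?_)
    have ht0 : 0 < t := hx.1.trans ht.1
    exact mul_nonneg (Real.rpow_nonneg ht0.le _) (P.nonneg t ⟨ht0, ht.2⟩)
  · intro q hq
    have := (P.integrable_prod_indicator hb hq).1.integral_prod_left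
    exact IntegrableOn.congr_fun this (hslice q) measurableSet_Ioo
  · intro q hq
    obtain ⟨h1, h2⟩ := P.integrable_prod_indicator hb hq
    have h3 := integral_integral_swap h1
    rw [setIntegral_congr_fun measurableSet_Ioo (hslice q),
      setIntegral_congr_fun measurableSet_Ioo h2, integral_div] at h3
    rw [h3, ← P.mellin q hq]
    push_cast
    rfl
  · intro c x hc0 hc1 hx0 hx1
    have h1 := P.loop_div hc0 hc1 hx0 hx1 (p := ((-b : ℝ) : ℂ))
      (by rw [Complex.ofReal_re]; linarith) (by simp)
    have e : (fun s : ℂ => F s / (s + b) * (x : ℂ) ^ (-s)) =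
        fun s => F s * (x : ℂ) ^ (-s) / (s - ((-b : ℝ) : ℂ)) := by
      ext s
      push_cast
      rw [sub_neg_eq_add]
      ring
    rw [e, h1, Complex.ofReal_mul, ← integral_complex_ofReal, Complex.ofReal_cpow hx0.le]
    congr 1
    · push_cast
      rw [neg_neg]
    · refine setIntegral_congr_fun measurableSet_Ioo fun t ht => ?_
      push_cast
      rw [Complex.ofReal_cpow (hx0.trans ht.1).le]
      push_cast
      rfl

end MellinPair

/-! ### The base pair `Γ(s) / Γ(s + a)` -/

theorem ring_choose_add_sub_one (β : ℝ) (n : ℕ) :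
    Ring.choose (β + n - 1) n = (∏ j ∈ Finset.range n, (β + j)) / (n.factorial : ℝ) := by
  have h := Ring.factorial_nsmul_multichoose_eq_ascPochhammer β n
  rw [Polynomial.ascPochhammer_smeval_eq_eval, nsmul_eq_mul] at h
  have h1 : ∀ n : ℕ, (ascPochhammer ℝ n).eval β = ∏ j ∈ Finset.range n, (β + j) := by
    intro n
    induction n with
    | zero => simp
    | succ n ih => rw [ascPochhammer_succ_eval, ih, Finset.prod_range_succ]
  rw [h1] at h
  rw [eq_div_iff (by positivity), ← h, Ring.choose, mul_comm]
  congr 2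
  ring

theorem hasSum_one_div_one_sub_rpow (β : ℝ) {x : ℝ} (hx : |x| < 1) :
    HasSum (fun n : ℕ => (∏ j ∈ Finset.range n, (β + j)) / (n.factorial : ℝ) * x ^ n)
      (1 / (1 - x) ^ β) := by
  have h := (Real.one_div_one_sub_rpow_hasFPowerSeriesOnBall_zero β).hasSum (y := x) (by
    rw [Metric.mem_eball, edist_zero_right, Real.enorm_eq_ofReal_abs]
    exact ENNReal.ofReal_lt_one.2 hx)
  simp only [zero_add, FormalMultilinearSeries.ofScalars_apply_eq, ring_choose_add_sub_one,
    smul_eq_mul] at h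
  exact h

theorem inv_Gamma_sub_nat (a : ℂ) (k : ℕ) : (-1) ^ k * (Complex.Gamma (a - k))⁻¹ =
    (∏ j ∈ Finset.range k, (1 - a + j)) * (Complex.Gamma a)⁻¹ := by
  induction k with
  | zero => simp
  | succ k ih =>
    have h := Complex.one_div_Gamma_eq_self_mul_one_div_Gamma_add_one (a - (k + 1 : ℕ))
    have e : a - ((k + 1 : ℕ) : ℂ) + 1 = a - k := by push_cast; ring
    rw [e] at h
    rw [h, Finset.prod_range_succ, mul_right_comm, ← ih, pow_succ]
    push_cast
    ring

/-- This factor 1 + a/w is what the growth argument `norm_one_add_div_le` consumes. -/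
theorem Gamma_div_step {a : ℝ} {w : ℂ} (hw : w ≠ 0) :
    Complex.Gamma w * (Complex.Gamma (w + a))⁻¹ =
      (1 + a / w) * (Complex.Gamma (w + 1) * (Complex.Gamma (w + 1 + a))⁻¹) := by
  rw [Complex.Gamma_add_one w hw, Complex.one_div_Gamma_eq_self_mul_one_div_Gamma_add_one (w + a),
    add_right_comm]
  field_simp

theorem natCast_le_norm_sub {s : ℂ} (hs : s.re ≤ 1) (N : ℕ) : (N : ℝ) ≤ ‖s - N - 1‖ := by
  refine le_trans ?_ (Complex.abs_re_le_norm _)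
  refine le_trans ?_ (neg_le_abs _)
  simp
  linarith

theorem ne_neg_nat_of_mem_slitPlane {s : ℂ} (hs : s ∈ Complex.slitPlane) (m : ℕ) :
    s ≠ -(m : ℂ) := by
  rintro rfl
  have h1 : -(m : ℂ) = ((-m : ℝ) : ℂ) := by push_cast; rfl
  rw [h1, Complex.ofReal_mem_slitPlane] at hs
  have : (0 : ℝ) ≤ m := by positivity
  linarith

/-- The transform is the Beta integral. The loop integral is the sum of the residues (-1)^k x^k /
(k! Γ(a-k)), which is the binomial series of (1-x)^{a-1} divided by Γ(a). -/
theorem mellinPair_Gamma_div {a : ℝ} (ha : 0 < a) :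
    MellinPair (fun s => Complex.Gamma s * (Complex.Gamma (s + a))⁻¹)
      (fun x => (1 - x) ^ (a - 1) / Real.Gamma a) := by
  have hΓ : 0 < Real.Gamma a := Real.Gamma_pos_of_pos ha
  have hinv : Differentiable ℂ fun s : ℂ => (Complex.Gamma (s + a))⁻¹ :=
    Complex.differentiable_one_div_Gamma.comp (differentiable_id.add_const _)
  have hdiff : ∀ s ∈ Complex.slitPlane, DifferentiableAt ℂ
      (fun s => Complex.Gamma s * (Complex.Gamma (s + a))⁻¹) s := fun s hs =>
    (Complex.differentiableAt_Gamma s (ne_neg_nat_of_mem_slitPlane hs)).mul (hinv s)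
  have hstep : ∀ N : ℕ, 1 ≤ N → ∀ s : ℂ, s.re ≤ 1 → |s.im| ≤ 1 →
      ‖Complex.Gamma (s - N - 1) * (Complex.Gamma (s - N - 1 + a))⁻¹‖ ≤
        Real.exp (a / N) * ‖Complex.Gamma (s - N) * (Complex.Gamma (s - N + a))⁻¹‖ := by
    intro N hN s h1 _
    have hw := natCast_le_norm_sub h1 N
    have hw0 : s - N - 1 ≠ 0 := norm_pos_iff.1 (lt_of_lt_of_le (by exact_mod_cast hN) hw)
    rw [Gamma_div_step hw0, norm_mul, sub_add_cancel]
    exact mul_le_mul_of_nonneg_right (norm_one_add_div_le ha.le hN hw) (norm_nonneg _)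
  have hbeta : ∀ q : ℝ, 0 < q → IntegrableOn
      (fun t : ℝ => (t : ℂ) ^ ((q : ℂ) - 1) * (1 - (t : ℂ)) ^ ((a : ℂ) - 1)) (Set.Ioo 0 1) := by
    intro q hq
    have := Complex.betaIntegral_convergent (u := q) (v := a) (by simpa using hq)
      (by simpa using ha)
    rwa [intervalIntegrable_iff_integrableOn_Ioo_of_le zero_le_one] at this
  have hcast : ∀ q : ℝ, ∀ t ∈ Set.Ioo (0 : ℝ) 1,
      (t : ℂ) ^ ((q : ℂ) - 1) * (1 - (t : ℂ)) ^ ((a : ℂ) - 1) =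
        ((t ^ (q - 1) * (1 - t) ^ (a - 1) : ℝ) : ℂ) := by
    intro q t ht
    rw [Complex.ofReal_mul, Complex.ofReal_cpow ht.1.le,
      Complex.ofReal_cpow (sub_nonneg.2 ht.2.le)]
    push_cast
    rfl
  refine ⟨hdiff, ?_, ?_, ?_, ?_, ?_, ?_⟩
  · exact subexpOnRays_of_step (fun s _ h2 =>
      (hdiff s (mem_slitPlane_of_abs_im h2)).continuousAt) hstep
  · intro x hx
    have h1 : ContinuousAt (fun x : ℝ => (1 - x) ^ (a - 1)) x :=
      ContinuousAt.rpow_const (by fun_prop) (Or.inl (sub_pos.2 hx.2).ne')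
    exact (h1.div_const _).continuousWithinAt
  · intro x hx
    exact div_nonneg (Real.rpow_nonneg (sub_nonneg.2 hx.2.le) _) hΓ.le
  · intro q hq
    have h1 : IntegrableOn (fun t : ℝ => ((t ^ (q - 1) * (1 - t) ^ (a - 1) : ℝ) : ℂ))
        (Set.Ioo 0 1) := (hbeta q hq).congr_fun (hcast q) measurableSet_Ioo
    have h2 : IntegrableOn (fun t : ℝ => t ^ (q - 1) * (1 - t) ^ (a - 1)) (Set.Ioo 0 1) := by
      have h2 := h1.re
      simp only [RCLike.re_to_complex, Complex.ofReal_re] at h2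
      exact h2
    simpa only [IntegrableOn, mul_div_assoc] using h2.div_const (Real.Gamma a)
  · intro q hq
    have h1 := Complex.betaIntegral_eq_Gamma_mul_div (q : ℂ) (a : ℂ) (by simpa using hq)
      (by simpa using ha)
    rw [Complex.betaIntegral, intervalIntegral.integral_of_le zero_le_one,
      integral_Ioc_eq_integral_Ioo, setIntegral_congr_fun measurableSet_Ioo (hcast q),
      integral_complex_ofReal] at h1
    have h2 : ∫ t in Set.Ioo (0 : ℝ) 1, t ^ (q - 1) * ((1 - t) ^ (a - 1) / Real.Gamma a) =
        (∫ t in Set.Ioo (0 : ℝ) 1, t ^ (q - 1) * (1 - t) ^ (a - 1)) / Real.Gamma a := by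
      rw [← integral_div]
      congr 1 with t
      ring
    have hΓ' : Complex.Gamma a ≠ 0 := by
      rw [Complex.Gamma_ofReal]
      exact_mod_cast hΓ.ne'
    rw [h2, Complex.ofReal_div, h1, ← Complex.Gamma_ofReal]
    field_simp
  · intro c x hc0 hc1 hx0 hx1
    have h1 := tendsto_residue_sum_cpow hc0 hc1 (φ := fun s => (Complex.Gamma (s + a))⁻¹)
      (fun s _ => hinv s) (fun s _ _ => (hinv s).continuousAt) hstep
      (y := (x : ℂ)) (by exact_mod_cast hx0.ne')
      (by rwa [Complex.norm_real, Real.norm_of_nonneg hx0.le])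
    refine tendsto_nhds_unique h1 ?_
    have h2 := (hasSum_one_div_one_sub_rpow (1 - a) (x := x)
      (by rwa [abs_of_pos hx0])).tendsto_sum_nat.div_const (Real.Gamma a)
    rw [one_div, ← Real.rpow_neg (sub_nonneg.2 hx1.le), neg_sub] at h2
    refine ((Complex.continuous_ofReal.tendsto _).comp h2).congr fun N => ?_
    rw [Function.comp_apply, Finset.sum_div, Complex.ofReal_sum]
    refine Finset.sum_congr rfl fun k _ => ?_
    have h3 := inv_Gamma_sub_nat a k
    rw [neg_add_eq_sub]
    push_cast
    rw [← Complex.Gamma_ofReal]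
    linear_combination (-(x : ℂ) ^ k / (k.factorial : ℂ)) * h3

/-- Loops of positive abscissa and the positive reals lie in the slit plane, so values of F at the
poles, fixed only by convention, are irrelevant. -/
theorem MellinPair.congr {F G : ℂ → ℂ} {h : ℝ → ℝ} (P : MellinPair F h)
    (hFG : ∀ s ∈ Complex.slitPlane, F s = G s) : MellinPair G h := by
  refine ⟨fun s hs => ?_, fun ε hε => ?_, P.continuousOn, P.nonneg, P.integrableOn, fun q hq => ?_,
    fun c x hc0 hc1 hx0 hx1 => ?_⟩
  · refine (P.differentiableAt s hs).congr_of_eventuallyEq ?_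
    filter_upwards [Complex.isOpen_slitPlane.mem_nhds hs] with z hz
    exact (hFG z hz).symm
  · obtain ⟨C, hC0, hC⟩ := P.subexp ε hε
    exact ⟨C, hC0, fun s h1 h2 => by
      rw [← hFG s (mem_slitPlane_of_abs_im h2)]
      exact hC s h1 h2⟩
  · rw [P.mellin q hq, hFG _ (Complex.ofReal_mem_slitPlane.2 hq)]
  · rw [← P.loop c x hc0 hc1 hx0 hx1]
    refine loopIntegral_congr fun s _ _ h3 => ?_
    rw [hFG]
    rcases h3 with h3 | h3
    · exact Or.inl (by rw [h3]; exact hc0)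
    · exact mem_slitPlane_of_abs_im h3

/-- The clause for n = 0 keeps the density explicit, as needed for the closed form of the weight at
m = 0. -/
theorem MellinPair.exists_div_prod {F : ℂ → ℂ} {h : ℝ → ℝ} (P : MellinPair F h) {b : ℝ}
    (hb : 0 ≤ b) (n : ℕ) :
    ∃ h', MellinPair (fun s => F s / ∏ j ∈ Finset.range n, (s + (b + j))) h' ∧
      (n = 0 → h' = h) := by
  induction n with
  | zero => exact ⟨h, by simpa using P, fun _ => rfl⟩
  | succ n ih =>
    obtain ⟨h', P', _⟩ := ih
    refine ⟨_, (P'.div_add (b := b + n) (by positivity)).congr fun s _ => ?_, by simp⟩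
    rw [Finset.prod_range_succ, div_div]
    push_cast
    rfl

/-! ### Evaluation of the two Meijer functions -/

theorem leftAbscissa_one_three (b : ℂ) : leftAbscissa 1 ![0, 0, b] = 0 := by
  have : {r : ℝ | ∃ j : Fin 3, j.val < 1 ∧ r = -((![0, 0, b] : Fin 3 → ℂ) j).re} = {0} := by
    ext r
    simp only [Set.mem_ofPred_eq, Set.mem_singleton_iff]
    constructor
    · rintro ⟨j, hj, rfl⟩
      have : j = 0 := Fin.ext (by simpa using hj)
      subst this
      simp
    · rintro rfl
      exact ⟨0, by simp, by simp⟩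
  rw [leftAbscissa, this, csSup_singleton]

theorem leftAbscissa_three_three {b : ℂ} (hb : 0 ≤ b.re) : leftAbscissa 3 ![0, 0, b] = 0 := by
  refine IsGreatest.csSup_eq ⟨⟨0, by simp, by simp⟩, ?_⟩
  rintro r ⟨j, _, rfl⟩
  fin_cases j <;> simp [hb]

/-- The right family of poles starts at real part at least 1, so the cap `leftAbscissa + 1` is
attained. Both Meijer functions therefore use the loop of abscissa 1/2 and height 1. -/
theorem rightAbscissa_three_three {a₀ a₁ a₂ b : ℂ} (h₀ : a₀.re ≤ 0) (h₁ : a₁.re ≤ 0)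
    (h₂ : a₂.re ≤ 0) : rightAbscissa 1 3 ![a₀, a₁, a₂] ![0, 0, b] = 1 := by
  rw [rightAbscissa, leftAbscissa_one_three, zero_add]
  refine IsLeast.csInf_eq ⟨Set.mem_insert _ _, ?_⟩
  rintro r (rfl | ⟨j, _, rfl⟩)
  · exact le_rfl
  · fin_cases j <;> simp [h₀, h₁, h₂]

theorem rightAbscissa_three_zero {a : Fin 3 → ℂ} {b : ℂ} (hb : 0 ≤ b.re) :
    rightAbscissa 3 0 a ![0, 0, b] = 1 := by
  rw [rightAbscissa, leftAbscissa_three_three hb, zero_add]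
  simp

theorem loopHeight_three {b : ℂ} (hb : b.im = 0) : loopHeight ![0, 0, b] = 1 := by
  simp [loopHeight, Fin.sum_univ_three, hb]

/-- The Taylor coefficients of `G^{1,3}_{3,3}(-x | -m, -2m-ν, -2m-ν; 0, 0, -m-ν)`. -/
def meijerCoeff (ν : ℝ) (m n : ℕ) : ℝ :=
  Real.Gamma (n + m + 1) * Real.Gamma (n + 2 * m + ν + 1) ^ 2 /
    (Real.Gamma (n + 1) ^ 2 * Real.Gamma (n + m + ν + 1))

theorem meijerCoeff_pos {ν : ℝ} (hν : 0 ≤ ν) (m n : ℕ) : 0 < meijerCoeff ν m n := by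
  have h1 := Real.Gamma_pos_of_pos (s := n + m + 1) (by positivity)
  have h2 := Real.Gamma_pos_of_pos (s := n + 2 * m + ν + 1) (by positivity)
  have h3 := Real.Gamma_pos_of_pos (s := n + 1) (by positivity)
  have h4 := Real.Gamma_pos_of_pos (s := n + m + ν + 1) (by positivity)
  unfold meijerCoeff
  positivity

theorem meijerG_three_zero {ν : ℝ} (hν : 0 ≤ ν) (m : ℕ) {h : ℝ → ℝ}
    (P : MellinPair (meijerKernel 3 0 ![(m : ℂ), 2 * m + ν, 2 * m + ν] ![0, 0, (m : ℂ) + ν]) h)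
    {x : ℝ} (hx0 : 0 < x) (hx1 : x < 1) :
    meijerG 3 0 ![(m : ℂ), 2 * m + ν, 2 * m + ν] ![0, 0, (m : ℂ) + ν] (x : ℂ) = h x := by
  have hb : 0 ≤ ((m : ℂ) + ν).re := by simp; positivity
  rw [meijerG, leftAbscissa_three_three hb, rightAbscissa_three_zero hb, loopHeight_three (by simp),
    ← P.loop ((0 + 1) / 2) x (by norm_num) (by norm_num) hx0 hx1]

theorem meijerKernel_three_zero (ν : ℝ) (m : ℕ) (s : ℂ) :
    meijerKernel 3 0 ![(m : ℂ), 2 * m + ν, 2 * m + ν] ![0, 0, (m : ℂ) + ν] s =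
      Complex.Gamma s ^ 2 * Complex.Gamma (s + (m + ν)) /
        (Complex.Gamma (s + m) * Complex.Gamma (s + (2 * m + ν)) ^ 2) := by
  simp [meijerKernel, Finset.prod_filter, Fin.prod_univ_three, add_comm s]
  ring

theorem meijerKernel_one_three (ν : ℝ) (m : ℕ) (s : ℂ) :
    meijerKernel 1 3 ![-(m : ℂ), -2 * m - ν, -2 * m - ν] ![0, 0, -(m : ℂ) - ν] s =
      Complex.Gamma s * (Complex.Gamma (1 + m - s) * Complex.Gamma (1 + (2 * m + ν) - s) ^ 2 *
        ((Complex.Gamma (1 - s))⁻¹ * (Complex.Gamma (1 + (m + ν) - s))⁻¹)) := by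
  have e1 : 1 - (-(2 * (m : ℂ)) - ν) - s = 1 + (2 * m + ν) - s := by ring
  have e2 : 1 - (-(m : ℂ) - ν) - s = 1 + (m + ν) - s := by ring
  simp [meijerKernel, Finset.prod_filter, Fin.prod_univ_three, e1, e2]
  ring

/-- The regular factor of the kernel of `G^{1,3}_{3,3}(· | -p, -q, -q; 0, 0, -r)`. -/
def regularFactor (p q r : ℝ) (s : ℂ) : ℂ :=
  Complex.Gamma (1 + p - s) * Complex.Gamma (1 + q - s) ^ 2 *
    ((Complex.Gamma (1 - s))⁻¹ * (Complex.Gamma (1 + r - s))⁻¹)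

theorem differentiableAt_regularFactor {p q r : ℝ} (hp : 0 ≤ p) (hq : 0 ≤ q) {s : ℂ}
    (hs : s.re < 1 ∨ s.im ≠ 0) : DifferentiableAt ℂ (regularFactor p q r) s := by
  have hinv : ∀ c : ℂ, Differentiable ℂ fun s : ℂ => (Complex.Gamma (c - s))⁻¹ := fun c =>
    Complex.differentiable_one_div_Gamma.comp (differentiable_id.const_sub c)
  have hΓ : ∀ c : ℝ, 0 ≤ c → DifferentiableAt ℂ (fun s => Complex.Gamma (1 + c - s)) s := by
    intro c hc
    refine (Complex.differentiableAt_Gamma (1 + c - s) (ne_neg_nat_of_mem_slitPlane ?_)).comp s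
      (differentiableAt_id.const_sub _)
    rw [Complex.mem_slitPlane_iff]
    refine hs.imp (fun h => ?_) fun h => ?_
    · simp
      linarith
    · simpa using h
  exact ((hΓ p hp).mul ((hΓ q hq).pow 2)).mul ((hinv _ s).mul (hinv _ s))

/-- The functional equations produce -(p-w)(q-w)²/(w²(r-w)). Pairing one numerator factor with each
denominator factor writes this as a product of terms 1 + A/w', each close to 1. -/
theorem Gamma_mul_regularFactor_step {p q r : ℝ} {w : ℂ} (hw : w ≠ 0) (hp : p - w ≠ 0)
    (hq : q - w ≠ 0) (hr : r - w ≠ 0) :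
    Complex.Gamma w * regularFactor p q r w =
      -((1 + (p : ℂ) / (-w)) * (1 + (q : ℂ) / (-w)) * (1 + ((q - r : ℝ) : ℂ) / (r - w))) *
        (Complex.Gamma (w + 1) * regularFactor p q r (w + 1)) := by
  have h : ∀ c : ℂ, c - w ≠ 0 →
      Complex.Gamma (1 + c - w) = (c - w) * Complex.Gamma (1 + c - (w + 1)) := by
    intro c hc
    have e1 : 1 + c - w = (c - w) + 1 := by ring
    have e2 : 1 + c - (w + 1) = c - w := by ring
    rw [e1, e2, Complex.Gamma_add_one _ hc]
  have h0 := h 0 (by simpa using hw)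
  simp only [add_zero, zero_sub] at h0
  unfold regularFactor
  rw [Complex.Gamma_add_one w hw, h p hp, h q hq, h r hr, h0, mul_inv, mul_inv]
  push_cast
  field_simp
  ring

theorem norm_Gamma_mul_regularFactor_le {p q r : ℝ} (hp : 0 ≤ p) (hr : 0 ≤ r) (hrq : r ≤ q)
    {N : ℕ} (hN : 1 ≤ N) {s : ℂ} (hs : s.re ≤ 1) :
    ‖Complex.Gamma (s - N - 1) * regularFactor p q r (s - N - 1)‖ ≤
      Real.exp ((p + q + (q - r)) / N) *
        ‖Complex.Gamma (s - N) * regularFactor p q r (s - N)‖ := by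
  have hN' : (1 : ℝ) ≤ N := by exact_mod_cast hN
  have hle : ∀ c : ℝ, 0 ≤ c → (N : ℝ) ≤ ‖(c : ℂ) - (s - N - 1)‖ := by
    intro c hc
    refine le_trans ?_ (Complex.abs_re_le_norm _)
    refine le_trans ?_ (le_abs_self _)
    simp
    linarith
  have hne : ∀ c : ℝ, 0 ≤ c → (c : ℂ) - (s - N - 1) ≠ 0 := fun c hc =>
    norm_pos_iff.1 (by linarith [hle c hc])
  have hw : (N : ℝ) ≤ ‖-(s - N - 1)‖ := by
    rw [norm_neg]
    exact natCast_le_norm_sub hs N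
  rw [Gamma_mul_regularFactor_step (neg_ne_zero.1 (norm_pos_iff.1 (by linarith))) (hne p hp)
    (hne q (hr.trans hrq)) (hne r hr), norm_mul, sub_add_cancel, norm_neg, norm_mul, norm_mul,
    add_div, add_div, Real.exp_add, Real.exp_add]
  gcongr
  · exact norm_one_add_div_le hp hN hw
  · exact norm_one_add_div_le (hr.trans hrq) hN hw
  · exact norm_one_add_div_le (sub_nonneg.2 hrq) hN (hle r hr)

/-- The residue at -k carries the sign (-1)^k, which the argument -x cancels. The terms are then
nonnegative, so convergence of partial sums already gives summability. -/
theorem hasSum_meijerG_one_three {ν : ℝ} (hν : 0 ≤ ν) (m : ℕ) {x : ℝ} (hx0 : 0 < x)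
    (hx1 : x < 1) :
    HasSum (fun k => meijerCoeff ν m k * x ^ k)
      (meijerG 1 3 ![-(m : ℂ), -2 * m - ν, -2 * m - ν] ![0, 0, -(m : ℂ) - ν] (-(x : ℂ))).re ∧
    (meijerG 1 3 ![-(m : ℂ), -2 * m - ν, -2 * m - ν] ![0, 0, -(m : ℂ) - ν] (-(x : ℂ))).im = 0 := by
  have hm : (0 : ℝ) ≤ m := m.cast_nonneg
  have hq : (0 : ℝ) ≤ 2 * m + ν := by positivity
  have h1 := tendsto_residue_sum_cpow (c := (0 + 1) / 2) (by norm_num) (by norm_num)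
    (φ := regularFactor m (2 * m + ν) (m + ν))
    (fun s hs => differentiableAt_regularFactor hm hq (Or.inl hs))
    (fun s _ hs => (differentiableAt_regularFactor hm hq (Or.inr (by
      rintro h
      simp [h] at hs))).continuousAt)
    (fun N hN s hs _ => norm_Gamma_mul_regularFactor_le hm (by positivity) (by linarith) hN hs)
    (y := -(x : ℂ)) (by simpa using hx0.ne')
    (by rwa [norm_neg, Complex.norm_real, Real.norm_of_nonneg hx0.le])
  have h2 : meijerG 1 3 ![-(m : ℂ), -2 * m - ν, -2 * m - ν] ![0, 0, -(m : ℂ) - ν] (-(x : ℂ)) =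
      loopIntegral ((0 + 1) / 2) 1 fun s =>
        Complex.Gamma s * regularFactor m (2 * m + ν) (m + ν) s * (-(x : ℂ)) ^ (-s) := by
    rw [meijerG, leftAbscissa_one_three, rightAbscissa_three_three (by simp)
      (by simp; linarith) (by simp; linarith), loopHeight_three (by simp)]
    congr 1
    ext s
    rw [meijerKernel_one_three, regularFactor]
    push_cast
    rfl
  rw [← h2] at h1
  have h3 : ∀ k : ℕ, (-1) ^ k / (k.factorial : ℂ) * regularFactor m (2 * m + ν) (m + ν) (-k) *
      (-(x : ℂ)) ^ k = ((meijerCoeff ν m k * x ^ k : ℝ) : ℂ) := by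
    intro k
    have hf : ((k.factorial : ℝ)) = Real.Gamma (k + 1) := (Real.Gamma_nat_eq_factorial k).symm
    have hf' : ((k.factorial : ℂ)) = ((Real.Gamma (k + 1) : ℝ) : ℂ) := by
      rw [← hf]
      norm_cast
    have hc : ∀ c : ℝ, Complex.Gamma (1 + c - -(k : ℂ)) = ((Real.Gamma (k + c + 1) : ℝ) : ℂ) := by
      intro c
      rw [← Complex.Gamma_ofReal]
      congr 1
      push_cast
      ring
    have hc0 := hc 0
    simp only [Complex.ofReal_zero, add_zero] at hc0
    have hs : ((-1 : ℂ)) ^ k * (-(x : ℂ)) ^ k = (x : ℂ) ^ k := by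
      rw [← mul_pow]
      simp
    rw [regularFactor, hc, hc, hc, hc0, hf', meijerCoeff, ← add_assoc (k : ℝ),
      ← add_assoc (k : ℝ), Complex.ofReal_mul, Complex.ofReal_div, Complex.ofReal_pow, ← hs]
    push_cast
    ring
  simp only [h3, ← Complex.ofReal_sum] at h1
  constructor
  · rw [hasSum_iff_tendsto_nat_of_nonneg fun k => by
      have := meijerCoeff_pos hν m k
      positivity]
    exact ((Complex.continuous_re.tendsto _).comp h1).congr fun N => Complex.ofReal_re _
  · refine tendsto_nhds_unique ((Complex.continuous_im.tendsto _).comp h1)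
      (tendsto_const_nhds.congr fun N => (Complex.ofReal_im _).symm)

/-- Since Γ(s)/Γ(s+m) = 1/∏_{j<m} (s+j) and Γ(s+m+ν)/Γ(s+2m+ν) = 1/∏_{j<m} (s+m+ν+j), the kernel is
Γ(s)/Γ(s+2m+ν) divided by these two products. -/
theorem exists_mellinPair_three_zero {ν : ℝ} (hν : 0 < ν) (m : ℕ) :
    ∃ h, MellinPair
      (meijerKernel 3 0 ![(m : ℂ), 2 * m + ν, 2 * m + ν] ![0, 0, (m : ℂ) + ν]) h ∧
      (m = 0 → h = fun x => (1 - x) ^ (ν - 1) / Real.Gamma ν) := by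
  obtain ⟨h₁, P₁, hm₁⟩ := (mellinPair_Gamma_div (a := 2 * m + ν) (by positivity)).exists_div_prod
    le_rfl m
  obtain ⟨h₂, P₂, hm₂⟩ := P₁.exists_div_prod (b := m + ν) (by positivity) m
  refine ⟨h₂, P₂.congr fun s hs => ?_, fun h0 => ?_⟩
  · have hne : ∀ c : ℝ, 0 ≤ c → ∀ j : ℕ, s + c + j ≠ 0 := by
      intro c hc j h
      have h' : s = ((-(c + j) : ℝ) : ℂ) := by
        push_cast
        linear_combination h
      rw [h', Complex.ofReal_mem_slitPlane] at hs
      have : (0 : ℝ) ≤ j := j.cast_nonneg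
      linarith
    have e1 := complex_Gamma_add_nat s m fun j _ => by simpa using hne 0 le_rfl j
    have e2 := complex_Gamma_add_nat (s + (m + ν)) m fun j _ => by
      simpa using hne (m + ν) (by positivity) j
    have e3 : s + (m + ν) + m = s + (2 * (m : ℂ) + ν) := by ring
    rw [e3] at e2
    have hΓ : Complex.Gamma s ≠ 0 := Complex.Gamma_ne_zero (ne_neg_nat_of_mem_slitPlane hs)
    have hΓ' : Complex.Gamma (s + (m + ν)) ≠ 0 := Complex.Gamma_ne_zero fun j h => by
      refine hne (m + ν) (by positivity) j ?_
      push_cast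
      rw [h]
      ring
    rw [meijerKernel_three_zero, e1]
    push_cast
    rw [e2]
    simp only [zero_add, ← add_assoc] at hΓ' ⊢
    generalize ∏ j ∈ Finset.range m, (s + j : ℂ) = p
    generalize ∏ j ∈ Finset.range m, (s + m + ν + j : ℂ) = q
    field_simp
  · rw [hm₂ h0, hm₁ h0]
    simp [h0]

/-! ### The moduli of the coefficients -/

theorem real_Gamma_add_nat {b : ℝ} (hb : 0 < b) (p : ℕ) :
    Real.Gamma (b + p) = (∏ i ∈ Finset.range p, (b + i)) * Real.Gamma b := by
  induction p with
  | zero => simp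
  | succ p ih =>
    rw [Finset.prod_range_succ, Nat.cast_succ, ← add_assoc, Real.Gamma_add_one (by positivity), ih]
    ring

theorem prod_range_sub_mul_factorial (M p : ℕ) :
    (∏ i ∈ Finset.range p, ((M : ℝ) + p - i)) * (M.factorial : ℝ) = ((M + p).factorial : ℝ) := by
  induction p with
  | zero => simp
  | succ p ih =>
    rw [Finset.prod_range_succ', ← Nat.add_assoc, Nat.factorial_succ]
    push_cast
    simp only [← ih, ← add_assoc, add_sub_add_right_eq_sub, sub_zero]
    ring

theorem sum_Icc_remainder (κ ν : ℝ) (k j : ℕ) :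
    ∑ s ∈ Finset.Icc (k + 1) (k + j), remainder κ (param (ν + 1) s) =
      κ ^ 2 * (j * (2 * k + j + 1 + ν)) := by
  induction j with
  | zero => simp
  | succ j ih =>
    rw [← Nat.add_assoc, Finset.sum_Icc_succ_top (by omega), ih, remainder, param]
    push_cast
    ring

/-- Each inner sum is κ² times its length times a linear factor; the lengths multiply to a quotient
of factorials and the linear factors to a quotient of Gamma values. The extra length M covers both
products in the expansion coefficient: (k, p, M) = (m, n, 0) and (0, m, n). -/
theorem prod_sum_remainder (κ : ℝ) {ν : ℝ} (hν : 0 ≤ ν) (k p M : ℕ) :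
    ∏ i ∈ Finset.Icc (k + 1) (k + p),
        ∑ s ∈ Finset.Icc i (k + p + M), remainder κ (param (ν + 1) s) =
      κ ^ (2 * p) * (((M + p).factorial : ℝ) / M.factorial) *
        (Real.Gamma (2 * k + 2 * p + M + 1 + ν) / Real.Gamma (2 * k + p + M + 1 + ν)) := by
  have hb : 0 < 2 * (k : ℝ) + p + M + 1 + ν := by positivity
  have h1 := real_Gamma_add_nat hb p
  have e1 : 2 * (k : ℝ) + p + M + 1 + ν + p = 2 * k + 2 * p + M + 1 + ν := by ring
  rw [← e1, h1, mul_div_cancel_right₀ _ (Real.Gamma_pos_of_pos hb).ne',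
    ← prod_range_sub_mul_factorial, mul_div_cancel_right₀ _ (by positivity),
    ← Finset.Ico_add_one_right_eq_Icc, Finset.prod_Ico_eq_prod_range,
    show k + p + 1 - (k + 1) = p by omega, pow_mul, mul_assoc, ← Finset.prod_mul_distrib]
  have hpow : (κ ^ 2) ^ p = ∏ _i ∈ Finset.range p, κ ^ 2 := by simp
  rw [hpow, ← Finset.prod_mul_distrib]
  refine Finset.prod_congr rfl fun i hi => ?_
  obtain ⟨q, rfl⟩ := Nat.exists_eq_add_of_lt (Finset.mem_range.1 hi)
  have h2 := sum_Icc_remainder κ ν (k + i) (q + 1 + M)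
  rw [show k + 1 + i = k + i + 1 by omega,
    show k + (i + q + 1) + M = k + i + (q + 1 + M) by omega, h2]
  push_cast
  ring

theorem norm_functionalZ_sq {κ ν : ℝ} (α : ℝ) (hν : 0 ≤ ν) (k : ℕ) :
    ‖functionalZ κ α (ν + 1) (1 + k)‖ ^ 2 =
      κ ^ 2 * ((2 * k + ν + 1) * (2 * k + ν + 1 + 1)) := by
  have h1 : auxG (param (ν + 1) (1 + k)) κ κ * auxG (param (ν + 1) (1 + k)) κ 0 =
      κ ^ 2 * ((2 * k + ν + 1) * (2 * k + ν + 1 + 1)) := by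
    simp only [auxG, param]
    push_cast
    ring
  have h2 : ‖Complex.exp (-Complex.I * α * (remainder κ (param (ν + 1) (1 + k)) : ℂ))‖ = 1 := by
    rw [Complex.norm_exp]
    simp
  rw [functionalZ, norm_mul, h2, mul_one, h1, Complex.norm_real, Real.norm_of_nonneg
    (Real.sqrt_nonneg _), Real.sq_sqrt (by positivity)]

theorem prod_norm_functionalZ_sq {κ ν : ℝ} (α : ℝ) (hν : 0 ≤ ν) (m n : ℕ) :
    ∏ k ∈ Finset.Ico m (n + m), ‖functionalZ κ α (ν + 1) (1 + k)‖ ^ 2 =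
      κ ^ (2 * n) * (Real.Gamma (2 * m + 2 * n + 1 + ν) / Real.Gamma (2 * m + ν + 1)) := by
  have hΓ : Real.Gamma (2 * m + ν + 1) ≠ 0 := (Real.Gamma_pos_of_pos (by positivity)).ne'
  induction n with
  | zero => simp [add_right_comm, hΓ]
  | succ n ih =>
    have e1 : 2 * (m : ℝ) + 2 * ((n + 1 : ℕ) : ℝ) + 1 + ν = 2 * m + 2 * n + 1 + ν + 1 + 1 := by
      push_cast
      ring
    rw [Nat.add_right_comm, Finset.prod_Ico_succ_top (by omega), ih, norm_functionalZ_sq α hν, e1,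
      Real.Gamma_add_one (s := 2 * m + 2 * n + 1 + ν + 1) (by positivity),
      Real.Gamma_add_one (s := 2 * m + 2 * n + 1 + ν) (by positivity)]
    push_cast
    ring

/-- The value Γ(2m+2n+ν+1) from the product of the |Z|² cancels the one from the product over k > m,
and so do the factors κ^{2n}. The product over k ≤ m supplies κ^{2m}. -/
theorem norm_secondCoeff_sq {κ ν : ℝ} (hκ : 0 < κ) (α : ℝ) (hν : 0 ≤ ν) (m n : ℕ) :
    ‖secondCoeff κ α ν m n‖ ^ 2 =
      κ ^ (2 * m) * meijerCoeff ν m n / Real.Gamma (2 * m + ν + 1) := by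
  have h1 := prod_sum_remainder κ hν m n 0
  have h2 := prod_sum_remainder κ hν 0 m n
  have h3 := prod_norm_functionalZ_sq (κ := κ) α hν m n
  have hΓ1 := Real.Gamma_pos_of_pos (s := 2 * m + ν + 1) (by positivity)
  have hΓ2 := Real.Gamma_pos_of_pos (s := 2 * m + 2 * n + 1 + ν) (by positivity)
  have hΓ3 := Real.Gamma_pos_of_pos (s := n + 2 * m + ν + 1) (by positivity)
  have hΓ4 := Real.Gamma_pos_of_pos (s := n + m + ν + 1) (by positivity)
  have e1 : 2 * (m : ℝ) + n + (0 : ℕ) + 1 + ν = n + 2 * m + ν + 1 := by push_cast; ring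
  have e2 : 2 * (m : ℝ) + 2 * n + (0 : ℕ) + 1 + ν = 2 * m + 2 * n + 1 + ν := by push_cast; ring
  have e3 : 2 * ((0 : ℕ) : ℝ) + m + n + 1 + ν = n + m + ν + 1 := by push_cast; ring
  have e4 : 2 * ((0 : ℕ) : ℝ) + 2 * m + n + 1 + ν = n + 2 * m + ν + 1 := by push_cast; ring
  rw [e1, e2, Nat.add_comm m n] at h1
  simp only [Nat.add_zero, Nat.zero_add, Nat.factorial_zero, Nat.cast_one, div_one] at h1
  rw [e3, e4, Nat.zero_add, Nat.zero_add, Nat.add_comm m n] at h2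
  have e5 : (n.factorial : ℝ) = Real.Gamma (n + 1) := (Real.Gamma_nat_eq_factorial n).symm
  have e6 : ((n + m).factorial : ℝ) = Real.Gamma (n + m + 1) := by
    rw [← Real.Gamma_nat_eq_factorial]
    push_cast
    rfl
  have hn : 0 < (n.factorial : ℝ) := by positivity
  rw [secondCoeff, expansionCoeff, one_div_div, norm_div, norm_mul, div_pow, mul_pow, norm_prod,
    ← Finset.prod_pow, h3, Complex.norm_real, Complex.norm_real,
    Real.norm_of_nonneg (Real.sqrt_nonneg _), Real.norm_of_nonneg (Real.sqrt_nonneg _),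
    Real.sq_sqrt (by rw [h2]; positivity), Real.sq_sqrt (by rw [h1]; positivity), h1, h2,
    meijerCoeff, ← e5, ← e6]
  field_simp

theorem norm_explicitCoeff_sq {κ ν : ℝ} (hκ : 0 < κ) (α : ℝ) (hν : 0 ≤ ν) (m n : ℕ) :
    ‖explicitCoeff κ α ν m n‖ ^ 2 =
      κ ^ (2 * m) * meijerCoeff ν m n / Real.Gamma (2 * m + ν + 1) := by
  have h1 : ‖Complex.exp (-Complex.I * α * (energy κ (ν + 1) n : ℂ))‖ = 1 := by
    rw [Complex.norm_exp]
    simp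
  have h2 : κ ^ (2 * m) *
      (Real.Gamma (n + m + 1) * Real.Gamma (n + 2 * m + ν + 1) ^ 2 /
        (Real.Gamma (n + 1) ^ 2 * Real.Gamma (n + m + ν + 1) * Real.Gamma (2 * m + ν + 1))) =
      κ ^ (2 * m) * meijerCoeff ν m n / Real.Gamma (2 * m + ν + 1) := by
    rw [meijerCoeff]
    field_simp
  have hΓ := Real.Gamma_pos_of_pos (s := 2 * m + ν + 1) (by positivity)
  have := meijerCoeff_pos hν m n
  rw [explicitCoeff, norm_mul, h1, mul_one, h2, Complex.norm_real,
    Real.norm_of_nonneg (Real.sqrt_nonneg _), Real.sq_sqrt (by positivity)]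

/-! ### The weight -/

/-- The reciprocity linking the two Meijer functions: the moments of one are the inverses of the
Taylor coefficients of the other. -/
theorem meijerKernel_three_zero_natCast (ν : ℝ) (m n : ℕ) :
    meijerKernel 3 0 ![(m : ℂ), 2 * m + ν, 2 * m + ν] ![0, 0, (m : ℂ) + ν]
      ((n + 1 : ℝ) : ℂ) = (((meijerCoeff ν m n)⁻¹ : ℝ) : ℂ) := by
  have h : ∀ c : ℝ, Complex.Gamma (((n + 1 : ℝ) : ℂ) + c) = (Real.Gamma (n + c + 1) : ℂ) := by
    intro c
    rw [← Complex.Gamma_ofReal]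
    congr 1
    push_cast
    ring
  have h1 := h m
  have h2 := h (m + ν)
  have h3 := h (2 * m + ν)
  rw [← add_assoc] at h2 h3
  push_cast at h1 h2 h3
  rw [meijerKernel_three_zero, Complex.Gamma_ofReal, meijerCoeff, inv_div]
  push_cast
  rw [h1, h2, h3]

/-- The weight splits as `π⁻¹ (∑ c_k x^k) h(x)`, where the `n`-th moment of `h` is `1 / c_n`. -/
theorem exists_weight_eq {ν : ℝ} (hν : 0 < ν) (m : ℕ) :
    ∃ h : ℝ → ℝ, ContinuousOn h (Set.Ioo 0 1) ∧ (∀ x ∈ Set.Ioo (0 : ℝ) 1, 0 ≤ h x) ∧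
      IntegrableOn h (Set.Ioo 0 1) ∧
      (∀ n : ℕ, ∫ x in Set.Ioo (0 : ℝ) 1, x ^ n * h x = (meijerCoeff ν m n)⁻¹) ∧
      (∀ x ∈ Set.Ioo (0 : ℝ) 1, weight ν m x =
        ((1 / Real.pi * (∑' k, meijerCoeff ν m k * x ^ k) * h x : ℝ) : ℂ)) ∧
      (m = 0 → h = fun x => (1 - x) ^ (ν - 1) / Real.Gamma ν) := by
  obtain ⟨h, P, h0⟩ := exists_mellinPair_three_zero hν m
  refine ⟨h, P.continuousOn, P.nonneg, P.integrableOn_self, fun n => ?_, fun x hx => ?_, h0⟩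
  · have h1 := P.mellin (n + 1) (by positivity)
    rw [meijerKernel_three_zero_natCast, Complex.ofReal_inj] at h1
    simpa using h1
  · obtain ⟨h1, h2⟩ := hasSum_meijerG_one_three hν.le m hx.1 hx.2
    rw [weight, meijerG_three_zero hν.le m P hx.1 hx.2, h1.tsum_eq, Complex.ofReal_mul,
      Complex.ofReal_mul, ← Complex.re_add_im (meijerG 1 3 _ _ _), h2]
    simp

/-- The constant C cancels: dividing the density by πC solves the moment problem for d, and the
series of the |d_n|² xⁿ restores the factor C in the weight. -/
theorem resolvesIdentity_of_norm_sq {H : Type*} [NormedAddCommGroup H] [InnerProductSpace ℂ H]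
    [CompleteSpace H] {Ψ : ℕ → H} (hΨ : Orthonormal ℂ Ψ) {ν : ℝ} (hν : 0 < ν) {m : ℕ} {d : ℕ → ℂ}
    {C : ℝ} (hC : 0 < C) (hd : ∀ n, ‖d n‖ ^ 2 = C * meijerCoeff ν m n) :
    ResolvesIdentity (tailSpace Ψ m) (photonAdded Ψ d m) (weight ν m) := by
  obtain ⟨h, hcont, hnn, hint, hmom, hw, _⟩ := exists_weight_eq hν m
  have hπ := Real.pi_pos
  have hsum : ∀ x, 0 ≤ x → x < 1 → Summable fun n => ‖d n‖ ^ 2 * x ^ n := by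
    intro x hx0 hx1
    simp only [hd, mul_assoc]
    refine Summable.mul_left C ?_
    -- Comparison with the midpoint of x and 1 also covers x = 0, where the Meijer expansion is not
    -- available.
    have hx2 : (x + 1) / 2 < 1 := by linarith
    have h1 := (hasSum_meijerG_one_three hν.le m (x := (x + 1) / 2) (by linarith) hx2).1.summable
    refine h1.of_nonneg_of_le (fun n => ?_) fun n => ?_
    · have := meijerCoeff_pos hν.le m n
      positivity
    · have := meijerCoeff_pos hν.le m n
      gcongr
      linarith
  refine resolvesIdentity_photonAdded hΨ m (h := fun x => 1 / (Real.pi * C) * h x) hsum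
    (hcont.const_smul (1 / (Real.pi * C))) (fun x hx => mul_nonneg (by positivity) (hnn x hx))
    (hint.const_mul _) (fun n => ?_) fun x hx => ?_
  · have hc := meijerCoeff_pos hν.le m n
    simp only [mul_left_comm _ (1 / (Real.pi * C))]
    rw [integral_const_mul, hmom, hd]
    field_simp
  · rw [hw x hx]
    simp only [hd, mul_assoc, tsum_mul_left]
    congr 1
    field_simp

/-- For m = 0 the series is Γ(ν+1) (1-x)^{-ν-1} by the binomial theorem and the density is
(1-x)^{ν-1}/Γ(ν), so the powers combine to (1-x)^{-2}. -/
theorem weight_zero {ν : ℝ} (hν : 0 < ν) {x : ℝ} (hx : x ∈ Set.Ioo (0 : ℝ) 1) :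
    weight ν 0 x = ((ν / Real.pi * (1 - x) ^ (-2 : ℤ) : ℝ) : ℂ) := by
  obtain ⟨h, _, _, _, _, hw, h0⟩ := exists_weight_eq hν 0
  have hΓ := Real.Gamma_pos_of_pos hν
  have hx1 : 0 < 1 - x := sub_pos.2 hx.2
  have h1 : ∀ k, meijerCoeff ν 0 k =
      Real.Gamma (ν + 1) * ((∏ j ∈ Finset.range k, (ν + 1 + j)) / k.factorial) := by
    intro k
    have e1 := real_Gamma_add_nat (b := ν + 1) (by positivity) k
    have e2 := Real.Gamma_nat_eq_factorial k
    have e3 : (k : ℝ) + ν + 1 = ν + 1 + k := by ring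
    have hk : 0 < Real.Gamma (ν + 1 + k) := Real.Gamma_pos_of_pos (by positivity)
    simp only [meijerCoeff, Nat.cast_zero, mul_zero, add_zero, e3, e2]
    field_simp
    rw [e1]
    ring
  have h2 := ((hasSum_one_div_one_sub_rpow (ν + 1) (x := x)
    (by rw [abs_of_pos hx.1]; exact hx.2)).mul_left (Real.Gamma (ν + 1))).tsum_eq
  have h3 : (1 - x) ^ (ν + 1) = (1 - x) ^ (ν - 1) * (1 - x) ^ 2 := by
    rw [← Real.rpow_natCast, ← Real.rpow_add hx1]
    congr 1
    push_cast
    ring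
  rw [hw x hx, h0 rfl]
  simp only [h1, mul_assoc] at h2 ⊢
  rw [h2, h3, Real.Gamma_add_one hν.ne', zpow_neg]
  congr 1
  norm_cast
  have := Real.rpow_pos_of_pos hx1 (ν - 1)
  field_simp

end PoschlTeller

end

/-! ### The main theorem. -/

theorem mainTheorem3 (κ ν α l l' : ℝ) (m : ℕ) (hκ : 0 < κ) (hν : 1 ≤ ν)
    (hl : 1 / 2 < l) (hl' : 1 / 2 < l') (hll' : l + l' = ν + 1) :
    (∀ x ∈ Set.Ioo (0 : ℝ) 1,
      (PoschlTeller.weight ν m x).im = 0 ∧ 0 ≤ (PoschlTeller.weight ν m x).re) ∧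
    PoschlTeller.ResolvesIdentity
      (PoschlTeller.tailSpace
        (PoschlTeller.eigenstate (1 / κ) l l' (one_div_pos.2 hκ) hl hl') m)
      (PoschlTeller.photonAdded
        (PoschlTeller.eigenstate (1 / κ) l l' (one_div_pos.2 hκ) hl hl')
        (PoschlTeller.secondCoeff κ α ν m) m)
      (PoschlTeller.weight ν m) ∧
    PoschlTeller.ResolvesIdentity
      (PoschlTeller.tailSpace
        (PoschlTeller.eigenstate (1 / κ) l l' (one_div_pos.2 hκ) hl hl') m)
      (PoschlTeller.photonAdded
        (PoschlTeller.eigenstate (1 / κ) l l' (one_div_pos.2 hκ) hl hl')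
        (PoschlTeller.explicitCoeff κ α ν m) m)
      (PoschlTeller.weight ν m) ∧
    (∀ z : ℂ, 0 < ‖z‖ → ‖z‖ < 1 →
      PoschlTeller.weight ν 0 (‖z‖ ^ 2) =
        ((ν / Real.pi * (1 - ‖z‖ ^ 2) ^ (-2 : ℤ) : ℝ) : ℂ)) := by
  have hν0 : 0 < ν := by linarith
  have hΨ := PoschlTeller.orthonormal_eigenstate (1 / κ) l l' (one_div_pos.2 hκ) hl hl'
  have hC : 0 < κ ^ (2 * m) / Real.Gamma (2 * m + ν + 1) :=
    div_pos (by positivity) (Real.Gamma_pos_of_pos (by positivity))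
  refine ⟨fun x hx => ?_, ?_, ?_, fun z hz0 hz1 => ?_⟩
  · obtain ⟨h, _, hnn, _, _, hw, _⟩ := PoschlTeller.exists_weight_eq hν0 m
    rw [hw x hx, Complex.ofReal_im, Complex.ofReal_re]
    have h1 : 0 ≤ ∑' k, PoschlTeller.meijerCoeff ν m k * x ^ k := tsum_nonneg fun k =>
      mul_nonneg (PoschlTeller.meijerCoeff_pos hν0.le m k).le (pow_nonneg hx.1.le k)
    have h2 := hnn x hx
    exact ⟨rfl, by positivity⟩
  · refine PoschlTeller.resolvesIdentity_of_norm_sq hΨ hν0 hC fun n => ?_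
    rw [PoschlTeller.norm_secondCoeff_sq hκ α hν0.le]
    ring
  · refine PoschlTeller.resolvesIdentity_of_norm_sq hΨ hν0 hC fun n => ?_
    rw [PoschlTeller.norm_explicitCoeff_sq hκ α hν0.le]
    ring
  · exact PoschlTeller.weight_zero hν0
      ⟨by positivity, pow_lt_one₀ hz0.le hz1 two_ne_zero⟩
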